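/- **Setting.** A *model* (of the type theory with $\Pi$-types and booleans) is a category $\mathcal{S}$ with a terminal object, a presheaf $\mathsf{Ty}$ on $\mathcal S$, a dependent presheaf $\mathsf{Tm}$ over $\mathsf{Ty}$ that is locally representable (i.e. context extensions $\Gamma\rhd A$ exist), and, in the internal language of presheaves over $\mathcal S$, operations $\Pi : (A:\mathsf{Ty})\,(B:\mathsf{Tm}\,A\to\mathsf{Ty})\to\mathsf{Ty}$, isomorphisms $\mathsf{app}:\mathsf{Tm}(\Pi\,A\,B)\simeq((a:\mathsf{Tm}\,A)\to\mathsf{Tm}(B\,a))$, and $\mathbf B:\mathsf{Ty}$, $\mathsf{true},\mathsf{false}:\mathsf{Tm}\,\mathbf B$, $\mathsf{elim} : (P:\mathsf{Tm}\,\mathbf B\to\mathsf{Ty})\,(t:\mathsf{Tm}(P\,\mathsf{true}))\,(f:\mathsf{Tm}(P\,\mathsf{false}))\,(b:\mathsf{Tm}\,\mathbf B)\to\mathsf{Tm}(P\,b)$ with $\mathsf{elim}\,P\,t\,f\,\mathsf{true}=t$ and $\mathsf{elim}\,P\,t\,f\,\mathsf{false}=f$. Let $F:\mathcal C\to\mathcal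 S$ be a functor into a model. A *displayed model without context extensions* $\mathcal S^\bullet$ over $F$ consists of a dependent presheaf $\mathsf{Ty}^\bullet(A)$ over $\Gamma:\mathcal C^{\mathsf{op}}$, $A\in\mathsf{Ty}(F\Gamma)$; a dependent presheaf $\mathsf{Tm}^\bullet(A^\bullet,a)$ over $\Gamma$, $A$, $A^\bullet\in\mathsf{Ty}^\bullet(A)$, $a\in\mathsf{Tm}(A)$; and operations $\Pi^\bullet$, isomorphisms $\mathsf{app}^\bullet:\mathsf{Tm}^\bullet(\Pi^\bullet A^\bullet B^\bullet, f)\simeq(\{a\}(a^\bullet:\mathsf{Tm}^\bullet A^\bullet a)\to\mathsf{Tm}^\bullet(B^\bullet a^\bullet)(\mathsf{app}\,f\,a))$, $\mathbf B^\bullet$, $\mathsf{true}^\bullet$, $\mathsf{false}^\bullet$, $\mathsf{elim}^\bullet$, internal to presheaves over $\mathcal C$, lying over the operations of $\mathcal S$ and satisfying the displayed versions of the two equations for $\mathsf{elim}$. It *has context extensions* if for all $\Gamma$, $A$, $A^\bullet$ the dependent presheaf of pairs $(a,a^\bullet)$ with $a:\mathsf{Tm}\,A$ and $a^\bullet:\mathsf{Tm}^\bullet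 A^\bullet a$ is locally representable and the projection $(a,a^\bullet)\mapsto a$ preserves context extensions. The categories $\mathcal C,\mathcal S$ have small hom-sets and $\mathsf{Tm}^\bullet$ is valued in small sets. The *displayed presheaf category* $\mathcal P$ of $F$ has as objects pairs of $\Gamma\in\mathcal S$ and a dependent presheaf $\Gamma^\dagger$ of small sets over $\Theta:\mathcal C^{\mathsf{op}}$, $\gamma:F\Theta\to\Gamma$, and as morphisms pairs of $f:\Gamma\to\Delta$ in $\mathcal S$ and a dependent natural transformation $\Gamma^\dagger(\gamma)\to\Delta^\dagger(\gamma\cdot f)$. Let $G:\mathcal P\to\mathcal S$ be the projection, and let $Y:\mathcal C\to\mathcal P$ send $\Gamma$ to $F\Gamma$ with the dependent presheaf $\gamma\mapsto\{g:\Theta\to\Gamma\mid Fg=\gamma\}$. **Statement.** For every model $\mathcal S$, functor $F:\mathcal C\to\mathcal S$ and displayed model without context extensions $\mathcal S^\bullet$ over $F$: 1. $G\circ Y=F$, and $Y$ is fully faithful. 2. There are a displayed model $\mathcal S^\dagger$ over $G:\mathcal P\to\mathcal S$ that has context extensions, and natural actions of $Y$ on displayed types and terms, $\mathsf{Ty}^\bullet_\Gamma(A)\to\mathsf{Ty}^\dagger_{Y\Gamma}(A)$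 and $\mathsf{Tm}^\bullet_\Gamma(A^\bullet,a)\to\mathsf{Tm}^\dagger_{Y\Gamma}(Y A^\bullet,a)$, all of which are bijective. These actions extend uniquely to bijective actions on families of displayed types, and of displayed terms, depending on a displayed term, and they preserve all displayed type-theoretic operations $\Pi$, $\mathsf{app}$, $\mathbf B$, $\mathsf{true}$, $\mathsf{false}$, $\mathsf{elim}$. 3. $\mathcal P$ is equivalent, compatibly with the projections to $\mathcal S$, to the comma (gluing) category $(\widehat{\mathcal C}\downarrow N_F)$, where $\widehat{\mathcal C}$ is the category of presheaves of small sets on $\mathcal C$ and $N_F:\mathcal S\to\widehat{\mathcal C}$ is the Yoneda embedding of $\mathcal S$ followed by precomposition with $F$. -/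

import Mathlib

open CategoryTheory

set_option linter.checkUnivs false

namespace RelativeInduction

universe u v u₁ v₁ u₂ v₂ a b c d e f w

/-! ### Types and terms over a category

Dependent presheaves are written with restriction operations that carry an equation for the index
of the result: if `A[σ] = A'`, a term of `A` restricts along `σ` to a term of `A'`. This is the same
as a functor on the category of elements, and no transports are needed. -/

/-- A presheaf `Ty` on `S` and a dependent presheaf `Tm` over it. -/
structure TyTm (S : Type u) [Category.{v} S] where
  Ty : S → Type a
  tySub : ∀ {Δ Γ : S}, (Δ ⟶ Γ) → Ty Γ → Ty Δ
  tySub_id : ∀ {Γ : S} (A : Ty Γ), tySub (𝟙 Γ) A = A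
  tySub_comp : ∀ {Θ Δ Γ : S} (τ : Θ ⟶ Δ) (σ : Δ ⟶ Γ) (A : Ty Γ),
    tySub (τ ≫ σ) A = tySub τ (tySub σ A)
  Tm : ∀ {Γ : S}, Ty Γ → Type b
  tmSub : ∀ {Δ Γ : S} (σ : Δ ⟶ Γ) {A : Ty Γ} {A' : Ty Δ}, tySub σ A = A' → Tm A → Tm A'
  tmSub_id : ∀ {Γ : S} {A : Ty Γ} (h : tySub (𝟙 Γ) A = A) (x : Tm A), tmSub (𝟙 Γ) h x = x
  tmSub_comp : ∀ {Θ Δ Γ : S} (τ : Θ ⟶ Δ) (σ : Δ ⟶ Γ) {A : Ty Γ} {A' : Ty Δ} {A'' : Ty Θ}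
    (h : tySub σ A = A') (h' : tySub τ A' = A'') (h'' : tySub (τ ≫ σ) A = A'') (x : Tm A),
    tmSub (τ ≫ σ) h'' x = tmSub τ h' (tmSub σ h x)

namespace TyTm

variable {S : Type u} [Category.{v} S] (T : TyTm.{u, v, a, b} S)

theorem tySub_trans {Θ Δ Γ : S} (τ : Θ ⟶ Δ) (σ : Δ ⟶ Γ) {A : T.Ty Γ} {A' : T.Ty Δ}
    {A'' : T.Ty Θ} (h : T.tySub σ A = A') (h' : T.tySub τ A' = A'') :
    T.tySub (τ ≫ σ) A = A'' := by
  subst h h'; exact T.tySub_comp τ σ A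

theorem tySub_of_eq_id {Γ : S} {σ : Γ ⟶ Γ} (hσ : σ = 𝟙 Γ) (A : T.Ty Γ) : T.tySub σ A = A := by
  subst hσ; exact T.tySub_id A

theorem tmSub_of_eq_id {Γ : S} {σ : Γ ⟶ Γ} (hσ : σ = 𝟙 Γ) {A : T.Ty Γ}
    (h : T.tySub σ A = A) (x : T.Tm A) : T.tmSub σ h x = x := by
  subst hσ; exact T.tmSub_id h x

/-- The value at `Γ` of the presheaf of families `Tm A → Ty`: a natural assignment of a type over
`Δ` to every `ρ : Δ ⟶ Γ` and every term of `A[ρ]`. -/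
structure TyFam {Γ : S} (A : T.Ty Γ) where
  app : ∀ {Δ : S} (ρ : Δ ⟶ Γ) {A' : T.Ty Δ}, T.tySub ρ A = A' → T.Tm A' → T.Ty Δ
  nat : ∀ {Θ Δ : S} (σ : Θ ⟶ Δ) (ρ : Δ ⟶ Γ) {A' : T.Ty Δ} {A'' : T.Ty Θ}
    (h : T.tySub ρ A = A') (h' : T.tySub σ A' = A'') (x : T.Tm A'),
    T.tySub σ (app ρ h x) = app (σ ≫ ρ) (T.tySub_trans σ ρ h h') (T.tmSub σ h' x)

namespace TyFam

variable {T}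
variable {Γ : S} {A : T.Ty Γ}

theorem nat' (B : T.TyFam A) {Θ Δ : S} (σ : Θ ⟶ Δ) (ρ : Δ ⟶ Γ) {ρ' : Θ ⟶ Γ} (hρ : σ ≫ ρ = ρ')
    {A' : T.Ty Δ} {A'' : T.Ty Θ} (h : T.tySub ρ A = A') (h' : T.tySub σ A' = A'')
    (h'' : T.tySub ρ' A = A'') {x : T.Tm A'} {x' : T.Tm A''} (hx : T.tmSub σ h' x = x') :
    T.tySub σ (B.app ρ h x) = B.app ρ' h'' x' := by
  subst hρ hx; exact B.nat σ ρ h h' x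

/-- The value `B x` of a family at a term over the same context. -/
def inst (B : T.TyFam A) (x : T.Tm A) : T.Ty Γ := B.app (𝟙 Γ) (T.tySub_id A) x

/-- Restriction of a family along `σ`. -/
def sub (B : T.TyFam A) {Δ : S} (σ : Δ ⟶ Γ) {A' : T.Ty Δ} (hA : T.tySub σ A = A') :
    T.TyFam A' where
  app ρ _ h x := B.app (ρ ≫ σ) (T.tySub_trans ρ σ hA h) x
  nat τ ρ _ _ _ h' _ := B.nat' τ (ρ ≫ σ) (Category.assoc _ _ _).symm _ h' _ rfl

theorem tySub_inst (B : T.TyFam A) {Δ : S} (σ : Δ ⟶ Γ) {A' : T.Ty Δ} (hA : T.tySub σ A = A')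
    {x : T.Tm A} {x' : T.Tm A'} (hx : T.tmSub σ hA x = x') :
    T.tySub σ (B.inst x) = (B.sub σ hA).inst x' :=
  B.nat' σ (𝟙 Γ) (by simp) _ hA _ hx

end TyFam

/-- The value at `Γ` of the presheaf of dependent functions `(x : Tm A) → Tm (B x)`. -/
structure TmFam {Γ : S} {A : T.Ty Γ} (B : T.TyFam A) where
  app : ∀ {Δ : S} (ρ : Δ ⟶ Γ) {A' : T.Ty Δ} (h : T.tySub ρ A = A') (x : T.Tm A')
    {B' : T.Ty Δ}, B.app ρ h x = B' → T.Tm B'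
  nat : ∀ {Θ Δ : S} (σ : Θ ⟶ Δ) (ρ : Δ ⟶ Γ) {A' : T.Ty Δ} {A'' : T.Ty Θ}
    (h : T.tySub ρ A = A') (h' : T.tySub σ A' = A'') (x : T.Tm A')
    {B' : T.Ty Δ} {B'' : T.Ty Θ} (hB : B.app ρ h x = B') (hB' : T.tySub σ B' = B'')
    (hB'' : B.app (σ ≫ ρ) (T.tySub_trans σ ρ h h') (T.tmSub σ h' x) = B''),
    T.tmSub σ hB' (app ρ h x hB) =
      app (σ ≫ ρ) (T.tySub_trans σ ρ h h') (T.tmSub σ h' x) hB''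

namespace TmFam

variable {T}
variable {Γ : S} {A : T.Ty Γ} {B : T.TyFam A}

theorem nat' (t : T.TmFam B) {Θ Δ : S} (σ : Θ ⟶ Δ) (ρ : Δ ⟶ Γ) {ρ' : Θ ⟶ Γ} (hρ : σ ≫ ρ = ρ')
    {A' : T.Ty Δ} {A'' : T.Ty Θ} (h : T.tySub ρ A = A') (h' : T.tySub σ A' = A'')
    (h'' : T.tySub ρ' A = A'') {x : T.Tm A'} {x' : T.Tm A''} (hx : T.tmSub σ h' x = x')
    {B' : T.Ty Δ} {B'' : T.Ty Θ} (hB : B.app ρ h x = B') (hB' : T.tySub σ B' = B'')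
    (hB'' : B.app ρ' h'' x' = B'') :
    T.tmSub σ hB' (t.app ρ h x hB) = t.app ρ' h'' x' hB'' := by
  subst hρ hx; exact t.nat σ ρ h h' x hB hB' hB''

/-- Restriction of a dependent function along `σ`. -/
def sub (t : T.TmFam B) {Δ : S} (σ : Δ ⟶ Γ) {A' : T.Ty Δ} (hA : T.tySub σ A = A') :
    T.TmFam (B.sub σ hA) where
  app ρ _ h x _ hB := t.app (ρ ≫ σ) (T.tySub_trans ρ σ hA h) x hB
  nat τ ρ _ _ _ h' _ _ _ hB hB' hB'' :=
    t.nat' τ (ρ ≫ σ) (Category.assoc _ _ _).symm _ h' _ rfl hB hB' hB''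

end TmFam

/-- The category of elements of `Tm A` restricted to the slice over `Γ`: its objects are a morphism
`p : Δ ⟶ Γ` together with a term of `A[p]`. A terminal object is exactly a context extension
`Γ ▹ A` with its projection and generic term: every `σ : Δ ⟶ Γ` and `x : Tm A[σ]` arise from a
unique morphism `⟨σ, x⟩ : Δ ⟶ Γ ▹ A`. -/
structure TermOver {Γ : S} (A : T.Ty Γ) where
  dom : S
  hom : dom ⟶ Γ
  tm : T.Tm (T.tySub hom A)

namespace TermOver

variable {T}
variable {Γ : S} {A : T.Ty Γ}

@[ext]
structure Hom (X Y : T.TermOver A) where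
  hom : X.dom ⟶ Y.dom
  comm : hom ≫ Y.hom = X.hom
  tm : ∀ h : T.tySub hom (T.tySub Y.hom A) = T.tySub X.hom A, T.tmSub hom h Y.tm = X.tm

instance : Category (T.TermOver A) where
  Hom X Y := Hom X Y
  id X := ⟨𝟙 _, Category.id_comp _, fun h => T.tmSub_id h X.tm⟩
  comp {X Y Z} m n := ⟨m.hom ≫ n.hom, by rw [Category.assoc, n.comm, m.comm], fun h => by
    have h1 : T.tySub n.hom (T.tySub Z.hom A) = T.tySub Y.hom A := by
      rw [← T.tySub_comp, n.comm]
    have h2 : T.tySub m.hom (T.tySub Y.hom A) = T.tySub X.hom A := by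
      rw [← T.tySub_comp, m.comm]
    rw [T.tmSub_comp m.hom n.hom h1 h2 h, n.tm h1, m.tm h2]⟩
  id_comp m := Hom.ext (Category.id_comp _)
  comp_id m := Hom.ext (Category.comp_id _)
  assoc m n k := Hom.ext (Category.assoc _ _ _)

end TermOver

end TyTm

/-! ### Models of the type theory with `Π`-types and booleans -/

/-- A model on the category `S`: a terminal object, types, terms with context extensions, a
`Π`-type former with `Tm (Π A B) ≃ ((x : Tm A) → Tm (B x))`, and a boolean type with a dependent
eliminator; all operations are natural. -/
structure Model (S : Type u) [Category.{v} S] extends TyTm.{u, v, a, b} S where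
  empty : S
  emptyIsTerminal : Limits.IsTerminal empty
  ext : ∀ {Γ : S} (A : Ty Γ), toTyTm.TermOver A
  extIsTerminal : ∀ {Γ : S} (A : Ty Γ), Limits.IsTerminal (ext A)
  pi : ∀ {Γ : S} (A : Ty Γ), toTyTm.TyFam A → Ty Γ
  pi_sub : ∀ {Δ Γ : S} (σ : Δ ⟶ Γ) (A : Ty Γ) (B : toTyTm.TyFam A),
    tySub σ (pi A B) = pi (tySub σ A) (B.sub σ rfl)
  app : ∀ {Γ : S} {A : Ty Γ} {B : toTyTm.TyFam A}, Tm (pi A B) ≃ toTyTm.TmFam B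
  app_sub : ∀ {Δ Γ : S} (σ : Δ ⟶ Γ) {A : Ty Γ} {B : toTyTm.TyFam A} (g : Tm (pi A B)),
    app (tmSub σ (pi_sub σ A B) g) = (app g).sub σ rfl
  bool : ∀ Γ : S, Ty Γ
  bool_sub : ∀ {Δ Γ : S} (σ : Δ ⟶ Γ), tySub σ (bool Γ) = bool Δ
  tt : ∀ Γ : S, Tm (bool Γ)
  tt_sub : ∀ {Δ Γ : S} (σ : Δ ⟶ Γ), tmSub σ (bool_sub σ) (tt Γ) = tt Δ
  ff : ∀ Γ : S, Tm (bool Γ)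
  ff_sub : ∀ {Δ Γ : S} (σ : Δ ⟶ Γ), tmSub σ (bool_sub σ) (ff Γ) = ff Δ
  elim : ∀ {Γ : S} (P : toTyTm.TyFam (bool Γ)) (_ : Tm (P.inst (tt Γ))) (_ : Tm (P.inst (ff Γ)))
    (x : Tm (bool Γ)), Tm (P.inst x)
  elim_sub : ∀ {Δ Γ : S} (σ : Δ ⟶ Γ) (P : toTyTm.TyFam (bool Γ)) (t : Tm (P.inst (tt Γ)))
    (s : Tm (P.inst (ff Γ))) (x : Tm (bool Γ)),
    tmSub σ (P.tySub_inst σ (bool_sub σ) rfl) (elim P t s x) =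
      elim (P.sub σ (bool_sub σ)) (tmSub σ (P.tySub_inst σ (bool_sub σ) (tt_sub σ)) t)
        (tmSub σ (P.tySub_inst σ (bool_sub σ) (ff_sub σ)) s) (tmSub σ (bool_sub σ) x)
  elim_tt : ∀ {Γ : S} (P : toTyTm.TyFam (bool Γ)) (t : Tm (P.inst (tt Γ)))
    (s : Tm (P.inst (ff Γ))), elim P t s (tt Γ) = t
  elim_ff : ∀ {Γ : S} (P : toTyTm.TyFam (bool Γ)) (t : Tm (P.inst (tt Γ)))
    (s : Tm (P.inst (ff Γ))), elim P t s (ff Γ) = s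

/-! ### Displayed types and terms over a functor -/

/-- A dependent presheaf `Ty` of displayed types over `Γ : Cᵒᵖ`, `A : Ty (F Γ)`, and a dependent
presheaf `Tm` of displayed terms over `Γ`, `A`, a displayed type over `A` and `x : Tm A`. -/
structure DispTyTm {C : Type u₁} [Category.{v₁} C] {S : Type u₂} [Category.{v₂} S]
    (T : TyTm.{u₂, v₂, a, b} S) (F : C ⥤ S) where
  Ty : ∀ Γ : C, T.Ty (F.obj Γ) → Type c
  tySub : ∀ {Δ Γ : C} (σ : Δ ⟶ Γ) {A : T.Ty (F.obj Γ)} {A' : T.Ty (F.obj Δ)},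
    T.tySub (F.map σ) A = A' → Ty Γ A → Ty Δ A'
  tySub_id : ∀ {Γ : C} {A : T.Ty (F.obj Γ)} (h : T.tySub (F.map (𝟙 Γ)) A = A) (X : Ty Γ A),
    tySub (𝟙 Γ) h X = X
  tySub_comp : ∀ {Θ Δ Γ : C} (τ : Θ ⟶ Δ) (σ : Δ ⟶ Γ) {A : T.Ty (F.obj Γ)} {A' : T.Ty (F.obj Δ)}
    {A'' : T.Ty (F.obj Θ)} (h : T.tySub (F.map σ) A = A') (h' : T.tySub (F.map τ) A' = A'')
    (h'' : T.tySub (F.map (τ ≫ σ)) A = A'') (X : Ty Γ A),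
    tySub (τ ≫ σ) h'' X = tySub τ h' (tySub σ h X)
  Tm : ∀ {Γ : C} {A : T.Ty (F.obj Γ)}, Ty Γ A → T.Tm A → Type d
  tmSub : ∀ {Δ Γ : C} (σ : Δ ⟶ Γ) {A : T.Ty (F.obj Γ)} {A' : T.Ty (F.obj Δ)}
    {X : Ty Γ A} {X' : Ty Δ A'} {x : T.Tm A} {x' : T.Tm A'} (h : T.tySub (F.map σ) A = A'),
    tySub σ h X = X' → T.tmSub (F.map σ) h x = x' → Tm X x → Tm X' x'
  tmSub_id : ∀ {Γ : C} {A : T.Ty (F.obj Γ)} {X : Ty Γ A} {x : T.Tm A}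
    (h : T.tySub (F.map (𝟙 Γ)) A = A) (hX : tySub (𝟙 Γ) h X = X)
    (hx : T.tmSub (F.map (𝟙 Γ)) h x = x) (y : Tm X x), tmSub (𝟙 Γ) h hX hx y = y
  tmSub_comp : ∀ {Θ Δ Γ : C} (τ : Θ ⟶ Δ) (σ : Δ ⟶ Γ) {A : T.Ty (F.obj Γ)} {A' : T.Ty (F.obj Δ)}
    {A'' : T.Ty (F.obj Θ)} {X : Ty Γ A} {X' : Ty Δ A'} {X'' : Ty Θ A''}
    {x : T.Tm A} {x' : T.Tm A'} {x'' : T.Tm A''}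
    (h : T.tySub (F.map σ) A = A') (hX : tySub σ h X = X') (hx : T.tmSub (F.map σ) h x = x')
    (h' : T.tySub (F.map τ) A' = A'') (hX' : tySub τ h' X' = X'')
    (hx' : T.tmSub (F.map τ) h' x' = x'')
    (h'' : T.tySub (F.map (τ ≫ σ)) A = A'') (hX'' : tySub (τ ≫ σ) h'' X = X'')
    (hx'' : T.tmSub (F.map (τ ≫ σ)) h'' x = x'') (y : Tm X x),
    tmSub (τ ≫ σ) h'' hX'' hx'' y = tmSub τ h' hX' hx' (tmSub σ h hX hx y)

namespace DispTyTm

variable {C : Type u₁} [Category.{v₁} C] {S : Type u₂} [Category.{v₂} S]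
  {T : TyTm.{u₂, v₂, a, b} S} {F : C ⥤ S} (D : DispTyTm.{u₁, v₁, u₂, v₂, a, b, c, d} T F)

/-- Transport of displayed terms along equalities of the indices. -/
def castTm {Γ : C} {A : T.Ty (F.obj Γ)} {X X' : D.Ty Γ A} {x x' : T.Tm A}
    (hX : X = X') (hx : x = x') (y : D.Tm X x) : D.Tm X' x' :=
  cast (by rw [hX, hx]) y

theorem base_id (Γ : C) (A : T.Ty (F.obj Γ)) : T.tySub (F.map (𝟙 Γ)) A = A :=
  T.tySub_of_eq_id (F.map_id Γ) A

theorem base_trans {Θ Δ Γ : C} (τ : Θ ⟶ Δ) (σ : Δ ⟶ Γ) {A : T.Ty (F.obj Γ)}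
    {A' : T.Ty (F.obj Δ)} {A'' : T.Ty (F.obj Θ)} (h : T.tySub (F.map σ) A = A')
    (h' : T.tySub (F.map τ) A' = A'') : T.tySub (F.map (τ ≫ σ)) A = A'' := by
  rw [F.map_comp]; exact T.tySub_trans _ _ h h'

theorem tySub_trans {Θ Δ Γ : C} (τ : Θ ⟶ Δ) (σ : Δ ⟶ Γ) {A : T.Ty (F.obj Γ)}
    {A' : T.Ty (F.obj Δ)} {A'' : T.Ty (F.obj Θ)} {h : T.tySub (F.map σ) A = A'}
    {h' : T.tySub (F.map τ) A' = A''} {X : D.Ty Γ A} {X' : D.Ty Δ A'} {X'' : D.Ty Θ A''}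
    (hX : D.tySub σ h X = X') (hX' : D.tySub τ h' X' = X'') :
    D.tySub (τ ≫ σ) (base_trans τ σ h h') X = X'' := by
  rw [D.tySub_comp τ σ h h', hX, hX']

/-- The value at `Γ` of the presheaf of displayed families
`{x : Tm A} → (y : Tm X x) → Ty (B x)` over a family `B : Tm A → Ty` at `F Γ`. -/
structure TyFam {Γ : C} {A : T.Ty (F.obj Γ)} (X : D.Ty Γ A) (B : T.TyFam A) where
  app : ∀ {Δ : C} (ρ : Δ ⟶ Γ) {A' : T.Ty (F.obj Δ)} {X' : D.Ty Δ A'}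
    (h : T.tySub (F.map ρ) A = A') (_ : D.tySub ρ h X = X') {x : T.Tm A'} (_ : D.Tm X' x)
    {B' : T.Ty (F.obj Δ)}, B.app (F.map ρ) h x = B' → D.Ty Δ B'
  nat : ∀ {Θ Δ : C} (σ : Θ ⟶ Δ) (ρ : Δ ⟶ Γ) {A' : T.Ty (F.obj Δ)} {A'' : T.Ty (F.obj Θ)}
    {X' : D.Ty Δ A'} {X'' : D.Ty Θ A''} {x : T.Tm A'} {x' : T.Tm A''}
    (h : T.tySub (F.map ρ) A = A') (hX : D.tySub ρ h X = X')
    (h' : T.tySub (F.map σ) A' = A'') (hX' : D.tySub σ h' X' = X'')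
    (hx : T.tmSub (F.map σ) h' x = x') (y : D.Tm X' x)
    {B' : T.Ty (F.obj Δ)} {B'' : T.Ty (F.obj Θ)} (hB : B.app (F.map ρ) h x = B')
    (hB' : T.tySub (F.map σ) B' = B'')
    (hB'' : B.app (F.map (σ ≫ ρ)) (base_trans σ ρ h h') x' = B''),
    D.tySub σ hB' (app ρ h hX y hB) =
      app (σ ≫ ρ) (base_trans σ ρ h h') (D.tySub_trans σ ρ hX hX')
        (D.tmSub σ h' hX' hx y) hB''

namespace TyFam

variable {D}
variable {Γ : C} {A : T.Ty (F.obj Γ)} {X : D.Ty Γ A} {B : T.TyFam A}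

theorem app_congr (E : D.TyFam X B) {Δ : C} {ρ ρ' : Δ ⟶ Γ} (hρ : ρ = ρ')
    {A' : T.Ty (F.obj Δ)} {X' X'' : D.Ty Δ A'} (hXX : X' = X'')
    (h : T.tySub (F.map ρ) A = A') (hX : D.tySub ρ h X = X')
    (h' : T.tySub (F.map ρ') A = A') (hX' : D.tySub ρ' h' X = X'')
    {x x' : T.Tm A'} (hx : x = x') {y : D.Tm X' x} {y' : D.Tm X'' x'}
    (hy : D.castTm hXX hx y = y') {B' : T.Ty (F.obj Δ)} (hB : B.app (F.map ρ) h x = B')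
    (hB' : B.app (F.map ρ') h' x' = B') :
    E.app ρ h hX y hB = E.app ρ' h' hX' y' hB' := by
  subst hρ hXX hx hy; rfl

theorem nat' (E : D.TyFam X B) {Θ Δ : C} (σ : Θ ⟶ Δ) (ρ : Δ ⟶ Γ) {ρ' : Θ ⟶ Γ}
    (hρ : σ ≫ ρ = ρ') {A' : T.Ty (F.obj Δ)} {A'' : T.Ty (F.obj Θ)}
    {X' : D.Ty Δ A'} {X'' : D.Ty Θ A''} {x : T.Tm A'} {x' : T.Tm A''}
    (h : T.tySub (F.map ρ) A = A') (hX : D.tySub ρ h X = X')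
    (h' : T.tySub (F.map σ) A' = A'') (hX' : D.tySub σ h' X' = X'')
    (hx : T.tmSub (F.map σ) h' x = x') {y : D.Tm X' x} {y' : D.Tm X'' x'}
    (hy : D.tmSub σ h' hX' hx y = y')
    (h'' : T.tySub (F.map ρ') A = A'') (hX'' : D.tySub ρ' h'' X = X'')
    {B' : T.Ty (F.obj Δ)} {B'' : T.Ty (F.obj Θ)} (hB : B.app (F.map ρ) h x = B')
    (hB' : T.tySub (F.map σ) B' = B'') (hB'' : B.app (F.map ρ') h'' x' = B'') :
    D.tySub σ hB' (E.app ρ h hX y hB) = E.app ρ' h'' hX'' y' hB'' := by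
  subst hρ hy; exact E.nat σ ρ h hX h' hX' hx y hB hB' hB''

theorem base_inst (B : T.TyFam A) (x : T.Tm A) :
    B.app (F.map (𝟙 Γ)) (base_id Γ A) x = B.inst x := by
  have : ∀ (ρ : F.obj Γ ⟶ F.obj Γ) (h : T.tySub ρ A = A), ρ = 𝟙 _ → B.app ρ h x = B.inst x := by
    rintro _ h rfl; rfl
  exact this _ _ (F.map_id Γ)

theorem base_sub (B : T.TyFam A) {Θ Δ : C} (ρ : Θ ⟶ Δ) (σ : Δ ⟶ Γ) {A' : T.Ty (F.obj Δ)}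
    {A'' : T.Ty (F.obj Θ)} (h : T.tySub (F.map σ) A = A') (h' : T.tySub (F.map ρ) A' = A'')
    (x : T.Tm A'') :
    B.app (F.map (ρ ≫ σ)) (base_trans ρ σ h h') x = (B.sub (F.map σ) h).app (F.map ρ) h' x := by
  have : ∀ (k : F.obj Θ ⟶ F.obj Γ) (hk : T.tySub k A = A''), k = F.map ρ ≫ F.map σ →
      B.app k hk x = (B.sub (F.map σ) h).app (F.map ρ) h' x := by
    rintro _ h rfl; rfl
  exact this _ _ (F.map_comp ρ σ)

/-- The value of a displayed family at a displayed term over the same context. -/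
def inst (E : D.TyFam X B) {x : T.Tm A} (y : D.Tm X x) : D.Ty Γ (B.inst x) :=
  E.app (𝟙 Γ) (base_id Γ A) (D.tySub_id _ X) y (base_inst B x)

/-- Restriction of a displayed family along `σ`. -/
def sub (E : D.TyFam X B) {Δ : C} (σ : Δ ⟶ Γ) {A' : T.Ty (F.obj Δ)} {X' : D.Ty Δ A'}
    (hA : T.tySub (F.map σ) A = A') (hX : D.tySub σ hA X = X') :
    D.TyFam X' (B.sub (F.map σ) hA) where
  app ρ _ _ h hX' _ y _ hB :=
    E.app (ρ ≫ σ) (base_trans ρ σ hA h) (D.tySub_trans ρ σ hX hX') y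
      ((base_sub B ρ σ hA h _).trans hB)
  nat τ ρ _ _ _ _ _ _ _ _ h' hX'' hx _ _ _ _ hB' _ :=
    E.nat' τ (ρ ≫ σ) (Category.assoc _ _ _).symm _ _ h' hX'' hx rfl _ _ _ hB' _

theorem tySub_inst (E : D.TyFam X B) {Δ : C} (σ : Δ ⟶ Γ) {A' : T.Ty (F.obj Δ)} {X' : D.Ty Δ A'}
    (hA : T.tySub (F.map σ) A = A') (hX : D.tySub σ hA X = X') {x : T.Tm A} {x' : T.Tm A'}
    (hx : T.tmSub (F.map σ) hA x = x') {y : D.Tm X x} {y' : D.Tm X' x'}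
    (hy : D.tmSub σ hA hX hx y = y') :
    D.tySub σ (B.tySub_inst (F.map σ) hA hx) (E.inst y) = (E.sub σ hA hX).inst y' :=
  E.nat' σ (𝟙 Γ) (by simp) _ _ hA hX hx hy _ _ _ _ _

end TyFam

/-- The value at `Γ` of the presheaf of displayed dependent functions
`{x : Tm A} → (y : Tm X x) → Tm (E y) (t x)` over a dependent function `t` at `F Γ`. -/
structure TmFam {Γ : C} {A : T.Ty (F.obj Γ)} {X : D.Ty Γ A} {B : T.TyFam A} (E : D.TyFam X B)
    (t : T.TmFam B) where
  app : ∀ {Δ : C} (ρ : Δ ⟶ Γ) {A' : T.Ty (F.obj Δ)} {X' : D.Ty Δ A'}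
    (h : T.tySub (F.map ρ) A = A') (hX : D.tySub ρ h X = X') {x : T.Tm A'} (y : D.Tm X' x)
    {B' : T.Ty (F.obj Δ)} (hB : B.app (F.map ρ) h x = B') {t' : T.Tm B'},
    t.app (F.map ρ) h x hB = t' → D.Tm (E.app ρ h hX y hB) t'
  nat : ∀ {Θ Δ : C} (σ : Θ ⟶ Δ) (ρ : Δ ⟶ Γ) {A' : T.Ty (F.obj Δ)} {A'' : T.Ty (F.obj Θ)}
    {X' : D.Ty Δ A'} {X'' : D.Ty Θ A''} {x : T.Tm A'} {x' : T.Tm A''}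
    (h : T.tySub (F.map ρ) A = A') (hX : D.tySub ρ h X = X')
    (h' : T.tySub (F.map σ) A' = A'') (hX' : D.tySub σ h' X' = X'')
    (hx : T.tmSub (F.map σ) h' x = x') (y : D.Tm X' x)
    {B' : T.Ty (F.obj Δ)} {B'' : T.Ty (F.obj Θ)} (hB : B.app (F.map ρ) h x = B')
    (hB' : T.tySub (F.map σ) B' = B'')
    (hB'' : B.app (F.map (σ ≫ ρ)) (base_trans σ ρ h h') x' = B'')
    {t' : T.Tm B'} {t'' : T.Tm B''} (ht : t.app (F.map ρ) h x hB = t')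
    (ht' : T.tmSub (F.map σ) hB' t' = t'')
    (ht'' : t.app (F.map (σ ≫ ρ)) (base_trans σ ρ h h') x' hB'' = t''),
    D.tmSub σ hB' (E.nat σ ρ h hX h' hX' hx y hB hB' hB'') ht' (app ρ h hX y hB ht) =
      app (σ ≫ ρ) (base_trans σ ρ h h') (D.tySub_trans σ ρ hX hX')
        (D.tmSub σ h' hX' hx y) hB'' ht''

namespace TmFam

variable {D}
variable {Γ : C} {A : T.Ty (F.obj Γ)} {X : D.Ty Γ A} {B : T.TyFam A} {E : D.TyFam X B}
  {t : T.TmFam B}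

theorem nat' (s : D.TmFam E t) {Θ Δ : C} (σ : Θ ⟶ Δ) (ρ : Δ ⟶ Γ) {ρ' : Θ ⟶ Γ}
    (hρ : σ ≫ ρ = ρ') {A' : T.Ty (F.obj Δ)} {A'' : T.Ty (F.obj Θ)}
    {X' : D.Ty Δ A'} {X'' : D.Ty Θ A''} {x : T.Tm A'} {x' : T.Tm A''}
    (h : T.tySub (F.map ρ) A = A') (hX : D.tySub ρ h X = X')
    (h' : T.tySub (F.map σ) A' = A'') (hX' : D.tySub σ h' X' = X'')
    (hx : T.tmSub (F.map σ) h' x = x') {y : D.Tm X' x} {y' : D.Tm X'' x'}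
    (hy : D.tmSub σ h' hX' hx y = y')
    (h'' : T.tySub (F.map ρ') A = A'') (hX'' : D.tySub ρ' h'' X = X'')
    {B' : T.Ty (F.obj Δ)} {B'' : T.Ty (F.obj Θ)} (hB : B.app (F.map ρ) h x = B')
    (hB' : T.tySub (F.map σ) B' = B'') (hB'' : B.app (F.map ρ') h'' x' = B'')
    {t' : T.Tm B'} {t'' : T.Tm B''} (ht : t.app (F.map ρ) h x hB = t')
    (ht' : T.tmSub (F.map σ) hB' t' = t'') (ht'' : t.app (F.map ρ') h'' x' hB'' = t'')
    (hE : D.tySub σ hB' (E.app ρ h hX y hB) = E.app ρ' h'' hX'' y' hB'') :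
    D.tmSub σ hB' hE ht' (s.app ρ h hX y hB ht) = s.app ρ' h'' hX'' y' hB'' ht'' := by
  subst hρ hy; exact s.nat σ ρ h hX h' hX' hx y hB hB' hB'' ht ht' ht''

theorem base_sub {Θ Δ : C} (ρ : Θ ⟶ Δ) (σ : Δ ⟶ Γ) {A' : T.Ty (F.obj Δ)}
    {A'' : T.Ty (F.obj Θ)} (h : T.tySub (F.map σ) A = A') (h' : T.tySub (F.map ρ) A' = A'')
    {t' : T.TmFam (B.sub (F.map σ) h)} (ht : t.sub (F.map σ) h = t') (x : T.Tm A'')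
    {B' : T.Ty (F.obj Θ)} (hB : (B.sub (F.map σ) h).app (F.map ρ) h' x = B')
    (hB' : B.app (F.map (ρ ≫ σ)) (base_trans ρ σ h h') x = B') :
    t.app (F.map (ρ ≫ σ)) (base_trans ρ σ h h') x hB' = t'.app (F.map ρ) h' x hB := by
  subst ht
  have : ∀ (k : F.obj Θ ⟶ F.obj Γ) (hk : T.tySub k A = A'') (hkB : B.app k hk x = B'),
      k = F.map ρ ≫ F.map σ →
      t.app k hk x hkB = (t.sub (F.map σ) h).app (F.map ρ) h' x hB := by
    rintro _ h _ rfl; rfl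
  exact this _ _ _ (F.map_comp ρ σ)

/-- Restriction of a displayed dependent function along `σ`. -/
def sub (s : D.TmFam E t) {Δ : C} (σ : Δ ⟶ Γ) {A' : T.Ty (F.obj Δ)} {X' : D.Ty Δ A'}
    (hA : T.tySub (F.map σ) A = A') (hX : D.tySub σ hA X = X')
    {t' : T.TmFam (B.sub (F.map σ) hA)} (ht : t.sub (F.map σ) hA = t') :
    D.TmFam (E.sub σ hA hX) t' where
  app ρ _ _ h hX' x y _ hB _ ht' :=
    s.app (ρ ≫ σ) (base_trans ρ σ hA h) (D.tySub_trans ρ σ hX hX') y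
      ((TyFam.base_sub B ρ σ hA h _).trans hB) ((base_sub ρ σ hA h ht x hB _).trans ht')
  nat τ ρ _ _ _ _ _ _ _ _ h' hX'' hx _ _ _ _ hB' _ _ _ _ _ _ :=
    s.nat' τ (ρ ≫ σ) (Category.assoc _ _ _).symm _ _ h' hX'' hx rfl _ _ _ hB' _ _ _ _ _

end TmFam

/-- The category of elements, over the slice `C / Γ`, of the dependent presheaf of pairs
`(x : Tm A) × Tm X x`. A terminal object is exactly an extended context `Γ ▹ X` with its
projection and its generic pair. -/
structure TermOver {Γ : C} {A : T.Ty (F.obj Γ)} (X : D.Ty Γ A) where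
  dom : C
  hom : dom ⟶ Γ
  tm : T.Tm (T.tySub (F.map hom) A)
  dtm : D.Tm (D.tySub hom rfl X) tm

namespace TermOver

variable {D}
variable {Γ : C} {A : T.Ty (F.obj Γ)} {X : D.Ty Γ A}

@[ext]
structure Hom (U V : D.TermOver X) where
  hom : U.dom ⟶ V.dom
  comm : hom ≫ V.hom = U.hom
  tm : ∀ h : T.tySub (F.map hom) (T.tySub (F.map V.hom) A) = T.tySub (F.map U.hom) A,
    T.tmSub (F.map hom) h V.tm = U.tm
  dtm : ∀ (h : T.tySub (F.map hom) (T.tySub (F.map V.hom) A) = T.tySub (F.map U.hom) A)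
    (hX : D.tySub hom h (D.tySub V.hom rfl X) = D.tySub U.hom rfl X),
    D.tmSub hom h hX (tm h) V.dtm = U.dtm

theorem Hom.base {U V : D.TermOver X} (m : Hom U V) :
    T.tySub (F.map m.hom) (T.tySub (F.map V.hom) A) = T.tySub (F.map U.hom) A := by
  rw [← T.tySub_comp, ← F.map_comp, m.comm]

theorem Hom.disp {U V : D.TermOver X} (m : Hom U V) :
    D.tySub m.hom m.base (D.tySub V.hom rfl X) = D.tySub U.hom rfl X := by
  have : ∀ (k : U.dom ⟶ Γ) (hk : T.tySub (F.map k) A = T.tySub (F.map U.hom) A), k = U.hom →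
      D.tySub k hk X = D.tySub U.hom rfl X := by
    rintro _ _ rfl; rfl
  rw [← D.tySub_comp m.hom V.hom rfl m.base (base_trans _ _ rfl m.base)]
  exact this _ _ m.comm

instance : Category (D.TermOver X) where
  Hom U V := Hom U V
  id U := ⟨𝟙 _, Category.id_comp _, fun h => T.tmSub_of_eq_id (F.map_id _) h U.tm,
    fun h hX => D.tmSub_id h hX _ U.dtm⟩
  comp {U V W} m n :=
    have htm : ∀ h, T.tmSub (F.map (m.hom ≫ n.hom)) h W.tm = U.tm := fun h => by
      have : ∀ (k : F.obj U.dom ⟶ F.obj W.dom) (hk : T.tySub k _ = _),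
          k = F.map m.hom ≫ F.map n.hom → T.tmSub k hk W.tm = U.tm := by
        rintro _ hk rfl
        rw [T.tmSub_comp (F.map m.hom) (F.map n.hom) n.base m.base hk, n.tm, m.tm]
      exact this _ h (F.map_comp _ _)
    ⟨m.hom ≫ n.hom, by rw [Category.assoc, n.comm, m.comm], htm, fun h hX => by
      rw [D.tmSub_comp m.hom n.hom n.base n.disp (n.tm n.base) m.base m.disp (m.tm m.base),
        n.dtm n.base n.disp, m.dtm m.base m.disp]⟩
  id_comp m := Hom.ext (Category.id_comp _)
  comp_id m := Hom.ext (Category.comp_id _)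
  assoc m n k := Hom.ext (Category.assoc _ _ _)

/-- The first projection `(x, y) ↦ x`, lying over the functor `F`. -/
def fst (X : D.Ty Γ A) : D.TermOver X ⥤ T.TermOver A where
  obj U := ⟨F.obj U.dom, F.map U.hom, U.tm⟩
  map m := ⟨F.map (Hom.hom m), by
    rw [← F.map_comp, Hom.comm m], fun h => Hom.tm m h⟩
  map_id U := TyTm.TermOver.Hom.ext (F.map_id _)
  map_comp m n := TyTm.TermOver.Hom.ext (F.map_comp _ _)

end TermOver

/-- The dependent presheaf `(x : Tm A) × Tm X x` is locally representable. -/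
def IsLocallyRepresentable : Prop :=
  ∀ (Γ : C) (A : T.Ty (F.obj Γ)) (X : D.Ty Γ A),
    ∃ U : D.TermOver X, Nonempty (Limits.IsTerminal U)

/-- The first projection preserves context extensions: `F` sends an extended context `Γ ▹ X`, with
its projection and the first component of its generic pair, to an extended context `F Γ ▹ A`. -/
def PreservesContextExtensions : Prop :=
  ∀ (Γ : C) (A : T.Ty (F.obj Γ)) (X : D.Ty Γ A) (U : D.TermOver X),
    Limits.IsTerminal U → Nonempty (Limits.IsTerminal ((TermOver.fst X).obj U))

/-- The first projection preserves virtual context extensions: for every dependent presheaf `P`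
over the terms of `A`, restriction along the first projection is a bijection from the elements of
`(x : Tm A) → P x` to the elements of `((x, y) : (x : Tm A) × Tm X x) → P x`. -/
def PreservesVirtualContextExtensions : Prop :=
  ∀ (Γ : C) (A : T.Ty (F.obj Γ)) (X : D.Ty Γ A) (P : (T.TermOver A)ᵒᵖ ⥤ Type w),
    Function.Bijective (fun s : P.sections =>
      (⟨fun U => s.1 ((TermOver.fst X).op.obj U), fun m => s.2 ((TermOver.fst X).op.map m)⟩ :
        ((TermOver.fst X).op ⋙ P).sections))

end DispTyTm

/-- A displayed model without context extensions over `F : C ⥤ S`. -/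
structure DispModel {C : Type u₁} [Category.{v₁} C] {S : Type u₂} [Category.{v₂} S]
    (M : Model.{u₂, v₂, a, b} S) (F : C ⥤ S) extends
    DispTyTm.{u₁, v₁, u₂, v₂, a, b, c, d} M.toTyTm F where
  pi : ∀ {Γ : C} {A : M.Ty (F.obj Γ)} {B : M.TyFam A} (X : Ty Γ A),
    toDispTyTm.TyFam X B → Ty Γ (M.pi A B)
  pi_sub : ∀ {Δ Γ : C} (σ : Δ ⟶ Γ) {A : M.Ty (F.obj Γ)} {B : M.TyFam A} (X : Ty Γ A)
    (E : toDispTyTm.TyFam X B),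
    tySub σ (M.pi_sub (F.map σ) A B) (pi X E) = pi (tySub σ rfl X) (E.sub σ rfl rfl)
  app : ∀ {Γ : C} {A : M.Ty (F.obj Γ)} {B : M.TyFam A} {X : Ty Γ A}
    {E : toDispTyTm.TyFam X B} {g : M.Tm (M.pi A B)},
    Tm (pi X E) g ≃ toDispTyTm.TmFam E (M.app g)
  app_sub : ∀ {Δ Γ : C} (σ : Δ ⟶ Γ) {A : M.Ty (F.obj Γ)} {B : M.TyFam A} {X : Ty Γ A}
    {E : toDispTyTm.TyFam X B} {g : M.Tm (M.pi A B)} (k : Tm (pi X E) g),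
    app (tmSub σ (M.pi_sub (F.map σ) A B) (pi_sub σ X E) rfl k) =
      (app k).sub σ rfl rfl (M.app_sub (F.map σ) g).symm
  bool : ∀ Γ : C, Ty Γ (M.bool (F.obj Γ))
  bool_sub : ∀ {Δ Γ : C} (σ : Δ ⟶ Γ), tySub σ (M.bool_sub (F.map σ)) (bool Γ) = bool Δ
  tt : ∀ Γ : C, Tm (bool Γ) (M.tt (F.obj Γ))
  tt_sub : ∀ {Δ Γ : C} (σ : Δ ⟶ Γ),
    tmSub σ (M.bool_sub (F.map σ)) (bool_sub σ) (M.tt_sub (F.map σ)) (tt Γ) = tt Δ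
  ff : ∀ Γ : C, Tm (bool Γ) (M.ff (F.obj Γ))
  ff_sub : ∀ {Δ Γ : C} (σ : Δ ⟶ Γ),
    tmSub σ (M.bool_sub (F.map σ)) (bool_sub σ) (M.ff_sub (F.map σ)) (ff Γ) = ff Δ
  elim : ∀ {Γ : C} {P : M.TyFam (M.bool (F.obj Γ))} (Q : toDispTyTm.TyFam (bool Γ) P)
    {t : M.Tm (P.inst (M.tt (F.obj Γ)))} {s : M.Tm (P.inst (M.ff (F.obj Γ)))}
    (_ : Tm (Q.inst (tt Γ)) t) (_ : Tm (Q.inst (ff Γ)) s)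
    {x : M.Tm (M.bool (F.obj Γ))} (y : Tm (bool Γ) x), Tm (Q.inst y) (M.elim P t s x)
  elim_sub : ∀ {Δ Γ : C} (σ : Δ ⟶ Γ) {P : M.TyFam (M.bool (F.obj Γ))}
    (Q : toDispTyTm.TyFam (bool Γ) P)
    {t : M.Tm (P.inst (M.tt (F.obj Γ)))} {s : M.Tm (P.inst (M.ff (F.obj Γ)))}
    (t' : Tm (Q.inst (tt Γ)) t) (s' : Tm (Q.inst (ff Γ)) s)
    {x : M.Tm (M.bool (F.obj Γ))} (y : Tm (bool Γ) x),
    tmSub σ _ (Q.tySub_inst σ (M.bool_sub (F.map σ)) (bool_sub σ) rfl rfl)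
        (M.elim_sub (F.map σ) P t s x) (elim Q t' s' y) =
      elim (Q.sub σ (M.bool_sub (F.map σ)) (bool_sub σ))
        (tmSub σ _ (Q.tySub_inst σ _ (bool_sub σ) (M.tt_sub (F.map σ)) (tt_sub σ)) rfl t')
        (tmSub σ _ (Q.tySub_inst σ _ (bool_sub σ) (M.ff_sub (F.map σ)) (ff_sub σ)) rfl s')
        (tmSub σ (M.bool_sub (F.map σ)) (bool_sub σ) rfl y)
  elim_tt : ∀ {Γ : C} {P : M.TyFam (M.bool (F.obj Γ))} (Q : toDispTyTm.TyFam (bool Γ) P)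
    {t : M.Tm (P.inst (M.tt (F.obj Γ)))} {s : M.Tm (P.inst (M.ff (F.obj Γ)))}
    (t' : Tm (Q.inst (tt Γ)) t) (s' : Tm (Q.inst (ff Γ)) s),
    toDispTyTm.castTm rfl (M.elim_tt P t s) (elim Q t' s' (tt Γ)) = t'
  elim_ff : ∀ {Γ : C} {P : M.TyFam (M.bool (F.obj Γ))} (Q : toDispTyTm.TyFam (bool Γ) P)
    {t : M.Tm (P.inst (M.tt (F.obj Γ)))} {s : M.Tm (P.inst (M.ff (F.obj Γ)))}
    (t' : Tm (Q.inst (tt Γ)) t) (s' : Tm (Q.inst (ff Γ)) s),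
    toDispTyTm.castTm rfl (M.elim_ff P t s) (elim Q t' s' (ff Γ)) = s'

/-! ### Actions on displayed types and terms -/

/-- A relation is the graph of a bijection. -/
def IsBijectiveRel {α : Sort u} {β : Sort v} (R : α → β → Prop) : Prop :=
  (∀ x, ∃! y, R x y) ∧ (∀ y, ∃! x, R x y)

section Action

variable {C : Type u₁} [Category.{v₁} C] {P : Type u} [Category.{v} P]
  {S : Type u₂} [Category.{v₂} S]

/-- Natural actions of a functor `Y : C ⥤ P` over `S` on displayed types and terms. -/
structure DispAction {T : TyTm.{u₂, v₂, a, b} S} (Y : C ⥤ P) (G : P ⥤ S)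
    (D : DispTyTm.{u₁, v₁, u₂, v₂, a, b, c, d} T (Y ⋙ G))
    (D' : DispTyTm.{u, v, u₂, v₂, a, b, e, f} T G) where
  ty : ∀ {Γ : C} {A : T.Ty (G.obj (Y.obj Γ))}, D.Ty Γ A → D'.Ty (Y.obj Γ) A
  ty_sub : ∀ {Δ Γ : C} (σ : Δ ⟶ Γ) {A : T.Ty (G.obj (Y.obj Γ))} {A' : T.Ty (G.obj (Y.obj Δ))}
    (h : T.tySub (G.map (Y.map σ)) A = A') (X : D.Ty Γ A),
    ty (D.tySub σ h X) = D'.tySub (Y.map σ) h (ty X)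
  tm : ∀ {Γ : C} {A : T.Ty (G.obj (Y.obj Γ))} {X : D.Ty Γ A} {x : T.Tm A},
    D.Tm X x → D'.Tm (ty X) x
  tm_sub : ∀ {Δ Γ : C} (σ : Δ ⟶ Γ) {A : T.Ty (G.obj (Y.obj Γ))} {A' : T.Ty (G.obj (Y.obj Δ))}
    {X : D.Ty Γ A} {X' : D.Ty Δ A'} {x : T.Tm A} {x' : T.Tm A'}
    (h : T.tySub (G.map (Y.map σ)) A = A') (hX : D.tySub σ h X = X')
    (hX' : D'.tySub (Y.map σ) h (ty X) = ty X')
    (hx : T.tmSub (G.map (Y.map σ)) h x = x') (y : D.Tm X x),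
    tm (D.tmSub σ h hX hx y) = D'.tmSub (Y.map σ) h hX' hx (tm y)

namespace DispAction

variable {T : TyTm.{u₂, v₂, a, b} S} {Y : C ⥤ P} {G : P ⥤ S}
  {D : DispTyTm.{u₁, v₁, u₂, v₂, a, b, c, d} T (Y ⋙ G)}
  {D' : DispTyTm.{u, v, u₂, v₂, a, b, e, f} T G} (y : DispAction Y G D D')

/-- The family `E'` at `Y Γ` extends the family `E` at `Γ` along the actions of `Y`: one has
`E' (Y z) = Y (E z)` for displayed terms `z` over all `ρ : Δ ⟶ Γ`. -/
def TyFamRel {Γ : C} {A : T.Ty (G.obj (Y.obj Γ))} {X : D.Ty Γ A} {X' : D'.Ty (Y.obj Γ) A}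
    (_ : y.ty X = X') {B : T.TyFam A} (E : D.TyFam X B) (E' : D'.TyFam X' B) : Prop :=
  ∀ {Δ : C} (ρ : Δ ⟶ Γ) {A' : T.Ty (G.obj (Y.obj Δ))} {Z : D.Ty Δ A'}
    (h : T.tySub (G.map (Y.map ρ)) A = A') (hZ : D.tySub ρ h X = Z)
    (hZ' : D'.tySub (Y.map ρ) h X' = y.ty Z) {x : T.Tm A'} (z : D.Tm Z x)
    {B' : T.Ty (G.obj (Y.obj Δ))} (hB : B.app (G.map (Y.map ρ)) h x = B'),
    y.ty (E.app ρ h hZ z hB) = E'.app (Y.map ρ) h hZ' (y.tm z) hB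

/-- The dependent function `s'` at `Y Γ` extends the dependent function `s` at `Γ` along the
actions of `Y`. -/
def TmFamRel {Γ : C} {A : T.Ty (G.obj (Y.obj Γ))} {X : D.Ty Γ A} {X' : D'.Ty (Y.obj Γ) A}
    (hX : y.ty X = X') {B : T.TyFam A} {E : D.TyFam X B} {E' : D'.TyFam X' B}
    (hE : y.TyFamRel hX E E') {t : T.TmFam B} (s : D.TmFam E t) (s' : D'.TmFam E' t) : Prop :=
  ∀ {Δ : C} (ρ : Δ ⟶ Γ) {A' : T.Ty (G.obj (Y.obj Δ))} {Z : D.Ty Δ A'}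
    (h : T.tySub (G.map (Y.map ρ)) A = A') (hZ : D.tySub ρ h X = Z)
    (hZ' : D'.tySub (Y.map ρ) h X' = y.ty Z) {x : T.Tm A'} (z : D.Tm Z x)
    {B' : T.Ty (G.obj (Y.obj Δ))} (hB : B.app (G.map (Y.map ρ)) h x = B')
    {t' : T.Tm B'} (ht : t.app (G.map (Y.map ρ)) h x hB = t'),
    D'.castTm (hE ρ h hZ hZ' z hB) rfl (y.tm (s.app ρ h hZ z hB ht)) =
      s'.app (Y.map ρ) h hZ' (y.tm z) hB ht

theorem TyFamRel.inst {y : DispAction Y G D D'} {Γ : C} {A : T.Ty (G.obj (Y.obj Γ))}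
    {X : D.Ty Γ A} {X' : D'.Ty (Y.obj Γ) A} {hX : y.ty X = X'} {B : T.TyFam A}
    {E : D.TyFam X B} {E' : D'.TyFam X' B} (hE : y.TyFamRel hX E E') {x : T.Tm A}
    {z : D.Tm X x} {z' : D'.Tm X' x} (hz : D'.castTm hX rfl (y.tm z) = z') :
    y.ty (E.inst z) = E'.inst z' := by
  have hZ' : D'.tySub (Y.map (𝟙 Γ)) (DispTyTm.base_id (F := Y ⋙ G) Γ A) X' = y.ty X := by
    subst hX
    rw [← y.ty_sub, D.tySub_id]
  refine (hE (𝟙 Γ) _ _ hZ' z _).trans ?_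
  exact E'.app_congr (Y.map_id Γ) hX _ hZ' _ _ rfl hz _ _

/-- The actions on displayed types and terms are bijective. -/
structure IsBijective : Prop where
  ty : ∀ (Γ : C) (A : T.Ty (G.obj (Y.obj Γ))),
    Function.Bijective (fun X : D.Ty Γ A => y.ty X)
  tm : ∀ (Γ : C) (A : T.Ty (G.obj (Y.obj Γ))) (X : D.Ty Γ A) (x : T.Tm A),
    Function.Bijective (fun z : D.Tm X x => y.tm z)

/-- Extension along `Y` is a bijection on the derived sorts of families of displayed types and of
displayed terms depending on one displayed term. -/
structure IsBijectiveOnFamilies : Prop where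
  tyFam : ∀ {Γ : C} {A : T.Ty (G.obj (Y.obj Γ))} (X : D.Ty Γ A) (B : T.TyFam A),
    IsBijectiveRel (fun (E : D.TyFam X B) (E' : D'.TyFam (y.ty X) B) => y.TyFamRel rfl E E')
  tmFam : ∀ {Γ : C} {A : T.Ty (G.obj (Y.obj Γ))} (X : D.Ty Γ A) (B : T.TyFam A)
    (E : D.TyFam X B) (E' : D'.TyFam (y.ty X) B) (hE : y.TyFamRel rfl E E') (t : T.TmFam B),
    IsBijectiveRel (fun (s : D.TmFam E t) (s' : D'.TmFam E' t) => y.TmFamRel rfl hE s s')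

end DispAction

/-- The actions of `Y` preserve all displayed type-theoretic operations. -/
structure DispAction.PreservesOperations {M : Model.{u₂, v₂, a, b} S} {Y : C ⥤ P} {G : P ⥤ S}
    {D : DispModel.{u₁, v₁, u₂, v₂, a, b, c, d} M (Y ⋙ G)}
    {D' : DispModel.{u, v, u₂, v₂, a, b, e, f} M G}
    (y : DispAction Y G D.toDispTyTm D'.toDispTyTm) : Prop where
  pi : ∀ {Γ : C} {A : M.Ty (G.obj (Y.obj Γ))} {B : M.TyFam A} (X : D.Ty Γ A)
    (E : D.TyFam X B) (E' : D'.TyFam (y.ty X) B), y.TyFamRel rfl E E' →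
    y.ty (D.pi X E) = D'.pi (y.ty X) E'
  app : ∀ {Γ : C} {A : M.Ty (G.obj (Y.obj Γ))} {B : M.TyFam A} (X : D.Ty Γ A)
    (E : D.TyFam X B) (E' : D'.TyFam (y.ty X) B) (hE : y.TyFamRel rfl E E')
    {g : M.Tm (M.pi A B)} (k : D.Tm (D.pi X E) g),
    y.TmFamRel rfl hE (D.app k) (D'.app (D'.castTm (pi X E E' hE) rfl (y.tm k)))
  bool : ∀ Γ : C, y.ty (D.bool Γ) = D'.bool (Y.obj Γ)
  tt : ∀ Γ : C, D'.castTm (bool Γ) rfl (y.tm (D.tt Γ)) = D'.tt (Y.obj Γ)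
  ff : ∀ Γ : C, D'.castTm (bool Γ) rfl (y.tm (D.ff Γ)) = D'.ff (Y.obj Γ)
  elim : ∀ {Γ : C} {Q : M.TyFam (M.bool (G.obj (Y.obj Γ)))} (E : D.TyFam (D.bool Γ) Q)
    (E' : D'.TyFam (D'.bool (Y.obj Γ)) Q) (hE : y.TyFamRel (bool Γ) E E')
    {t : M.Tm (Q.inst (M.tt _))} {s : M.Tm (Q.inst (M.ff _))}
    (t' : D.Tm (E.inst (D.tt Γ)) t) (s' : D.Tm (E.inst (D.ff Γ)) s)
    {x : M.Tm (M.bool (G.obj (Y.obj Γ)))} (z : D.Tm (D.bool Γ) x),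
    D'.castTm (hE.inst rfl) rfl (y.tm (D.elim E t' s' z)) =
      D'.elim E' (D'.castTm (hE.inst (tt Γ)) rfl (y.tm t'))
        (D'.castTm (hE.inst (ff Γ)) rfl (y.tm s')) (D'.castTm (bool Γ) rfl (y.tm z))

end Action

/-! ### The displayed presheaf category -/

/-- An object of the displayed presheaf category: an object `base` of `S` and a dependent presheaf
`fib` over `Θ : Cᵒᵖ` and `γ : F Θ ⟶ base`. -/
structure DispPsh {C : Type u₁} [Category.{v} C] {S : Type u₂} [Category.{v₂} S] (F : C ⥤ S) where
  base : S
  fib : ∀ {Θ : C}, (F.obj Θ ⟶ base) → Type v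
  res : ∀ {Ξ Θ : C} (σ : Ξ ⟶ Θ) {γ : F.obj Θ ⟶ base} {γ' : F.obj Ξ ⟶ base},
    F.map σ ≫ γ = γ' → fib γ → fib γ'
  res_id : ∀ {Θ : C} {γ : F.obj Θ ⟶ base} (h : F.map (𝟙 Θ) ≫ γ = γ) (x : fib γ),
    res (𝟙 Θ) h x = x
  res_comp : ∀ {Ω Ξ Θ : C} (τ : Ω ⟶ Ξ) (σ : Ξ ⟶ Θ) {γ : F.obj Θ ⟶ base} {γ' : F.obj Ξ ⟶ base}
    {γ'' : F.obj Ω ⟶ base} (h : F.map σ ≫ γ = γ') (h' : F.map τ ≫ γ' = γ'')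
    (h'' : F.map (τ ≫ σ) ≫ γ = γ'') (x : fib γ),
    res (τ ≫ σ) h'' x = res τ h' (res σ h x)

namespace DispPsh

variable {C : Type u₁} [Category.{v} C] {S : Type u₂} [Category.{v₂} S] {F : C ⥤ S}

/-- A morphism: a morphism `base` of `S` and a dependent natural transformation sending elements
over `γ` to elements over `γ ≫ base`. -/
structure Hom (U V : DispPsh F) where
  base : U.base ⟶ V.base
  app : ∀ {Θ : C} (γ : F.obj Θ ⟶ U.base) {δ : F.obj Θ ⟶ V.base}, γ ≫ base = δ → U.fib γ → V.fib δ
  nat : ∀ {Ξ Θ : C} (σ : Ξ ⟶ Θ) {γ : F.obj Θ ⟶ U.base} {γ' : F.obj Ξ ⟶ U.base}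
    {δ : F.obj Θ ⟶ V.base} {δ' : F.obj Ξ ⟶ V.base} (h : F.map σ ≫ γ = γ')
    (k : γ ≫ base = δ) (k' : γ' ≫ base = δ') (h' : F.map σ ≫ δ = δ') (x : U.fib γ),
    app γ' k' (U.res σ h x) = V.res σ h' (app γ k x)

theorem Hom.ext' {U V : DispPsh F} {m n : Hom U V} (hb : m.base = n.base)
    (ha : ∀ {Θ : C} (γ : F.obj Θ ⟶ U.base) {δ : F.obj Θ ⟶ V.base} (h : γ ≫ m.base = δ)
      (h' : γ ≫ n.base = δ) (x : U.fib γ), m.app γ h x = n.app γ h' x) : m = n := by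
  obtain ⟨mb, ma, _⟩ := m
  obtain ⟨nb, na, _⟩ := n
  obtain rfl : mb = nb := hb
  have : @ma = @na := by
    funext Θ γ δ h x
    exact ha γ h h x
  subst this
  rfl

instance : Category (DispPsh F) where
  Hom U V := Hom U V
  id U :=
    { base := 𝟙 _
      app := fun {Θ} γ {δ} h x => U.res (𝟙 Θ) (by rw [← h]; simp) x
      nat := fun σ γ γ' δ δ' h k k' h' x => by
        obtain rfl : γ = δ := by simpa using k
        obtain rfl : γ' = δ' := by simpa using k'
        rw [U.res_id, U.res_id] }
  comp m n :=
    { base := m.base ≫ n.base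
      app := fun γ δ h x => n.app (γ ≫ m.base) (by rw [Category.assoc, h]) (m.app γ rfl x)
      nat := fun σ γ γ' δ δ' h k k' h' x => by
        rw [m.nat σ h rfl rfl (by rw [← Category.assoc, h])]
        exact n.nat σ _ _ _ _ _ }
  id_comp {U V} m := Hom.ext' (Category.id_comp _) fun {Θ} γ {δ} h h' x => by
    have : ∀ (γ' : F.obj Θ ⟶ U.base) (k : F.map (𝟙 Θ) ≫ γ = γ') (hk : γ' ≫ m.base = δ), γ' = γ →
        m.app γ' hk (U.res (𝟙 Θ) k x) = m.app γ h' x := by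
      rintro _ k hk rfl
      rw [U.res_id]
    exact this _ _ _ (Category.comp_id γ)
  comp_id {U V} m := Hom.ext' (Category.comp_id _) fun {Θ} γ {δ} h h' x => by
    subst h'
    exact V.res_id _ _
  assoc m n k := Hom.ext' (Category.assoc _ _ _) fun {Θ} γ {δ} h h' x => by
    have : ∀ (γ' : F.obj Θ ⟶ _) (hγ : (γ ≫ Hom.base m) ≫ Hom.base n = γ')
        (hk : γ' ≫ Hom.base k = δ) (hk' : ((γ ≫ Hom.base m) ≫ Hom.base n) ≫ Hom.base k = δ),
        Hom.app k γ' hk (Hom.app n (γ ≫ Hom.base m) hγ (Hom.app m γ rfl x)) =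
        Hom.app k _ hk' (Hom.app n (γ ≫ Hom.base m) rfl (Hom.app m γ rfl x)) := by
      rintro _ rfl _ _; rfl
    exact this _ _ _ _

end DispPsh

section

variable {C : Type u₁} [Category.{v} C] {S : Type u₂} [Category.{v₂} S] (F : C ⥤ S)

/-- The projection `G` from the displayed presheaf category to `S`. -/
def dispProj : DispPsh F ⥤ S where
  obj U := U.base
  map m := DispPsh.Hom.base m

/-- The displayed Yoneda embedding `Y`: the elements of `Y Γ` over `γ : F Θ ⟶ F Γ` are the
morphisms `Θ ⟶ Γ` of `C` lying over `γ`. -/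
def dispYoneda : C ⥤ DispPsh F where
  obj Γ :=
    { base := F.obj Γ
      fib := fun {Θ} γ => { g : Θ ⟶ Γ // F.map g = γ }
      res := fun σ _ _ h g => ⟨σ ≫ g.1, by rw [F.map_comp, g.2, h]⟩
      res_id := fun _ _ => Subtype.ext (Category.id_comp _)
      res_comp := fun _ _ _ _ _ _ _ _ _ => Subtype.ext (Category.assoc _ _ _) }
  map k :=
    { base := F.map k
      app := fun _ _ h g => ⟨g.1 ≫ k, by rw [F.map_comp, g.2, h]⟩
      nat := fun _ _ _ _ _ _ _ _ _ _ => Subtype.ext (Category.assoc _ _ _) }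
  map_id Γ := DispPsh.Hom.ext' (F.map_id Γ) fun _ _ _ _ _ =>
    Subtype.ext ((Category.comp_id _).trans (Category.id_comp _).symm)
  map_comp k l := DispPsh.Hom.ext' (F.map_comp k l) fun _ _ _ _ _ =>
    Subtype.ext (Category.assoc _ _ _).symm

theorem dispYoneda_comp_dispProj : dispYoneda F ⋙ dispProj F = F := rfl

end

/-- The functor `N_F : S ⥤ (Cᵒᵖ ⥤ Type)`, the Yoneda embedding of `S` followed by
precomposition with `F`. -/
def relNerve {C : Type u₁} [Category.{v} C] {S : Type u₂} [Category.{v} S] (F : C ⥤ S) :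
    S ⥤ Cᵒᵖ ⥤ Type v :=
  yoneda ⋙ (Functor.whiskeringLeft Cᵒᵖ Sᵒᵖ (Type v)).obj F.op

end RelativeInduction

open CategoryTheory

set_option linter.checkUnivs false

namespace RelativeInduction

universe u v u₁ v₁ u₂ v₂ a b c d e f w

/-! ### Extensionality and congruence for types, terms and families -/

namespace TyTm

variable {S : Type u} [Category.{v} S] {T : TyTm.{u, v, a, b} S}

/-! Objects of the displayed presheaf category obey a Yoneda lemma: a morphism `Y Θ ⟶ U` is a
morphism `γ : F Θ ⟶ U.base` together with an element of `U.fib γ` (`DispPsh.point`, `DispPsh.elem`,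
`DispPsh.point_elem`). For `U = Y Γ` such an element is a morphism `Θ ⟶ Γ` over `γ`, so `Y` is fully
faithful.

The displayed model over `G` is the right Kan extension of the given one along `Y`: a displayed type
at `U` over `A` is a natural choice, for every point `m : Y Θ ⟶ U`, of a displayed type at `Θ` over
`A[m]`, and displayed terms are natural choices of displayed terms. As `Y` is fully faithful, such a
choice at `Y Γ` amounts to its value at the identity, so the action of `Y` is bijective, with
evaluation at `𝟙` as inverse (`ranAction_isBijective`).

The operations rest on one observation. A family over the extension takes as arguments all `ρ : V ⟶
U` and all displayed terms `z` at `V`, which are themselves natural choices. By naturality its value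
there, read at a point `m` of `V`, depends only on the point `m ≫ ρ` of `U` and on the single
displayed term `z` at `m` (`TyFam.eval_app`, `TmFam.eval_app`). Families over the extension are
therefore the same as compatible values at points (`PtTyFam`, `PtTmFam`). At `Y Γ` all points come
from `C`, and this is the bijection on families (`ranAction_isBijectiveOnFamilies`). At a general
`U`, each point turns a family into one over `C` (`TyFam.restr`), to which the operations of the
given model apply; `Π`, application, abstraction and the eliminator are computed point by point, and
all their equations are checked at points. Evaluation at `𝟙` shows that `Y` preserves them. So far
only the full faithfulness of `Y` is used, for any `Y` and `G`.

Context extensions use the displayed presheaves themselves: `U ▹ X` lies over the extension of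
`U.base` by `A`, and its elements over `γ` are an element of `U` over the projection of `γ` with a
displayed term at the corresponding point. This is a presheaf of small sets because displayed terms
form small sets. The base of `U ▹ X` is by construction a context extension in `S`, which gives
preservation. The equivalence with the gluing category is the usual passage between a family of
fibres and its total space.

Equalities such as that of `(Π A B)[m]` with `Π (A[m]) (B[m])` hold only propositionally. To avoid
transports, values are read through `eval`, which takes the equations between indices as arguments,
and lemmas leave composites and restricted types free, so that these equations can be eliminated by
substitution. -/

theorem tySub_congr {Δ Γ : S} {σ σ' : Δ ⟶ Γ} (hσ : σ = σ') (A : T.Ty Γ) :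
    T.tySub σ A = T.tySub σ' A := by
  rw [hσ]

theorem tmSub_congr {Δ Γ : S} {σ σ' : Δ ⟶ Γ} (hσ : σ = σ') {A : T.Ty Γ} {A' : T.Ty Δ}
    (h : T.tySub σ A = A') (h' : T.tySub σ' A = A') (x : T.Tm A) :
    T.tmSub σ h x = T.tmSub σ' h' x := by
  subst hσ; rfl

theorem tmSub_trans {Θ Δ Γ : S} {τ : Θ ⟶ Δ} {σ : Δ ⟶ Γ} {ρ : Θ ⟶ Γ} (hρ : τ ≫ σ = ρ)
    {A : T.Ty Γ} {A' : T.Ty Δ} {A'' : T.Ty Θ} {h : T.tySub σ A = A'} {h' : T.tySub τ A' = A''}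
    (h'' : T.tySub ρ A = A'') {x : T.Tm A} {x' : T.Tm A'} {x'' : T.Tm A''}
    (hx : T.tmSub σ h x = x') (hx' : T.tmSub τ h' x' = x'') : T.tmSub ρ h'' x = x'' := by
  subst hρ hx hx'; exact T.tmSub_comp τ σ h h' h'' x

theorem TyFam.ext_app {Γ : S} {A : T.Ty Γ} {B B' : T.TyFam A}
    (hB : ∀ {Δ : S} (ρ : Δ ⟶ Γ) {A' : T.Ty Δ} (h : T.tySub ρ A = A') (x : T.Tm A'),
      B.app ρ h x = B'.app ρ h x) : B = B' := by
  obtain ⟨f, _⟩ := B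
  obtain ⟨g, _⟩ := B'
  have : @f = @g := by
    funext Δ ρ A' h x
    exact hB ρ h x
  subst this
  rfl

theorem TyFam.app_congr {Γ : S} {A : T.Ty Γ} (B : T.TyFam A) {Δ : S} {ρ ρ' : Δ ⟶ Γ}
    (hρ : ρ = ρ') {A' : T.Ty Δ} (h : T.tySub ρ A = A') (h' : T.tySub ρ' A = A')
    {x x' : T.Tm A'} (hx : x = x') : B.app ρ h x = B.app ρ' h' x' := by
  subst hρ hx; rfl

theorem TmFam.app_congr {Γ : S} {A : T.Ty Γ} {B : T.TyFam A} (t : T.TmFam B) {Δ : S}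
    {ρ ρ' : Δ ⟶ Γ} (hρ : ρ = ρ') {A' : T.Ty Δ} (h : T.tySub ρ A = A') (h' : T.tySub ρ' A = A')
    {x x' : T.Tm A'} (hx : x = x') {B' : T.Ty Δ} (hB : B.app ρ h x = B')
    (hB' : B.app ρ' h' x' = B') : t.app ρ h x hB = t.app ρ' h' x' hB' := by
  subst hρ hx; rfl

end TyTm

namespace DispTyTm

section

variable {C : Type u₁} [Category.{v₁} C] {S : Type u₂} [Category.{v₂} S]
  {T : TyTm.{u₂, v₂, a, b} S} {F : C ⥤ S} {D : DispTyTm.{u₁, v₁, u₂, v₂, a, b, c, d} T F}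

theorem base_tmSub_id {Γ : C} {A : T.Ty (F.obj Γ)} (h : T.tySub (F.map (𝟙 Γ)) A = A)
    (x : T.Tm A) : T.tmSub (F.map (𝟙 Γ)) h x = x :=
  T.tmSub_of_eq_id (F.map_id Γ) h x

theorem base_tmSub_trans {Θ Δ Γ : C} {τ : Θ ⟶ Δ} {σ : Δ ⟶ Γ} {A : T.Ty (F.obj Γ)}
    {A' : T.Ty (F.obj Δ)} {A'' : T.Ty (F.obj Θ)} {h : T.tySub (F.map σ) A = A'}
    {h' : T.tySub (F.map τ) A' = A''} (h'' : T.tySub (F.map (τ ≫ σ)) A = A'')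
    {x : T.Tm A} {x' : T.Tm A'} {x'' : T.Tm A''} (hx : T.tmSub (F.map σ) h x = x')
    (hx' : T.tmSub (F.map τ) h' x' = x'') : T.tmSub (F.map (τ ≫ σ)) h'' x = x'' :=
  T.tmSub_trans (F.map_comp τ σ).symm h'' hx hx'

theorem tySub_congr {Δ Γ : C} {σ σ' : Δ ⟶ Γ} (hσ : σ = σ') {A : T.Ty (F.obj Γ)}
    {A' : T.Ty (F.obj Δ)} (h : T.tySub (F.map σ) A = A') (h' : T.tySub (F.map σ') A = A')
    (X : D.Ty Γ A) : D.tySub σ h X = D.tySub σ' h' X := by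
  subst hσ; rfl

theorem tmSub_congr {Δ Γ : C} {σ σ' : Δ ⟶ Γ} (hσ : σ = σ') {A : T.Ty (F.obj Γ)}
    {A' : T.Ty (F.obj Δ)} {X : D.Ty Γ A} {X' : D.Ty Δ A'} {x : T.Tm A} {x' : T.Tm A'}
    (h : T.tySub (F.map σ) A = A') (hX : D.tySub σ h X = X') (hx : T.tmSub (F.map σ) h x = x')
    (h' : T.tySub (F.map σ') A = A') (hX' : D.tySub σ' h' X = X')
    (hx' : T.tmSub (F.map σ') h' x = x') (y : D.Tm X x) :
    D.tmSub σ h hX hx y = D.tmSub σ' h' hX' hx' y := by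
  subst hσ; rfl

/-- A cast after a restriction is absorbed by the index equations that restriction already carries.
-/
theorem castTm_tmSub {Δ Γ : C} (σ : Δ ⟶ Γ) {A : T.Ty (F.obj Γ)}
    {A' : T.Ty (F.obj Δ)} {X : D.Ty Γ A} {X' Z : D.Ty Δ A'} {x : T.Tm A} {x' z : T.Tm A'}
    (h : T.tySub (F.map σ) A = A') (hX : D.tySub σ h X = X') (hx : T.tmSub (F.map σ) h x = x')
    (hXZ : X' = Z) (hxz : x' = z) (y : D.Tm X x) :
    D.castTm hXZ hxz (D.tmSub σ h hX hx y) =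
      D.tmSub σ h (hX.trans hXZ) (hx.trans hxz) y := by
  subst hXZ hxz; rfl

theorem TyFam.ext_app {Γ : C} {A : T.Ty (F.obj Γ)} {X : D.Ty Γ A} {B : T.TyFam A}
    {E E' : D.TyFam X B}
    (hE : ∀ {Δ : C} (ρ : Δ ⟶ Γ) {A' : T.Ty (F.obj Δ)} {X' : D.Ty Δ A'}
      (h : T.tySub (F.map ρ) A = A') (hX : D.tySub ρ h X = X') {x : T.Tm A'} (y : D.Tm X' x)
      {B' : T.Ty (F.obj Δ)} (hB : B.app (F.map ρ) h x = B'),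
      E.app ρ h hX y hB = E'.app ρ h hX y hB) : E = E' := by
  obtain ⟨f, _⟩ := E
  obtain ⟨g, _⟩ := E'
  have : @f = @g := by
    funext Δ ρ A' X' h hX x y B' hB
    exact hE ρ h hX y hB
  subst this
  rfl

namespace TmFam

variable {Γ : C} {A : T.Ty (F.obj Γ)} {X : D.Ty Γ A} {B : T.TyFam A} {E : D.TyFam X B}
  {t : T.TmFam B}

theorem ext_app {s s' : D.TmFam E t}
    (hs : ∀ {Δ : C} (ρ : Δ ⟶ Γ) {A' : T.Ty (F.obj Δ)} {X' : D.Ty Δ A'}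
      (h : T.tySub (F.map ρ) A = A') (hX : D.tySub ρ h X = X') {x : T.Tm A'} (y : D.Tm X' x)
      {B' : T.Ty (F.obj Δ)} (hB : B.app (F.map ρ) h x = B') {t' : T.Tm B'}
      (ht : t.app (F.map ρ) h x hB = t'),
      s.app ρ h hX y hB ht = s'.app ρ h hX y hB ht) : s = s' := by
  obtain ⟨f, _⟩ := s
  obtain ⟨g, _⟩ := s'
  have : @f = @g := by
    funext Δ ρ A' X' h hX x y B' hB t' ht
    exact hs ρ h hX y hB ht
  subst this
  rfl

/-- The value of a displayed dependent function, with an equation for the displayed type of the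
result. -/
def appTo (s : D.TmFam E t) {Δ : C} (ρ : Δ ⟶ Γ) {A' : T.Ty (F.obj Δ)} {X' : D.Ty Δ A'}
    (h : T.tySub (F.map ρ) A = A') (hX : D.tySub ρ h X = X') {x : T.Tm A'} (y : D.Tm X' x)
    {B' : T.Ty (F.obj Δ)} (hB : B.app (F.map ρ) h x = B') {Z : D.Ty Δ B'}
    (hZ : E.app ρ h hX y hB = Z) {t' : T.Tm B'} (ht : t.app (F.map ρ) h x hB = t') :
    D.Tm Z t' :=
  D.castTm hZ rfl (s.app ρ h hX y hB ht)

theorem appTo_congr_hom (s : D.TmFam E t) {Δ : C} {ρ ρ' : Δ ⟶ Γ} (hρ : ρ = ρ')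
    {A' : T.Ty (F.obj Δ)} {X' : D.Ty Δ A'}
    (h : T.tySub (F.map ρ) A = A') (hX : D.tySub ρ h X = X')
    (h' : T.tySub (F.map ρ') A = A') (hX' : D.tySub ρ' h' X = X')
    {x : T.Tm A'} (y : D.Tm X' x) {B' : T.Ty (F.obj Δ)} (hB : B.app (F.map ρ) h x = B')
    (hB' : B.app (F.map ρ') h' x = B') {Z : D.Ty Δ B'}
    (hZ : E.app ρ h hX y hB = Z) (hZ' : E.app ρ' h' hX' y hB' = Z) {t' : T.Tm B'}
    (ht : t.app (F.map ρ) h x hB = t') (ht' : t.app (F.map ρ') h' x hB' = t') :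
    s.appTo ρ h hX y hB hZ ht = s.appTo ρ' h' hX' y hB' hZ' ht' := by
  subst hρ; rfl

theorem tmSub_appTo (s : D.TmFam E t) {Θ Δ : C} (σ : Θ ⟶ Δ) (ρ : Δ ⟶ Γ) {ρ' : Θ ⟶ Γ}
    (hρ : σ ≫ ρ = ρ') {A' : T.Ty (F.obj Δ)} {A'' : T.Ty (F.obj Θ)}
    {X' : D.Ty Δ A'} {X'' : D.Ty Θ A''} {x : T.Tm A'} {x' : T.Tm A''}
    (h : T.tySub (F.map ρ) A = A') (hX : D.tySub ρ h X = X')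
    (h' : T.tySub (F.map σ) A' = A'') (hX' : D.tySub σ h' X' = X'')
    (hx : T.tmSub (F.map σ) h' x = x') {y : D.Tm X' x} {y' : D.Tm X'' x'}
    (hy : D.tmSub σ h' hX' hx y = y')
    (h'' : T.tySub (F.map ρ') A = A'') (hX'' : D.tySub ρ' h'' X = X'')
    {B' : T.Ty (F.obj Δ)} {B'' : T.Ty (F.obj Θ)} (hB : B.app (F.map ρ) h x = B')
    (hB' : T.tySub (F.map σ) B' = B'') (hB'' : B.app (F.map ρ') h'' x' = B'')
    {Z : D.Ty Δ B'} {Z' : D.Ty Θ B''} (hZ : E.app ρ h hX y hB = Z)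
    (hZ' : D.tySub σ hB' Z = Z') (hZ'' : E.app ρ' h'' hX'' y' hB'' = Z')
    {t' : T.Tm B'} {t'' : T.Tm B''} (ht : t.app (F.map ρ) h x hB = t')
    (ht' : T.tmSub (F.map σ) hB' t' = t'') (ht'' : t.app (F.map ρ') h'' x' hB'' = t'') :
    D.tmSub σ hB' hZ' ht' (s.appTo ρ h hX y hB hZ ht) = s.appTo ρ' h'' hX'' y' hB'' hZ'' ht'' := by
  subst hZ hZ''
  exact s.nat' σ ρ hρ h hX h' hX' hx hy h'' hX'' hB hB' hB'' ht ht' ht'' hZ'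

end TmFam

end

/-! ### Extension of displayed types and terms along a functor

For functors `Y : C ⥤ P` and `G : P ⥤ S` and displayed types and terms over `Y ⋙ G`, the displayed
types over `G` at `U` are the natural families of displayed types indexed by `Y Θ ⟶ U`. -/

variable {C : Type u₁} [Category.{v₁} C] {P : Type u} [Category.{v} P]
  {S : Type u₂} [Category.{v₂} S] {T : TyTm.{u₂, v₂, a, b} S} {Y : C ⥤ P} {G : P ⥤ S}
  (D : DispTyTm.{u₁, v₁, u₂, v₂, a, b, c, d} T (Y ⋙ G))

/-- A displayed type at `U`: a natural family of displayed types over all `Y Θ ⟶ U`. -/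
structure RanTy (U : P) (A : T.Ty (G.obj U)) where
  val : ∀ {Θ : C} (m : Y.obj Θ ⟶ U), D.Ty Θ (T.tySub (G.map m) A)
  nat : ∀ {Ξ Θ : C} (σ : Ξ ⟶ Θ) (m : Y.obj Θ ⟶ U)
    (h : T.tySub (G.map (Y.map σ)) (T.tySub (G.map m) A) = T.tySub (G.map (Y.map σ ≫ m)) A),
    D.tySub σ h (val m) = val (Y.map σ ≫ m)

namespace RanTy

variable {D}
variable {U : P} {A : T.Ty (G.obj U)}

/-- The value at `m`, with an equation for the type of the result. -/
def eval (X : D.RanTy U A) {Θ : C} (m : Y.obj Θ ⟶ U) {A' : T.Ty (G.obj (Y.obj Θ))}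
    (h : T.tySub (G.map m) A = A') : D.Ty Θ A' :=
  h ▸ X.val m

theorem eval_congr (X : D.RanTy U A) {Θ : C} {m m' : Y.obj Θ ⟶ U} (hm : m = m')
    {A' : T.Ty (G.obj (Y.obj Θ))} (h : T.tySub (G.map m) A = A')
    (h' : T.tySub (G.map m') A = A') : X.eval m h = X.eval m' h' := by
  subst hm; rfl

/-- The field `nat` with the composite and all types left free; substitution reduces it to that
field. It is the form in which naturality is used throughout. -/
theorem tySub_eval (X : D.RanTy U A) {Ξ Θ : C} (σ : Ξ ⟶ Θ) (m : Y.obj Θ ⟶ U)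
    {m' : Y.obj Ξ ⟶ U} (hm : Y.map σ ≫ m = m') {A' : T.Ty (G.obj (Y.obj Θ))}
    {A'' : T.Ty (G.obj (Y.obj Ξ))} (h : T.tySub (G.map m) A = A')
    (h' : T.tySub (G.map (Y.map σ)) A' = A'') (h'' : T.tySub (G.map m') A = A'') :
    D.tySub σ h' (X.eval m h) = X.eval m' h'' := by
  subst hm h h''; exact X.nat σ m h'

theorem ext_eval {X X' : D.RanTy U A}
    (hX : ∀ {Θ : C} (m : Y.obj Θ ⟶ U) {A' : T.Ty (G.obj (Y.obj Θ))}
      (h : T.tySub (G.map m) A = A'), X.eval m h = X'.eval m h) : X = X' := by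
  obtain ⟨f, hf⟩ := X
  obtain ⟨g, hg⟩ := X'
  have : @f = @g := by
    funext Θ m
    exact hX m rfl
  subst this
  rfl

/-- A displayed type given by values over chosen representatives of the types `A[m]`. -/
def ofChosen {A₀ : ∀ {Θ : C}, (Y.obj Θ ⟶ U) → T.Ty (G.obj (Y.obj Θ))}
    (hA₀ : ∀ {Θ : C} (m : Y.obj Θ ⟶ U), T.tySub (G.map m) A = A₀ m)
    (k : ∀ {Θ : C} (m : Y.obj Θ ⟶ U), D.Ty Θ (A₀ m))
    (nat : ∀ {Ξ Θ : C} (σ : Ξ ⟶ Θ) (m : Y.obj Θ ⟶ U)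
      (h : T.tySub (G.map (Y.map σ)) (A₀ m) = A₀ (Y.map σ ≫ m)),
      D.tySub σ h (k m) = k (Y.map σ ≫ m)) : D.RanTy U A where
  val m := (hA₀ m).symm ▸ k m
  nat {Ξ Θ} σ m h := by
    -- The actual restricted types are generalised to variables, so that the equations with the
    -- representatives can be substituted.
    have key : ∀ (A₁ : T.Ty (G.obj (Y.obj Θ))) (A₂ : T.Ty (G.obj (Y.obj Ξ))) (e₁ : A₀ m = A₁)
        (e₂ : A₀ (Y.map σ ≫ m) = A₂) (h : T.tySub (G.map (Y.map σ)) A₁ = A₂),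
        D.tySub σ h (e₁ ▸ k m : D.Ty Θ A₁) = (e₂ ▸ k (Y.map σ ≫ m) : D.Ty Ξ A₂) := by
      rintro _ _ rfl rfl h
      exact nat σ m h
    exact key _ _ _ _ h

theorem eval_ofChosen {A₀ : ∀ {Θ : C}, (Y.obj Θ ⟶ U) → T.Ty (G.obj (Y.obj Θ))}
    (hA₀ : ∀ {Θ : C} (m : Y.obj Θ ⟶ U), T.tySub (G.map m) A = A₀ m)
    (k : ∀ {Θ : C} (m : Y.obj Θ ⟶ U), D.Ty Θ (A₀ m)) (nat) {Θ : C} (m : Y.obj Θ ⟶ U)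
    (h : T.tySub (G.map m) A = A₀ m) : (ofChosen (D := D) hA₀ k nat).eval m h = k m := by
  have key : ∀ (A₁ : T.Ty (G.obj (Y.obj Θ))) (e : A₀ m = A₁) (e' : A₁ = A₀ m),
      (e' ▸ (e ▸ k m : D.Ty Θ A₁) : D.Ty Θ (A₀ m)) = k m := by
    rintro _ rfl _; rfl
  exact key _ _ _

/-- Restriction along `n : V ⟶ U`. -/
def sub (X : D.RanTy U A) {V : P} (n : V ⟶ U) {A' : T.Ty (G.obj V)}
    (hA : T.tySub (G.map n) A = A') : D.RanTy V A' where
  val m := X.eval (m ≫ n) (base_trans m n hA rfl)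
  nat σ m h := X.tySub_eval σ (m ≫ n) (Category.assoc _ _ _).symm _ h _

theorem eval_sub (X : D.RanTy U A) {V : P} (n : V ⟶ U) {A' : T.Ty (G.obj V)}
    (hA : T.tySub (G.map n) A = A') {Θ : C} (m : Y.obj Θ ⟶ V) {m' : Y.obj Θ ⟶ U}
    (hm : m ≫ n = m') {A'' : T.Ty (G.obj (Y.obj Θ))}
    (h : T.tySub (G.map m) A' = A'') (h' : T.tySub (G.map m') A = A'') :
    (X.sub n hA).eval m h = X.eval m' h' := by
  subst hm h; rfl

/-- The restriction enters through an equation `X.sub n hA = X'` because families receive their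
displayed type argument in that form. -/
theorem eval_of_sub_eq {X : D.RanTy U A} {V : P} {n : V ⟶ U} {A' : T.Ty (G.obj V)}
    {hA : T.tySub (G.map n) A = A'} {X' : D.RanTy V A'} (hX : X.sub n hA = X') {Θ : C}
    (m : Y.obj Θ ⟶ V) {m' : Y.obj Θ ⟶ U} (hm : m ≫ n = m') {A'' : T.Ty (G.obj (Y.obj Θ))}
    (h : T.tySub (G.map m) A' = A'') (h' : T.tySub (G.map m') A = A'') :
    X'.eval m h = X.eval m' h' := by
  subst hX; exact X.eval_sub n hA m hm h h'

end RanTy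

/-- A displayed term at `U`: a natural family of displayed terms over all `Y Θ ⟶ U`. -/
structure RanTm {U : P} {A : T.Ty (G.obj U)} (X : D.RanTy U A) (x : T.Tm A) where
  val : ∀ {Θ : C} (m : Y.obj Θ ⟶ U), D.Tm (X.val m) (T.tmSub (G.map m) rfl x)
  nat : ∀ {Ξ Θ : C} (σ : Ξ ⟶ Θ) (m : Y.obj Θ ⟶ U)
    (h : T.tySub (G.map (Y.map σ)) (T.tySub (G.map m) A) = T.tySub (G.map (Y.map σ ≫ m)) A)
    (hX : D.tySub σ h (X.val m) = X.val (Y.map σ ≫ m))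
    (hx : T.tmSub (G.map (Y.map σ)) h (T.tmSub (G.map m) rfl x) =
      T.tmSub (G.map (Y.map σ ≫ m)) rfl x),
    D.tmSub σ h hX hx (val m) = val (Y.map σ ≫ m)

namespace RanTm

variable {D}
variable {U : P} {A : T.Ty (G.obj U)} {X : D.RanTy U A} {x : T.Tm A}

/-- The value at `m`, with equations for the indices of the result. -/
def eval (y : D.RanTm X x) {Θ : C} (m : Y.obj Θ ⟶ U) {A' : T.Ty (G.obj (Y.obj Θ))}
    {X' : D.Ty Θ A'} {x' : T.Tm A'} (h : T.tySub (G.map m) A = A') (hX : X.eval m h = X')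
    (hx : T.tmSub (G.map m) h x = x') : D.Tm X' x' := by
  subst h hX hx
  exact y.val m

theorem eval_congr (y : D.RanTm X x) {Θ : C} {m m' : Y.obj Θ ⟶ U} (hm : m = m')
    {A' : T.Ty (G.obj (Y.obj Θ))} {X' : D.Ty Θ A'} {x' : T.Tm A'}
    (h : T.tySub (G.map m) A = A') (hX : X.eval m h = X') (hx : T.tmSub (G.map m) h x = x')
    (h' : T.tySub (G.map m') A = A') (hX' : X.eval m' h' = X')
    (hx' : T.tmSub (G.map m') h' x = x') : y.eval m h hX hx = y.eval m' h' hX' hx' := by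
  subst hm; rfl

theorem castTm_eval (y : D.RanTm X x) {Θ : C} (m : Y.obj Θ ⟶ U)
    {A' : T.Ty (G.obj (Y.obj Θ))} {X' X'' : D.Ty Θ A'} {x' x'' : T.Tm A'}
    (h : T.tySub (G.map m) A = A') (hX : X.eval m h = X') (hx : T.tmSub (G.map m) h x = x')
    (hX' : X' = X'') (hx' : x' = x'') :
    D.castTm hX' hx' (y.eval m h hX hx) = y.eval m h (hX.trans hX') (hx.trans hx') := by
  subst hX' hx'; rfl

theorem tmSub_eval (y : D.RanTm X x) {Ξ Θ : C} (σ : Ξ ⟶ Θ) (m : Y.obj Θ ⟶ U)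
    {m' : Y.obj Ξ ⟶ U} (hm : Y.map σ ≫ m = m') {A' : T.Ty (G.obj (Y.obj Θ))}
    {A'' : T.Ty (G.obj (Y.obj Ξ))} {X' : D.Ty Θ A'} {X'' : D.Ty Ξ A''} {x' : T.Tm A'}
    {x'' : T.Tm A''} (h : T.tySub (G.map m) A = A') (hX : X.eval m h = X')
    (hx : T.tmSub (G.map m) h x = x') (h' : T.tySub (G.map (Y.map σ)) A' = A'')
    (hX' : D.tySub σ h' X' = X'') (hx' : T.tmSub (G.map (Y.map σ)) h' x' = x'')
    (h'' : T.tySub (G.map m') A = A'') (hX'' : X.eval m' h'' = X'')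
    (hx'' : T.tmSub (G.map m') h'' x = x'') :
    D.tmSub σ h' hX' hx' (y.eval m h hX hx) = y.eval m' h'' hX'' hx'' := by
  subst hm h hX hx h'' hX'' hx''; exact y.nat σ m h' hX' hx'

theorem ext_eval {y y' : D.RanTm X x}
    (hy : ∀ {Θ : C} (m : Y.obj Θ ⟶ U) {A' : T.Ty (G.obj (Y.obj Θ))} {X' : D.Ty Θ A'}
      {x' : T.Tm A'} (h : T.tySub (G.map m) A = A') (hX : X.eval m h = X')
      (hx : T.tmSub (G.map m) h x = x'), y.eval m h hX hx = y'.eval m h hX hx) : y = y' := by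
  obtain ⟨f, hf⟩ := y
  obtain ⟨g, hg⟩ := y'
  have : @f = @g := by
    funext Θ m
    exact hy m rfl rfl rfl
  subst this
  rfl

/-- A displayed term over representatives of the indices at `m`, as a displayed term over the
indices themselves. -/
def unindex {Θ : C} (m : Y.obj Θ ⟶ U) {A' : T.Ty (G.obj (Y.obj Θ))} {X' : D.Ty Θ A'}
    {x' : T.Tm A'} (h : T.tySub (G.map m) A = A') (hX : X.eval m h = X')
    (hx : T.tmSub (G.map m) h x = x') (z : D.Tm X' x') :
    D.Tm (X.val m) (T.tmSub (G.map m) rfl x) := by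
  subst h hX hx
  exact z

/-- A displayed term given by values over chosen representatives of the indices. -/
def ofChosen {A₀ : ∀ {Θ : C}, (Y.obj Θ ⟶ U) → T.Ty (G.obj (Y.obj Θ))}
    (hA₀ : ∀ {Θ : C} (m : Y.obj Θ ⟶ U), T.tySub (G.map m) A = A₀ m)
    {X₀ : ∀ {Θ : C} (m : Y.obj Θ ⟶ U), D.Ty Θ (A₀ m)}
    (hX₀ : ∀ {Θ : C} (m : Y.obj Θ ⟶ U), X.eval m (hA₀ m) = X₀ m)
    {x₀ : ∀ {Θ : C} (m : Y.obj Θ ⟶ U), T.Tm (A₀ m)}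
    (hx₀ : ∀ {Θ : C} (m : Y.obj Θ ⟶ U), T.tmSub (G.map m) (hA₀ m) x = x₀ m)
    (k : ∀ {Θ : C} (m : Y.obj Θ ⟶ U), D.Tm (X₀ m) (x₀ m))
    (nat : ∀ {Ξ Θ : C} (σ : Ξ ⟶ Θ) (m : Y.obj Θ ⟶ U)
      (h : T.tySub (G.map (Y.map σ)) (A₀ m) = A₀ (Y.map σ ≫ m))
      (hX : D.tySub σ h (X₀ m) = X₀ (Y.map σ ≫ m))
      (hx : T.tmSub (G.map (Y.map σ)) h (x₀ m) = x₀ (Y.map σ ≫ m)),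
      D.tmSub σ h hX hx (k m) = k (Y.map σ ≫ m)) : D.RanTm X x where
  val m := unindex m (hA₀ m) (hX₀ m) (hx₀ m) (k m)
  nat {Ξ Θ} σ m h hX hx := by
    -- All six indices are generalised at once, after which both uses of `unindex` disappear by
    -- substitution.
    have key : ∀ {A₁ : T.Ty (G.obj (Y.obj Θ))} {A₂ : T.Ty (G.obj (Y.obj Ξ))}
        {X₁ : D.Ty Θ A₁} {X₂ : D.Ty Ξ A₂} {x₁ : T.Tm A₁} {x₂ : T.Tm A₂}
        (h₁ : T.tySub (G.map m) A = A₁) (hX₁ : X.eval m h₁ = X₁)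
        (hx₁ : T.tmSub (G.map m) h₁ x = x₁) (h₂ : T.tySub (G.map (Y.map σ ≫ m)) A = A₂)
        (hX₂ : X.eval (Y.map σ ≫ m) h₂ = X₂) (hx₂ : T.tmSub (G.map (Y.map σ ≫ m)) h₂ x = x₂)
        (z₁ : D.Tm X₁ x₁) (z₂ : D.Tm X₂ x₂) (_ : ∀ h hX hx, D.tmSub σ h hX hx z₁ = z₂),
        D.tmSub σ h hX hx (unindex m h₁ hX₁ hx₁ z₁) =
          unindex (Y.map σ ≫ m) h₂ hX₂ hx₂ z₂ := by
      rintro _ _ _ _ _ _ rfl rfl rfl rfl rfl rfl z₁ z₂ hz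
      exact hz _ _ _
    exact key _ _ _ _ _ _ _ _ (nat σ m)

theorem eval_unindex {Θ : C} (m : Y.obj Θ ⟶ U) {A' : T.Ty (G.obj (Y.obj Θ))} {X' : D.Ty Θ A'}
    {x' : T.Tm A'} (h : T.tySub (G.map m) A = A') (hX : X.eval m h = X')
    (hx : T.tmSub (G.map m) h x = x') (z : D.Tm X' x') (y : D.RanTm X x)
    (hy : y.val m = unindex m h hX hx z) : y.eval m h hX hx = z := by
  subst h hX hx; exact hy

theorem eval_ofChosen {A₀ : ∀ {Θ : C}, (Y.obj Θ ⟶ U) → T.Ty (G.obj (Y.obj Θ))}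
    (hA₀ : ∀ {Θ : C} (m : Y.obj Θ ⟶ U), T.tySub (G.map m) A = A₀ m)
    {X₀ : ∀ {Θ : C} (m : Y.obj Θ ⟶ U), D.Ty Θ (A₀ m)}
    (hX₀ : ∀ {Θ : C} (m : Y.obj Θ ⟶ U), X.eval m (hA₀ m) = X₀ m)
    {x₀ : ∀ {Θ : C} (m : Y.obj Θ ⟶ U), T.Tm (A₀ m)}
    (hx₀ : ∀ {Θ : C} (m : Y.obj Θ ⟶ U), T.tmSub (G.map m) (hA₀ m) x = x₀ m)
    (k : ∀ {Θ : C} (m : Y.obj Θ ⟶ U), D.Tm (X₀ m) (x₀ m)) (nat) {Θ : C} (m : Y.obj Θ ⟶ U)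
    (h : T.tySub (G.map m) A = A₀ m) (hX : X.eval m h = X₀ m)
    (hx : T.tmSub (G.map m) h x = x₀ m) :
    (ofChosen hA₀ hX₀ hx₀ k nat).eval m h hX hx = k m :=
  eval_unindex m h hX hx (k m) _ rfl

/-- Restriction along `n : V ⟶ U`. -/
def sub (y : D.RanTm X x) {V : P} (n : V ⟶ U) {A' : T.Ty (G.obj V)} {X' : D.RanTy V A'}
    {x' : T.Tm A'} (hA : T.tySub (G.map n) A = A') (hX : X.sub n hA = X')
    (hx : T.tmSub (G.map n) hA x = x') : D.RanTm X' x' where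
  val m := y.eval (m ≫ n) (base_trans m n hA rfl)
    (by subst hX; exact (X.eval_sub n hA m rfl rfl _).symm) (base_tmSub_trans _ hx rfl)
  nat σ m h hX' hx' := y.tmSub_eval σ (m ≫ n) (Category.assoc _ _ _).symm _ _ _ h hX' hx' _ _ _

theorem eval_sub (y : D.RanTm X x) {V : P} (n : V ⟶ U) {A' : T.Ty (G.obj V)}
    {X' : D.RanTy V A'} {x' : T.Tm A'} (hA : T.tySub (G.map n) A = A') (hX : X.sub n hA = X')
    (hx : T.tmSub (G.map n) hA x = x') {Θ : C} (m : Y.obj Θ ⟶ V) {m' : Y.obj Θ ⟶ U}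
    (hm : m ≫ n = m') {A'' : T.Ty (G.obj (Y.obj Θ))} {X'' : D.Ty Θ A''} {x'' : T.Tm A''}
    (h : T.tySub (G.map m) A' = A'') (hX' : X'.eval m h = X'')
    (hx' : T.tmSub (G.map m) h x' = x'') (h' : T.tySub (G.map m') A = A'')
    (hX'' : X.eval m' h' = X'') (hx'' : T.tmSub (G.map m') h' x = x'') :
    (y.sub n hA hX hx).eval m h hX' hx' = y.eval m' h' hX'' hx'' := by
  subst hm h hX' hx'; rfl

end RanTm

/-- The extension of displayed types and terms over `Y ⋙ G` to displayed types and terms over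
`G`. -/
def ran : DispTyTm.{u, v, u₂, v₂, a, b, max u₁ v c, max u₁ v d} T G where
  Ty := D.RanTy
  tySub n _ _ h X := X.sub n h
  tySub_id h X := RanTy.ext_eval fun m _ h' => by
    rw [X.eval_sub _ h m rfl h' (base_trans _ _ h h')]
    exact X.eval_congr (Category.comp_id m) _ _
  -- Both sides at a point `m` are the value of `X` at `m ≫ τ ≫ σ`, up to associativity.
  tySub_comp τ σ _ _ _ h h' h'' X := RanTy.ext_eval fun m _ k => by
    rw [X.eval_sub _ h'' m rfl k (base_trans _ _ h'' k),
      RanTy.eval_sub _ τ h' m rfl k (base_trans _ _ h' k),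
      RanTy.eval_sub _ σ h (m ≫ τ) (Category.assoc _ _ _) _ _]
  Tm := D.RanTm
  tmSub n _ _ _ _ _ _ h hX hx y := y.sub n h hX hx
  tmSub_id h hX hx y := RanTm.ext_eval fun m _ _ _ h' hX' hx' =>
    y.eval_sub _ h hX hx m (Category.comp_id m) h' hX' hx' h' hX' hx'
  tmSub_comp τ σ _ _ _ _ _ _ _ _ _ h hX hx h' hX' hx' h'' hX'' hx'' y :=
    RanTm.ext_eval fun m _ _ _ k kX kx => by
      have h₁ := base_trans _ _ h'' k
      have hX₁ := (RanTy.eval_of_sub_eq hX'' m rfl k h₁).symm.trans kX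
      have hx₁ := base_tmSub_trans h₁ hx'' kx
      have h₂ := base_trans _ _ h' k
      have hX₂ := (RanTy.eval_of_sub_eq hX' m rfl k h₂).symm.trans kX
      have hx₂ := base_tmSub_trans h₂ hx' kx
      rw [y.eval_sub _ h'' hX'' hx'' m rfl k kX kx h₁ hX₁ hx₁,
        RanTm.eval_sub _ τ h' hX' hx' m rfl k kX kx h₂ hX₂ hx₂]
      exact (y.eval_sub σ h hX hx (m ≫ τ) (Category.assoc _ _ _) _ _ _ _ _ _).symm

end DispTyTm

/-! ### The extension along a fully faithful functor -/

namespace DispTyTm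

section

variable {P : Type u} [Category.{v} P] {S : Type u₂} [Category.{v₂} S]
  {T : TyTm.{u₂, v₂, a, b} S} {G : P ⥤ S} {U V W : P} {A : T.Ty (G.obj U)} {A' : T.Ty (G.obj V)}
  {A'' : T.Ty (G.obj W)} {ρ : V ⟶ U} {m : W ⟶ V} {m' : W ⟶ U} {B : T.TyFam A}

theorem base_trans_eq (hm : m ≫ ρ = m') (h : T.tySub (G.map ρ) A = A')
    (h' : T.tySub (G.map m) A' = A'') : T.tySub (G.map m') A = A'' := by
  subst hm; exact base_trans m ρ h h'

/-- Naturality of `B` along `m`. It supplies the base equation whenever a value at `ρ` is compared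
with the value at a composite. -/
theorem base_app (hm : m ≫ ρ = m') {h : T.tySub (G.map ρ) A = A'}
    {h' : T.tySub (G.map m) A' = A''} (h'' : T.tySub (G.map m') A = A'') {x : T.Tm A'}
    {x' : T.Tm A''} (hx : T.tmSub (G.map m) h' x = x') {B' : T.Ty (G.obj V)}
    {B'' : T.Ty (G.obj W)} (hB : B.app (G.map ρ) h x = B') (hB' : T.tySub (G.map m) B' = B'') :
    B.app (G.map m') h'' x' = B'' := by
  subst hm hB hB'
  exact (B.nat' (G.map m) (G.map ρ) (G.map_comp m ρ).symm h h' h'' hx).symm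

theorem base_tmApp {t : T.TmFam B} (hm : m ≫ ρ = m') {h : T.tySub (G.map ρ) A = A'}
    {h' : T.tySub (G.map m) A' = A''} {h'' : T.tySub (G.map m') A = A''} {x : T.Tm A'}
    {x' : T.Tm A''} (hx : T.tmSub (G.map m) h' x = x') {B' : T.Ty (G.obj V)}
    {B'' : T.Ty (G.obj W)} {hB : B.app (G.map ρ) h x = B'} {hB' : T.tySub (G.map m) B' = B''}
    (hB'' : B.app (G.map m') h'' x' = B'') {t' : T.Tm B'} {t'' : T.Tm B''}
    (ht : t.app (G.map ρ) h x hB = t') (ht' : T.tmSub (G.map m) hB' t' = t'') :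
    t.app (G.map m') h'' x' hB'' = t'' := by
  subst hm ht ht'
  exact (t.nat' (G.map m) (G.map ρ) (G.map_comp m ρ).symm h h' h'' hx hB hB' hB'').symm

end

variable {C : Type u₁} [Category.{v₁} C] {P : Type u} [Category.{v} P]
  {S : Type u₂} [Category.{v₂} S] {T : TyTm.{u₂, v₂, a, b} S} {Y : C ⥤ P} {G : P ⥤ S}
  {D : DispTyTm.{u₁, v₁, u₂, v₂, a, b, c, d} T (Y ⋙ G)} (hY : Y.FullyFaithful)

namespace RanTy

/-- The action on displayed types. -/
def ofTy {Γ : C} {A : T.Ty (G.obj (Y.obj Γ))} (X : D.Ty Γ A) : D.RanTy (Y.obj Γ) A where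
  -- By fullness `m` is the image of a morphism of `C`, along which `X` is restricted.
  val m := D.tySub (hY.preimage m)
    (T.tySub_congr (congrArg G.map (hY.map_preimage m)) A) X
  nat σ m h := by
    have h₁ : T.tySub (G.map (Y.map (σ ≫ hY.preimage m))) A =
        T.tySub (G.map (Y.map σ ≫ m)) A := by simp
    refine (D.tySub_comp σ (hY.preimage m) _ h h₁ X).symm.trans (tySub_congr ?_ _ _ _)
    -- Faithfulness makes the choice of preimages compatible with composition.
    exact hY.map_injective (by simp)

theorem eval_ofTy {Γ : C} {A : T.Ty (G.obj (Y.obj Γ))} (X : D.Ty Γ A) {Θ : C} {σ : Θ ⟶ Γ}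
    {m : Y.obj Θ ⟶ Y.obj Γ} (hm : Y.map σ = m) {A' : T.Ty (G.obj (Y.obj Θ))}
    (h : T.tySub (G.map m) A = A') (h' : T.tySub (G.map (Y.map σ)) A = A') :
    (ofTy hY X).eval m h = D.tySub σ h' X := by
  subst hm h
  exact tySub_congr (hY.preimage_map σ) _ _ _

theorem eval_id_ofTy {Γ : C} {A : T.Ty (G.obj (Y.obj Γ))} (X : D.Ty Γ A)
    (h : T.tySub (G.map (𝟙 (Y.obj Γ))) A = A) : (ofTy hY X).eval (𝟙 (Y.obj Γ)) h = X :=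
  (eval_ofTy hY X (Y.map_id Γ) h (base_id (F := Y ⋙ G) Γ A)).trans (D.tySub_id _ X)

variable {U : P} {A : T.Ty (G.obj U)}

/-- A further point `n` of `Y Θ` is `Y` of some `ρ` by fullness, and by naturality the value of `X`
at `n ≫ m` is the restriction along `ρ` of its value at `m`. Hence a displayed type restricted to a
representable comes from a single displayed type over `C`. -/
theorem sub_eq_ofTy {X : D.RanTy U A} {Θ : C} {m : Y.obj Θ ⟶ U} {A' : T.Ty (G.obj (Y.obj Θ))}
    {h : T.tySub (G.map m) A = A'} {X' : D.Ty Θ A'} (hX : X.eval m h = X') :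
    X.sub m h = ofTy hY X' := by
  subst hX
  refine ext_eval fun n _ k => ?_
  have hn := hY.map_preimage n
  have k' := (T.tySub_congr (congrArg G.map hn) A').trans k
  rw [X.eval_sub m h n rfl k (base_trans n m h k), eval_ofTy hY _ hn k k']
  exact (X.tySub_eval _ _ (by rw [hn]) _ _ _).symm

theorem eval_eq_of_sub_eq_ofTy {X : D.RanTy U A} {Θ : C} {m : Y.obj Θ ⟶ U}
    {A' : T.Ty (G.obj (Y.obj Θ))} {h : T.tySub (G.map m) A = A'} {X' : D.Ty Θ A'}
    (hX : X.sub m h = ofTy hY X') : X.eval m h = X' := by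
  rw [← X.eval_sub m h (𝟙 _) (Category.id_comp m) (base_id _ _) h, hX]
  exact eval_id_ofTy hY X' _

end RanTy

namespace RanTm

/-- The action on displayed terms. -/
def ofTm {Γ : C} {A : T.Ty (G.obj (Y.obj Γ))} {X : D.Ty Γ A} {x : T.Tm A} (y : D.Tm X x) :
    D.RanTm (RanTy.ofTy hY X) x where
  val m := D.tmSub (hY.preimage m)
    (T.tySub_congr (congrArg G.map (hY.map_preimage m)) A) rfl
    (T.tmSub_congr (congrArg G.map (hY.map_preimage m)) _ _ x) y
  nat σ m h hX hx := by
    have h₁ : T.tySub (G.map (Y.map (σ ≫ hY.preimage m))) A =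
        T.tySub (G.map (Y.map σ ≫ m)) A := by simp
    have hm : σ ≫ hY.preimage m = hY.preimage (Y.map σ ≫ m) := hY.map_injective (by simp)
    refine (D.tmSub_comp σ (hY.preimage m) _ rfl _ h hX hx h₁ ?_ ?_ y).symm.trans
      (tmSub_congr hm _ _ _ _ _ _ _)
    · exact tySub_congr hm _ _ _
    · exact T.tmSub_congr (by simp) _ _ _

theorem eval_ofTm {Γ : C} {A : T.Ty (G.obj (Y.obj Γ))} {X : D.Ty Γ A} {x : T.Tm A}
    (y : D.Tm X x) {Θ : C} {σ : Θ ⟶ Γ} {m : Y.obj Θ ⟶ Y.obj Γ} (hm : Y.map σ = m)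
    {A' : T.Ty (G.obj (Y.obj Θ))} {X' : D.Ty Θ A'} {x' : T.Tm A'}
    (h : T.tySub (G.map m) A = A') (hX : (RanTy.ofTy hY X).eval m h = X')
    (hx : T.tmSub (G.map m) h x = x') (h' : T.tySub (G.map (Y.map σ)) A = A')
    (hX' : D.tySub σ h' X = X') (hx' : T.tmSub (G.map (Y.map σ)) h' x = x') :
    (ofTm hY y).eval m h hX hx = D.tmSub σ h' hX' hx' y := by
  subst hm h hX hx
  exact tmSub_congr (hY.preimage_map σ) _ _ _ _ _ _ _

theorem eval_id_ofTm {Γ : C} {A : T.Ty (G.obj (Y.obj Γ))} {X : D.Ty Γ A} {x : T.Tm A}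
    (y : D.Tm X x) (h : T.tySub (G.map (𝟙 (Y.obj Γ))) A = A)
    (hX : (RanTy.ofTy hY X).eval (𝟙 (Y.obj Γ)) h = X)
    (hx : T.tmSub (G.map (𝟙 (Y.obj Γ))) h x = x) :
    (ofTm hY y).eval (𝟙 (Y.obj Γ)) h hX hx = y :=
  (eval_ofTm hY y (Y.map_id Γ) h hX hx (base_id (F := Y ⋙ G) Γ A) (D.tySub_id _ X)
    (base_tmSub_id (F := Y ⋙ G) _ x)).trans (D.tmSub_id _ _ _ y)

/-- The same argument as for `RanTy.sub_eq_ofTy`: naturality determines all values from the one at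
`m`. -/
theorem sub_eq_ofTm {U : P} {A : T.Ty (G.obj U)} {X : D.RanTy U A} {x : T.Tm A}
    {y : D.RanTm X x} {Θ : C} {m : Y.obj Θ ⟶ U} {A' : T.Ty (G.obj (Y.obj Θ))}
    {h : T.tySub (G.map m) A = A'} {X' : D.Ty Θ A'} {hX : X.eval m h = X'} {x' : T.Tm A'}
    {hx : T.tmSub (G.map m) h x = x'} {y' : D.Tm X' x'} (hy : y.eval m h hX hx = y')
    (hX' : X.sub m h = RanTy.ofTy hY X') : y.sub m h hX' hx = ofTm hY y' := by
  subst hy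
  refine ext_eval fun n _ _ _ k kX kx => ?_
  have hn := hY.map_preimage n
  have k' := (T.tySub_congr (congrArg G.map hn) A').trans k
  have kX' := (RanTy.eval_ofTy hY X' hn k k').symm.trans kX
  have kx' := (T.tmSub_congr (congrArg G.map hn) k' k x').trans kx
  have hX₁ := (RanTy.eval_of_sub_eq hX' n rfl k (base_trans n m h k)).symm.trans kX
  have hx₁ := base_tmSub_trans (base_trans n m h k) hx kx
  rw [y.eval_sub m h hX' hx n rfl k kX kx (base_trans n m h k) hX₁ hx₁,
    eval_ofTm hY _ hn k kX kx k' kX' kx']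
  exact (y.tmSub_eval _ _ (by rw [hn]) _ _ _ _ _ _ _ _ _).symm

end RanTm

/-- The action of a fully faithful functor on displayed types and terms of the extension. -/
def ranAction (D : DispTyTm.{u₁, v₁, u₂, v₂, a, b, c, d} T (Y ⋙ G)) (hY : Y.FullyFaithful) :
    DispAction Y G D D.ran where
  ty X := RanTy.ofTy hY X
  ty_sub _ _ _ h X := (RanTy.sub_eq_ofTy hY (RanTy.eval_ofTy hY X rfl h h)).symm
  tm y := RanTm.ofTm hY y
  tm_sub _ _ _ X _ _ _ h hX hX' hx y :=
    (RanTm.sub_eq_ofTm hY (hX := (RanTy.eval_ofTy hY X rfl h h).trans hX)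
      (RanTm.eval_ofTm hY y rfl h _ hx h hX hx) hX').symm

/-- The inverse is evaluation at the identity; surjectivity is `sub_eq_ofTy` and `sub_eq_ofTm` for
the point `𝟙`. -/
theorem ranAction_isBijective : (ranAction D hY).IsBijective where
  ty Γ A := by
    refine ⟨fun X X' h => ?_, fun X => ⟨X.eval (𝟙 _) (base_id _ _), ?_⟩⟩
    · have h' : RanTy.ofTy hY X = RanTy.ofTy hY X' := h
      rw [← RanTy.eval_id_ofTy hY X (base_id _ _), h', RanTy.eval_id_ofTy hY X']
    · exact (RanTy.sub_eq_ofTy hY rfl).symm.trans (D.ran.tySub_id (base_id _ _) X)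
  tm Γ A X x := by
    have hX := RanTy.eval_id_ofTy hY X (base_id _ _)
    have hx := base_tmSub_id (F := G) (base_id _ _) x
    refine ⟨fun y y' h => ?_, fun y => ⟨RanTm.eval y (𝟙 _) (base_id _ _) hX hx, ?_⟩⟩
    · have h' : RanTm.ofTm hY y = RanTm.ofTm hY y' := h
      rw [← RanTm.eval_id_ofTm hY y (base_id _ _) hX hx, h', RanTm.eval_id_ofTm hY y']
    · exact (RanTm.sub_eq_ofTm hY rfl (RanTy.sub_eq_ofTy hY hX)).symm.trans
        (D.ran.tmSub_id (base_id _ _) (RanTy.sub_eq_ofTy hY hX) hx y)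

end DispTyTm

/-! ### Families over the extension

A family over the extension is determined by its values at the points `Y Θ ⟶ U`. -/

namespace DispTyTm

variable {C : Type u₁} [Category.{v₁} C] {P : Type u} [Category.{v} P]
  {S : Type u₂} [Category.{v₂} S] {T : TyTm.{u₂, v₂, a, b} S} {Y : C ⥤ P} {G : P ⥤ S}
  {D : DispTyTm.{u₁, v₁, u₂, v₂, a, b, c, d} T (Y ⋙ G)} (hY : Y.FullyFaithful)
  {U : P} {A : T.Ty (G.obj U)} {X : D.RanTy U A} {B : T.TyFam A}

namespace TyFam

/-- The value of a family at a point `m` and a displayed term over it. -/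
def pt (E : D.ran.TyFam X B) {Δ : C} (m : Y.obj Δ ⟶ U) {A' : T.Ty (G.obj (Y.obj Δ))}
    {X' : D.Ty Δ A'} (h : T.tySub (G.map m) A = A') (hX : X.eval m h = X') {x : T.Tm A'}
    (z : D.Tm X' x) {B' : T.Ty (G.obj (Y.obj Δ))} (hB : B.app (G.map m) h x = B') : D.Ty Δ B' :=
  RanTy.eval (E.app m h (RanTy.sub_eq_ofTy hY hX) (RanTm.ofTm hY z) hB) (𝟙 _) (base_id _ _)

theorem pt_congr (E : D.ran.TyFam X B) {Δ : C} {m m' : Y.obj Δ ⟶ U} (hm : m = m')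
    {A' : T.Ty (G.obj (Y.obj Δ))} {X' X'' : D.Ty Δ A'} (hXX : X' = X'')
    (h : T.tySub (G.map m) A = A') (hX : X.eval m h = X') (h' : T.tySub (G.map m') A = A')
    (hX' : X.eval m' h' = X'') {x x' : T.Tm A'} (hx : x = x') {z : D.Tm X' x} {z' : D.Tm X'' x'}
    (hz : D.castTm hXX hx z = z') {B' : T.Ty (G.obj (Y.obj Δ))}
    (hB : B.app (G.map m) h x = B') (hB' : B.app (G.map m') h' x' = B') :
    E.pt hY m h hX z hB = E.pt hY m' h' hX' z' hB' := by
  subst hm hXX hx hz; rfl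

/-- The central reduction. Naturality of `E` along `m` moves the value from `ρ` to `m ≫ ρ`, and the
displayed term restricted along `m` is the action of `Y` on its value at `m` by `RanTm.sub_eq_ofTm`;
what remains is a value at a point. -/
theorem eval_app (E : D.ran.TyFam X B) {V : P} (ρ : V ⟶ U) {A₁ : T.Ty (G.obj V)}
    {X₁ : D.RanTy V A₁} (h : T.tySub (G.map ρ) A = A₁) (hX : X.sub ρ h = X₁) {x₁ : T.Tm A₁}
    (z : D.RanTm X₁ x₁) {B₁ : T.Ty (G.obj V)} (hB : B.app (G.map ρ) h x₁ = B₁)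
    {Θ : C} (m : Y.obj Θ ⟶ V) {m' : Y.obj Θ ⟶ U} (hm : m ≫ ρ = m')
    {A₂ : T.Ty (G.obj (Y.obj Θ))} {X₂ : D.Ty Θ A₂} {x₂ : T.Tm A₂}
    (h₁ : T.tySub (G.map m) A₁ = A₂) (hX₁ : X₁.eval m h₁ = X₂)
    (hx₁ : T.tmSub (G.map m) h₁ x₁ = x₂) {z₂ : D.Tm X₂ x₂} (hz : z.eval m h₁ hX₁ hx₁ = z₂)
    {B₂ : T.Ty (G.obj (Y.obj Θ))} (hB₁ : T.tySub (G.map m) B₁ = B₂)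
    (h₂ : T.tySub (G.map m') A = A₂) (hX₂ : X.eval m' h₂ = X₂)
    (hB₂ : B.app (G.map m') h₂ x₂ = B₂) :
    RanTy.eval (E.app ρ h hX z hB) m hB₁ = E.pt hY m' h₂ hX₂ z₂ hB₂ := by
  have := E.nat' m ρ hm h hX h₁ (RanTy.sub_eq_ofTy hY hX₁) hx₁
    (RanTm.sub_eq_ofTm hY hz (RanTy.sub_eq_ofTy hY hX₁)) h₂ (RanTy.sub_eq_ofTy hY hX₂) hB hB₁ hB₂
  unfold pt
  rw [← this]
  exact (RanTy.eval_sub _ m hB₁ (𝟙 _) (Category.id_comp m) _ _).symm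

/-- Restricting along `σ` amounts to reading the value at `m` at the point `Y.map σ`, which
`eval_app` computes. -/
theorem tySub_pt (E : D.ran.TyFam X B) {Θ Δ : C} (σ : Θ ⟶ Δ) (m : Y.obj Δ ⟶ U)
    {m' : Y.obj Θ ⟶ U} (hm : Y.map σ ≫ m = m') {A' : T.Ty (G.obj (Y.obj Δ))}
    {A'' : T.Ty (G.obj (Y.obj Θ))} {X' : D.Ty Δ A'} {X'' : D.Ty Θ A''} {x : T.Tm A'}
    {x' : T.Tm A''} (h : T.tySub (G.map m) A = A') (hX : X.eval m h = X')
    (h' : T.tySub (G.map (Y.map σ)) A' = A'') (hX' : D.tySub σ h' X' = X'')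
    (hx : T.tmSub (G.map (Y.map σ)) h' x = x') {z : D.Tm X' x} {z' : D.Tm X'' x'}
    (hz : D.tmSub σ h' hX' hx z = z') (h'' : T.tySub (G.map m') A = A'')
    (hX'' : X.eval m' h'' = X'') {B' : T.Ty (G.obj (Y.obj Δ))} {B'' : T.Ty (G.obj (Y.obj Θ))}
    (hB : B.app (G.map m) h x = B') (hB' : T.tySub (G.map (Y.map σ)) B' = B'')
    (hB'' : B.app (G.map m') h'' x' = B'') :
    D.tySub σ hB' (E.pt hY m h hX z hB) = E.pt hY m' h'' hX'' z' hB'' := by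
  refine (RanTy.tySub_eval _ σ (𝟙 _) (Category.comp_id _) _ hB' hB').trans ?_
  exact E.eval_app hY m h _ _ hB (Y.map σ) hm h' ((RanTy.eval_ofTy hY X' rfl h' h').trans hX') hx
    ((RanTm.eval_ofTm hY z rfl h' _ hx h' hX' hx).trans hz) hB' h'' hX'' hB''

/-- By `eval_app`, every value of a family, read at any point, is one of its values at points. -/
theorem ext_pt {E E' : D.ran.TyFam X B}
    (hE : ∀ {Δ : C} (m : Y.obj Δ ⟶ U) {A' : T.Ty (G.obj (Y.obj Δ))} {X' : D.Ty Δ A'}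
      (h : T.tySub (G.map m) A = A') (hX : X.eval m h = X') {x : T.Tm A'} (z : D.Tm X' x)
      {B' : T.Ty (G.obj (Y.obj Δ))} (hB : B.app (G.map m) h x = B'),
      E.pt hY m h hX z hB = E'.pt hY m h hX z hB) : E = E' := by
  refine ext_app fun ρ _ X₁ h hX x z _ hB => RanTy.ext_eval fun m _ hB₁ => ?_
  have hX₂ := (RanTy.eval_of_sub_eq (hA := h) hX m rfl rfl (base_trans m ρ h rfl)).symm
  have hB₂ := base_app rfl (base_trans m ρ h rfl) (rfl : T.tmSub (G.map m) rfl x = _) hB hB₁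
  rw [E.eval_app hY ρ h hX z hB m rfl rfl rfl rfl rfl hB₁ _ hX₂ hB₂,
    E'.eval_app hY ρ h hX z hB m rfl rfl rfl rfl rfl hB₁ _ hX₂ hB₂]
  exact hE _ _ _ _ _

end TyFam

/-- The values at points of a family of displayed types over the extension. -/
structure PtTyFam (X : D.RanTy U A) (B : T.TyFam A) where
  app : ∀ {Δ : C} (m : Y.obj Δ ⟶ U) {A' : T.Ty (G.obj (Y.obj Δ))} {X' : D.Ty Δ A'}
    (h : T.tySub (G.map m) A = A') (_ : X.eval m h = X') {x : T.Tm A'} (_ : D.Tm X' x)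
    {B' : T.Ty (G.obj (Y.obj Δ))}, B.app (G.map m) h x = B' → D.Ty Δ B'
  nat : ∀ {Θ Δ : C} (σ : Θ ⟶ Δ) (m : Y.obj Δ ⟶ U) {m' : Y.obj Θ ⟶ U} (_ : Y.map σ ≫ m = m')
    {A' : T.Ty (G.obj (Y.obj Δ))} {A'' : T.Ty (G.obj (Y.obj Θ))} {X' : D.Ty Δ A'}
    {X'' : D.Ty Θ A''} {x : T.Tm A'} {x' : T.Tm A''} (h : T.tySub (G.map m) A = A')
    (hX : X.eval m h = X') (h' : T.tySub (G.map (Y.map σ)) A' = A'')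
    (hX' : D.tySub σ h' X' = X'') (hx : T.tmSub (G.map (Y.map σ)) h' x = x')
    {z : D.Tm X' x} {z' : D.Tm X'' x'} (_ : D.tmSub σ h' hX' hx z = z')
    (h'' : T.tySub (G.map m') A = A'')
    (hX'' : X.eval m' h'' = X'') {B' : T.Ty (G.obj (Y.obj Δ))}
    {B'' : T.Ty (G.obj (Y.obj Θ))} (hB : B.app (G.map m) h x = B')
    (hB' : T.tySub (G.map (Y.map σ)) B' = B'')
    (hB'' : B.app (G.map m') h'' x' = B''),
    D.tySub σ hB' (app m h hX z hB) = app m' h'' hX'' z' hB''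

namespace PtTyFam

/-- The displayed type at `V` with the values prescribed by a family of values at points. -/
def glue (K : PtTyFam X B) {V : P} (ρ : V ⟶ U) {A₁ : T.Ty (G.obj V)}
    {X₁ : D.RanTy V A₁} (h : T.tySub (G.map ρ) A = A₁) (hX : X.sub ρ h = X₁) {x₁ : T.Tm A₁}
    (z : D.RanTm X₁ x₁) {B₁ : T.Ty (G.obj V)} (hB : B.app (G.map ρ) h x₁ = B₁) :
    D.RanTy V B₁ where
  val m := K.app (m ≫ ρ) (base_trans m ρ h rfl)
    (RanTy.eval_of_sub_eq hX m rfl rfl (base_trans m ρ h rfl)).symm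
    (z.eval m rfl rfl rfl) (base_app rfl _ rfl hB rfl)
  nat σ m h' := by
    have h₁ := (base_trans_eq (G := G) (m := Y.map σ) (ρ := m) (A := A₁) rfl rfl rfl).symm
    exact K.nat σ (m ≫ ρ) (Category.assoc _ _ _).symm _ _ h₁
      (X₁.tySub_eval σ m rfl rfl h₁ rfl) (base_tmSub_trans rfl rfl rfl).symm
      (z.tmSub_eval σ m rfl rfl rfl rfl _ _ _ rfl rfl rfl) _ _ _ _ _

theorem eval_glue (K : PtTyFam X B) {V : P} (ρ : V ⟶ U) {A₁ : T.Ty (G.obj V)}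
    {X₁ : D.RanTy V A₁} (h : T.tySub (G.map ρ) A = A₁) (hX : X.sub ρ h = X₁) {x₁ : T.Tm A₁}
    (z : D.RanTm X₁ x₁) {B₁ : T.Ty (G.obj V)} (hB : B.app (G.map ρ) h x₁ = B₁)
    {Θ : C} (m : Y.obj Θ ⟶ V) {m' : Y.obj Θ ⟶ U} (hm : m ≫ ρ = m')
    {A₂ : T.Ty (G.obj (Y.obj Θ))} {X₂ : D.Ty Θ A₂} {x₂ : T.Tm A₂}
    (h₁ : T.tySub (G.map m) A₁ = A₂) (hX₁ : X₁.eval m h₁ = X₂)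
    (hx₁ : T.tmSub (G.map m) h₁ x₁ = x₂) {z₂ : D.Tm X₂ x₂} (hz : z.eval m h₁ hX₁ hx₁ = z₂)
    {B₂ : T.Ty (G.obj (Y.obj Θ))} (hB₁ : T.tySub (G.map m) B₁ = B₂)
    (h₂ : T.tySub (G.map m') A = A₂) (hX₂ : X.eval m' h₂ = X₂)
    (hB₂ : B.app (G.map m') h₂ x₂ = B₂) :
    (K.glue ρ h hX z hB).eval m hB₁ = K.app m' h₂ hX₂ z₂ hB₂ := by
  subst hm h₁ hX₁ hx₁ hz hB₁; rfl

/-- The family with given values at points. -/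
def toTyFam (K : PtTyFam X B) : D.ran.TyFam X B where
  app ρ _ _ h hX _ z _ hB := K.glue ρ h hX z hB
  nat σ ρ A₁ A₂ X₁ X₂ x₁ x₂ h hX h' hX' hx z B₁ B₂ hB hB' hB'' := by
    refine RanTy.ext_eval fun m _ k => ?_
    have h₁ := base_trans m σ h' rfl
    have hX₁ := (RanTy.eval_of_sub_eq (hA := h') hX' m rfl rfl h₁).symm
    have hx₁ := base_tmSub_trans h₁ hx (rfl : T.tmSub (G.map m) rfl x₂ = _)
    have h₂ := base_trans m (σ ≫ ρ) (base_trans σ ρ h h') rfl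
    have hX₂ := (RanTy.eval_of_sub_eq (hA := base_trans σ ρ h h')
      (D.ran.tySub_trans σ ρ hX hX') m rfl rfl h₂).symm
    have hB₂ := base_app rfl h₂ (rfl : T.tmSub (G.map m) rfl x₂ = _) hB'' k
    refine (RanTy.eval_sub _ σ hB' m rfl k (base_trans m σ hB' k)).trans ?_
    rw [K.eval_glue ρ h hX z hB (m ≫ σ) (Category.assoc _ _ _) h₁ hX₁ hx₁ rfl _ h₂ hX₂ hB₂]
    exact (K.eval_glue (σ ≫ ρ) _ _ _ hB'' m rfl rfl rfl rfl
      (RanTm.eval_sub z σ h' hX' hx m rfl rfl rfl rfl h₁ hX₁ hx₁) k h₂ hX₂ hB₂).symm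

/-- The value at a point is read at the identity, where the action of `Y` on a displayed term
returns that term. -/
theorem pt_toTyFam (K : PtTyFam X B) {Δ : C} (m : Y.obj Δ ⟶ U) {A' : T.Ty (G.obj (Y.obj Δ))}
    {X' : D.Ty Δ A'} (h : T.tySub (G.map m) A = A') (hX : X.eval m h = X') {x : T.Tm A'}
    (z : D.Tm X' x) {B' : T.Ty (G.obj (Y.obj Δ))} (hB : B.app (G.map m) h x = B') :
    K.toTyFam.pt hY m h hX z hB = K.app m h hX z hB :=
  K.eval_glue m h (RanTy.sub_eq_ofTy hY hX) _ hB (𝟙 _) (Category.id_comp m)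
    (base_id _ _) (RanTy.eval_id_ofTy hY X' _)
    (base_tmSub_id _ _) (RanTm.eval_id_ofTm hY z _ _ _) _ h hX hB

end PtTyFam

namespace TmFam

variable {E : D.ran.TyFam X B} {t : T.TmFam B}

/-- The value of a dependent function at a point `m` and a displayed term over it. -/
def pt (s : D.ran.TmFam E t) {Δ : C} (m : Y.obj Δ ⟶ U) {A' : T.Ty (G.obj (Y.obj Δ))}
    {X' : D.Ty Δ A'} (h : T.tySub (G.map m) A = A') (hX : X.eval m h = X') {x : T.Tm A'}
    (z : D.Tm X' x) {B' : T.Ty (G.obj (Y.obj Δ))} (hB : B.app (G.map m) h x = B')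
    {Z : D.Ty Δ B'} (hZ : E.pt hY m h hX z hB = Z) {t' : T.Tm B'}
    (ht : t.app (G.map m) h x hB = t') : D.Tm Z t' :=
  RanTm.eval (s.app m h (RanTy.sub_eq_ofTy hY hX) (RanTm.ofTm hY z) hB ht) (𝟙 _) (base_id _ _) hZ
    (base_tmSub_id _ _)

/-- The reduction of `TyFam.eval_app` one level up: naturality of `s` along `m`, over naturality of
`E`. -/
theorem eval_app (s : D.ran.TmFam E t) {V : P} (ρ : V ⟶ U) {A₁ : T.Ty (G.obj V)}
    {X₁ : D.RanTy V A₁} (h : T.tySub (G.map ρ) A = A₁) (hX : X.sub ρ h = X₁) {x₁ : T.Tm A₁}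
    (z : D.RanTm X₁ x₁) {B₁ : T.Ty (G.obj V)} (hB : B.app (G.map ρ) h x₁ = B₁)
    {t₁ : T.Tm B₁} (ht : t.app (G.map ρ) h x₁ hB = t₁)
    {Θ : C} (m : Y.obj Θ ⟶ V) {m' : Y.obj Θ ⟶ U} (hm : m ≫ ρ = m')
    {A₂ : T.Ty (G.obj (Y.obj Θ))} {X₂ : D.Ty Θ A₂} {x₂ : T.Tm A₂}
    (h₁ : T.tySub (G.map m) A₁ = A₂) (hX₁ : X₁.eval m h₁ = X₂)
    (hx₁ : T.tmSub (G.map m) h₁ x₁ = x₂) {z₂ : D.Tm X₂ x₂} (hz : z.eval m h₁ hX₁ hx₁ = z₂)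
    {B₂ : T.Ty (G.obj (Y.obj Θ))} (hB₁ : T.tySub (G.map m) B₁ = B₂)
    {Z₂ : D.Ty Θ B₂} (hZ₁ : RanTy.eval (E.app ρ h hX z hB) m hB₁ = Z₂)
    {t₂ : T.Tm B₂} (ht₁ : T.tmSub (G.map m) hB₁ t₁ = t₂)
    (h₂ : T.tySub (G.map m') A = A₂) (hX₂ : X.eval m' h₂ = X₂)
    (hB₂ : B.app (G.map m') h₂ x₂ = B₂) (hZ₂ : E.pt hY m' h₂ hX₂ z₂ hB₂ = Z₂)
    (ht₂ : t.app (G.map m') h₂ x₂ hB₂ = t₂) :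
    RanTm.eval (s.app ρ h hX z hB ht) m hB₁ hZ₁ ht₁ = s.pt hY m' h₂ hX₂ z₂ hB₂ hZ₂ ht₂ := by
  have hE := E.nat' m ρ hm h hX h₁ (RanTy.sub_eq_ofTy hY hX₁) hx₁
    (RanTm.sub_eq_ofTm hY hz (RanTy.sub_eq_ofTy hY hX₁)) h₂ (RanTy.sub_eq_ofTy hY hX₂) hB hB₁ hB₂
  have := s.nat' m ρ hm h hX h₁ (RanTy.sub_eq_ofTy hY hX₁) hx₁
    (RanTm.sub_eq_ofTm hY hz (RanTy.sub_eq_ofTy hY hX₁)) h₂ (RanTy.sub_eq_ofTy hY hX₂) hB hB₁ hB₂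
    ht ht₁ ht₂ hE
  unfold pt
  rw [← this]
  exact (RanTm.eval_sub _ m hB₁ hE ht₁ (𝟙 _) (Category.id_comp m) _ _ _ _ _ _).symm

theorem tmSub_pt (s : D.ran.TmFam E t) {Θ Δ : C} (σ : Θ ⟶ Δ) (m : Y.obj Δ ⟶ U)
    {m' : Y.obj Θ ⟶ U} (hm : Y.map σ ≫ m = m') {A' : T.Ty (G.obj (Y.obj Δ))}
    {A'' : T.Ty (G.obj (Y.obj Θ))} {X' : D.Ty Δ A'} {X'' : D.Ty Θ A''} {x : T.Tm A'}
    {x' : T.Tm A''} (h : T.tySub (G.map m) A = A') (hX : X.eval m h = X')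
    (h' : T.tySub (G.map (Y.map σ)) A' = A'') (hX' : D.tySub σ h' X' = X'')
    (hx : T.tmSub (G.map (Y.map σ)) h' x = x') {z : D.Tm X' x} {z' : D.Tm X'' x'}
    (hz : D.tmSub σ h' hX' hx z = z') (h'' : T.tySub (G.map m') A = A'')
    (hX'' : X.eval m' h'' = X'') {B' : T.Ty (G.obj (Y.obj Δ))} {B'' : T.Ty (G.obj (Y.obj Θ))}
    (hB : B.app (G.map m) h x = B') (hB' : T.tySub (G.map (Y.map σ)) B' = B'')
    (hB'' : B.app (G.map m') h'' x' = B'') {Z : D.Ty Δ B'} {Z' : D.Ty Θ B''}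
    (hZ : E.pt hY m h hX z hB = Z) (hZ' : D.tySub σ hB' Z = Z')
    (hZ'' : E.pt hY m' h'' hX'' z' hB'' = Z') {t' : T.Tm B'} {t'' : T.Tm B''}
    (ht : t.app (G.map m) h x hB = t') (ht' : T.tmSub (G.map (Y.map σ)) hB' t' = t'')
    (ht'' : t.app (G.map m') h'' x' hB'' = t'') :
    D.tmSub σ hB' hZ' ht' (s.pt hY m h hX z hB hZ ht) =
      s.pt hY m' h'' hX'' z' hB'' hZ'' ht'' := by
  have hX₁ := (RanTy.eval_ofTy hY X' rfl h' h').trans hX'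
  have hz₁ := (RanTm.eval_ofTm hY z rfl h' hX₁ hx h' hX' hx).trans hz
  have hZ₁ := (E.eval_app hY m h (RanTy.sub_eq_ofTy hY hX) (RanTm.ofTm hY z) hB (Y.map σ) hm h'
    hX₁ hx hz₁ hB' h'' hX'' hB'').trans hZ''
  refine (RanTm.tmSub_eval _ σ (𝟙 _) (Category.comp_id _) _ _ _ hB' hZ' ht' hB' hZ₁ ht').trans ?_
  exact s.eval_app hY m h _ _ hB ht (Y.map σ) hm h' hX₁ hx hz₁ hB' hZ₁ ht' h'' hX'' hB'' hZ'' ht''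

theorem ext_pt {s s' : D.ran.TmFam E t}
    (hs : ∀ {Δ : C} (m : Y.obj Δ ⟶ U) {A' : T.Ty (G.obj (Y.obj Δ))} {X' : D.Ty Δ A'}
      (h : T.tySub (G.map m) A = A') (hX : X.eval m h = X') {x : T.Tm A'} (z : D.Tm X' x)
      {B' : T.Ty (G.obj (Y.obj Δ))} (hB : B.app (G.map m) h x = B') {Z : D.Ty Δ B'}
      (hZ : E.pt hY m h hX z hB = Z) {t' : T.Tm B'} (ht : t.app (G.map m) h x hB = t'),
      s.pt hY m h hX z hB hZ ht = s'.pt hY m h hX z hB hZ ht) : s = s' := by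
  refine ext_app fun ρ _ X₁ h hX x z _ hB _ ht => RanTm.ext_eval fun m _ _ _ hB₁ hZ₁ ht₁ => ?_
  have hX₂ := (RanTy.eval_of_sub_eq (hA := h) hX m rfl rfl (base_trans m ρ h rfl)).symm
  have hB₂ := base_app rfl (base_trans m ρ h rfl) (rfl : T.tmSub (G.map m) rfl x = _) hB hB₁
  have hZ₂ := (E.eval_app hY ρ h hX z hB m rfl rfl rfl rfl rfl hB₁ _ hX₂ hB₂).symm.trans hZ₁
  have ht₂ := base_tmApp rfl rfl hB₂ ht ht₁
  rw [s.eval_app hY ρ h hX z hB ht m rfl rfl rfl rfl rfl hB₁ hZ₁ ht₁ _ hX₂ hB₂ hZ₂ ht₂,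
    s'.eval_app hY ρ h hX z hB ht m rfl rfl rfl rfl rfl hB₁ hZ₁ ht₁ _ hX₂ hB₂ hZ₂ ht₂]
  exact hs _ _ _ _ _ _ _

end TmFam

/-- The values at points of a dependent function over the extension. -/
structure PtTmFam (E : D.ran.TyFam X B) (t : T.TmFam B) where
  app : ∀ {Δ : C} (m : Y.obj Δ ⟶ U) {A' : T.Ty (G.obj (Y.obj Δ))} {X' : D.Ty Δ A'}
    (h : T.tySub (G.map m) A = A') (hX : X.eval m h = X') {x : T.Tm A'} (z : D.Tm X' x)
    {B' : T.Ty (G.obj (Y.obj Δ))} (hB : B.app (G.map m) h x = B') {Z : D.Ty Δ B'}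
    (_ : E.pt hY m h hX z hB = Z) {t' : T.Tm B'}, t.app (G.map m) h x hB = t' → D.Tm Z t'
  nat : ∀ {Θ Δ : C} (σ : Θ ⟶ Δ) (m : Y.obj Δ ⟶ U) {m' : Y.obj Θ ⟶ U} (_ : Y.map σ ≫ m = m')
    {A' : T.Ty (G.obj (Y.obj Δ))} {A'' : T.Ty (G.obj (Y.obj Θ))} {X' : D.Ty Δ A'}
    {X'' : D.Ty Θ A''} {x : T.Tm A'} {x' : T.Tm A''} (h : T.tySub (G.map m) A = A')
    (hX : X.eval m h = X') (h' : T.tySub (G.map (Y.map σ)) A' = A'')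
    (hX' : D.tySub σ h' X' = X'') (hx : T.tmSub (G.map (Y.map σ)) h' x = x')
    {z : D.Tm X' x} {z' : D.Tm X'' x'} (_ : D.tmSub σ h' hX' hx z = z')
    (h'' : T.tySub (G.map m') A = A'')
    (hX'' : X.eval m' h'' = X'') {B' : T.Ty (G.obj (Y.obj Δ))}
    {B'' : T.Ty (G.obj (Y.obj Θ))} (hB : B.app (G.map m) h x = B')
    (hB' : T.tySub (G.map (Y.map σ)) B' = B'')
    (hB'' : B.app (G.map m') h'' x' = B'') {Z : D.Ty Δ B'} {Z' : D.Ty Θ B''}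
    (hZ : E.pt hY m h hX z hB = Z) (hZ' : D.tySub σ hB' Z = Z')
    (hZ'' : E.pt hY m' h'' hX'' z' hB'' = Z') {t' : T.Tm B'} {t'' : T.Tm B''}
    (ht : t.app (G.map m) h x hB = t') (ht' : T.tmSub (G.map (Y.map σ)) hB' t' = t'')
    (ht'' : t.app (G.map m') h'' x' hB'' = t''),
    D.tmSub σ hB' hZ' ht' (app m h hX z hB hZ ht) = app m' h'' hX'' z' hB'' hZ'' ht''

namespace PtTmFam

variable {hY}
variable {E : D.ran.TyFam X B} {t : T.TmFam B}

/-- The displayed term at `V` with the values prescribed by a family of values at points. -/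
def glue (K : PtTmFam hY E t) {V : P} (ρ : V ⟶ U) {A₁ : T.Ty (G.obj V)}
    {X₁ : D.RanTy V A₁} (h : T.tySub (G.map ρ) A = A₁) (hX : X.sub ρ h = X₁) {x₁ : T.Tm A₁}
    (z : D.RanTm X₁ x₁) {B₁ : T.Ty (G.obj V)} (hB : B.app (G.map ρ) h x₁ = B₁)
    {t₁ : T.Tm B₁} (ht : t.app (G.map ρ) h x₁ hB = t₁) :
    D.RanTm (E.app ρ h hX z hB) t₁ where
  val m := K.app (m ≫ ρ) (base_trans m ρ h rfl)
    (RanTy.eval_of_sub_eq hX m rfl rfl (base_trans m ρ h rfl)).symm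
    (z.eval m rfl rfl rfl) (base_app rfl _ rfl hB rfl)
    (E.eval_app hY ρ h hX z hB m rfl rfl rfl rfl rfl rfl _ _ _).symm
    (base_tmApp rfl rfl _ ht rfl)
  nat σ m h' hX' hx' := by
    have h₁ := (base_trans_eq (G := G) (m := Y.map σ) (ρ := m) (A := A₁) rfl rfl rfl).symm
    exact K.nat σ (m ≫ ρ) (Category.assoc _ _ _).symm _ _ h₁
      (X₁.tySub_eval σ m rfl rfl h₁ rfl) (base_tmSub_trans rfl rfl rfl).symm
      (z.tmSub_eval σ m rfl rfl rfl rfl _ _ _ rfl rfl rfl) _ _ _ _ _ _ hX' _ _ hx' _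

theorem eval_glue (K : PtTmFam hY E t) {V : P} (ρ : V ⟶ U) {A₁ : T.Ty (G.obj V)}
    {X₁ : D.RanTy V A₁} (h : T.tySub (G.map ρ) A = A₁) (hX : X.sub ρ h = X₁) {x₁ : T.Tm A₁}
    (z : D.RanTm X₁ x₁) {B₁ : T.Ty (G.obj V)} (hB : B.app (G.map ρ) h x₁ = B₁)
    {t₁ : T.Tm B₁} (ht : t.app (G.map ρ) h x₁ hB = t₁)
    {Θ : C} (m : Y.obj Θ ⟶ V) {m' : Y.obj Θ ⟶ U} (hm : m ≫ ρ = m')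
    {A₂ : T.Ty (G.obj (Y.obj Θ))} {X₂ : D.Ty Θ A₂} {x₂ : T.Tm A₂}
    (h₁ : T.tySub (G.map m) A₁ = A₂) (hX₁ : X₁.eval m h₁ = X₂)
    (hx₁ : T.tmSub (G.map m) h₁ x₁ = x₂) {z₂ : D.Tm X₂ x₂} (hz : z.eval m h₁ hX₁ hx₁ = z₂)
    {B₂ : T.Ty (G.obj (Y.obj Θ))} (hB₁ : T.tySub (G.map m) B₁ = B₂)
    {Z₂ : D.Ty Θ B₂} (hZ₁ : RanTy.eval (E.app ρ h hX z hB) m hB₁ = Z₂)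
    {t₂ : T.Tm B₂} (ht₁ : T.tmSub (G.map m) hB₁ t₁ = t₂)
    (h₂ : T.tySub (G.map m') A = A₂) (hX₂ : X.eval m' h₂ = X₂)
    (hB₂ : B.app (G.map m') h₂ x₂ = B₂) (hZ₂ : E.pt hY m' h₂ hX₂ z₂ hB₂ = Z₂)
    (ht₂ : t.app (G.map m') h₂ x₂ hB₂ = t₂) :
    (K.glue ρ h hX z hB ht).eval m hB₁ hZ₁ ht₁ = K.app m' h₂ hX₂ z₂ hB₂ hZ₂ ht₂ := by
  subst hm h₁ hX₁ hx₁ hz hB₁ hZ₁ ht₁; rfl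

/-- The dependent function with given values at points. -/
def toTmFam (K : PtTmFam hY E t) : D.ran.TmFam E t where
  app ρ _ _ h hX _ z _ hB _ ht := K.glue ρ h hX z hB ht
  nat σ ρ A₁ A₂ X₁ X₂ x₁ x₂ h hX h' hX' hx z B₁ B₂ hB hB' hB'' t₁ t₂ ht ht' ht'' := by
    refine RanTm.ext_eval fun m _ _ _ k kZ kt => ?_
    have h₁ := base_trans m σ h' rfl
    have hX₁ := (RanTy.eval_of_sub_eq (hA := h') hX' m rfl rfl h₁).symm
    have hx₁ := base_tmSub_trans h₁ hx (rfl : T.tmSub (G.map m) rfl x₂ = _)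
    have h₂ := base_trans m (σ ≫ ρ) (base_trans σ ρ h h') rfl
    have hX₂ := (RanTy.eval_of_sub_eq (hA := base_trans σ ρ h h')
      (D.ran.tySub_trans σ ρ hX hX') m rfl rfl h₂).symm
    have hB₂ := base_app rfl h₂ (rfl : T.tmSub (G.map m) rfl x₂ = _) hB'' k
    have k₁ := base_trans m σ hB' k
    -- The two displayed types of values differ by naturality of `E`; this equation supplies the
    -- index for restricting the displayed term along `σ`.
    have hE := E.nat σ ρ h hX h' hX' hx z hB hB' hB''
    have kZ₁ := (RanTy.eval_of_sub_eq (hA := hB') hE m rfl k k₁).symm.trans kZ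
    have kt₁ := base_tmSub_trans k₁ ht' kt
    have hZ₂ := (E.eval_app hY ρ h hX z hB (m ≫ σ) (Category.assoc _ _ _) h₁ hX₁ hx₁ rfl k₁ h₂ hX₂
      hB₂).symm.trans kZ₁
    have ht₂ := base_tmApp rfl rfl hB₂ ht'' kt
    refine (RanTm.eval_sub _ σ hB' hE ht' m rfl k kZ kt k₁ kZ₁ kt₁).trans ?_
    rw [K.eval_glue ρ h hX z hB ht (m ≫ σ) (Category.assoc _ _ _) h₁ hX₁ hx₁ rfl k₁ kZ₁ kt₁ h₂ hX₂
      hB₂ hZ₂ ht₂]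
    exact (K.eval_glue (σ ≫ ρ) _ _ _ hB'' ht'' m rfl rfl rfl rfl
      (RanTm.eval_sub z σ h' hX' hx m rfl rfl rfl rfl h₁ hX₁ hx₁) k kZ kt h₂ hX₂ hB₂ hZ₂ ht₂).symm

theorem pt_toTmFam (K : PtTmFam hY E t) {Δ : C} (m : Y.obj Δ ⟶ U)
    {A' : T.Ty (G.obj (Y.obj Δ))} {X' : D.Ty Δ A'} (h : T.tySub (G.map m) A = A')
    (hX : X.eval m h = X') {x : T.Tm A'} (z : D.Tm X' x) {B' : T.Ty (G.obj (Y.obj Δ))}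
    (hB : B.app (G.map m) h x = B') {Z : D.Ty Δ B'} (hZ : E.pt hY m h hX z hB = Z) {t' : T.Tm B'}
    (ht : t.app (G.map m) h x hB = t') :
    K.toTmFam.pt hY m h hX z hB hZ ht = K.app m h hX z hB hZ ht :=
  K.eval_glue m h (RanTy.sub_eq_ofTy hY hX) _ hB ht (𝟙 _) (Category.id_comp m) (base_id _ _)
    (RanTy.eval_id_ofTy hY X' _) (base_tmSub_id _ _) (RanTm.eval_id_ofTm hY z _ _ _) _ _ _ h hX hB
    _ ht

end PtTmFam

end DispTyTm

/-! ### Equality tests at chosen representatives and at the identity -/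

namespace DispTyTm

variable {C : Type u₁} [Category.{v₁} C] {P : Type u} [Category.{v} P]
  {S : Type u₂} [Category.{v₂} S] {T : TyTm.{u₂, v₂, a, b} S} {Y : C ⥤ P} {G : P ⥤ S}
  {D : DispTyTm.{u₁, v₁, u₂, v₂, a, b, c, d} T (Y ⋙ G)} (hY : Y.FullyFaithful)

/-- Values of an operation are known only over the type formed after restriction; testing there
suffices, since the equation between the types can be substituted. -/
theorem RanTy.ext_chosen {U : P} {A : T.Ty (G.obj U)} {X X' : D.RanTy U A}
    {A₀ : ∀ {Θ : C}, (Y.obj Θ ⟶ U) → T.Ty (G.obj (Y.obj Θ))}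
    (hA₀ : ∀ {Θ : C} (m : Y.obj Θ ⟶ U), T.tySub (G.map m) A = A₀ m)
    (hX : ∀ {Θ : C} (m : Y.obj Θ ⟶ U), X.eval m (hA₀ m) = X'.eval m (hA₀ m)) : X = X' := by
  refine ext_eval fun {Θ} m A' h => ?_
  have key : ∀ {A₁ : T.Ty (G.obj (Y.obj Θ))} (h₁ : T.tySub (G.map m) A = A₁),
      X.eval m h₁ = X'.eval m h₁ → X.eval m h = X'.eval m h := by
    rintro _ rfl e
    subst h
    exact e
  exact key (hA₀ m) (hX m)

theorem RanTm.ext_chosen {U : P} {A : T.Ty (G.obj U)} {X : D.RanTy U A} {x : T.Tm A}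
    {y y' : D.RanTm X x}
    {A₀ : ∀ {Θ : C}, (Y.obj Θ ⟶ U) → T.Ty (G.obj (Y.obj Θ))}
    (hA₀ : ∀ {Θ : C} (m : Y.obj Θ ⟶ U), T.tySub (G.map m) A = A₀ m)
    {X₀ : ∀ {Θ : C} (m : Y.obj Θ ⟶ U), D.Ty Θ (A₀ m)}
    (hX₀ : ∀ {Θ : C} (m : Y.obj Θ ⟶ U), X.eval m (hA₀ m) = X₀ m)
    {x₀ : ∀ {Θ : C} (m : Y.obj Θ ⟶ U), T.Tm (A₀ m)}
    (hx₀ : ∀ {Θ : C} (m : Y.obj Θ ⟶ U), T.tmSub (G.map m) (hA₀ m) x = x₀ m)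
    (hy : ∀ {Θ : C} (m : Y.obj Θ ⟶ U),
      y.eval m (hA₀ m) (hX₀ m) (hx₀ m) = y'.eval m (hA₀ m) (hX₀ m) (hx₀ m)) : y = y' := by
  refine ext_eval fun {Θ} m A' X' x' h hX hx => ?_
  have key : ∀ {A₁ : T.Ty (G.obj (Y.obj Θ))} (h₁ : T.tySub (G.map m) A = A₁)
      {X₁ : D.Ty Θ A₁} (hX₁ : X.eval m h₁ = X₁) {x₁ : T.Tm A₁}
      (hx₁ : T.tmSub (G.map m) h₁ x = x₁),
      y.eval m h₁ hX₁ hx₁ = y'.eval m h₁ hX₁ hx₁ → y.eval m h hX hx = y'.eval m h hX hx := by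
    rintro _ rfl _ rfl _ rfl e
    subst h hX hx
    exact e
  exact key (hA₀ m) (hX₀ m) (hx₀ m) (hy m)

theorem RanTm.eval_castTm {U : P} {A : T.Ty (G.obj U)} {X X₁ : D.RanTy U A} {x x₁ : T.Tm A}
    (hXX : X = X₁) (hxx : x = x₁) (y : D.RanTm X x) {Θ : C} (m : Y.obj Θ ⟶ U)
    {A' : T.Ty (G.obj (Y.obj Θ))} {X' : D.Ty Θ A'} {x' : T.Tm A'} (h : T.tySub (G.map m) A = A')
    (hX : X₁.eval m h = X') (hx : T.tmSub (G.map m) h x₁ = x') (hX' : X.eval m h = X')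
    (hx' : T.tmSub (G.map m) h x = x') :
    RanTm.eval (D.ran.castTm (X := X) (X' := X₁) hXX hxx y) m h hX hx = y.eval m h hX' hx' := by
  subst hXX hxx; rfl

theorem RanTy.eq_ofTy {Γ : C} {A : T.Ty (G.obj (Y.obj Γ))} {X : D.RanTy (Y.obj Γ) A}
    {X' : D.Ty Γ A} {h : T.tySub (G.map (𝟙 _)) A = A} (hX : X.eval (𝟙 _) h = X') :
    X = RanTy.ofTy hY X' :=
  (D.ran.tySub_id h X).symm.trans (RanTy.sub_eq_ofTy hY hX)

/-- Restriction along the identity does nothing, yet by `sub_eq_ofTm` it depends only on the value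
at the identity. -/
theorem RanTm.ext_id (hY : Y.FullyFaithful) {Γ : C} {A : T.Ty (G.obj (Y.obj Γ))}
    {X : D.RanTy (Y.obj Γ) A} {x : T.Tm A}
    {y y' : D.RanTm X x} {h : T.tySub (G.map (𝟙 _)) A = A} {X' : D.Ty Γ A}
    (hX : X.eval (𝟙 _) h = X') {hx : T.tmSub (G.map (𝟙 _)) h x = x}
    (hy : y.eval (𝟙 _) h hX hx = y'.eval (𝟙 _) h hX hx) : y = y' := by
  obtain rfl := RanTy.eq_ofTy hY hX
  have e := (RanTm.sub_eq_ofTm hY hy (RanTy.sub_eq_ofTy hY hX)).trans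
    (RanTm.sub_eq_ofTm hY rfl (RanTy.sub_eq_ofTy hY hX)).symm
  exact (D.ran.tmSub_id h (RanTy.sub_eq_ofTy hY hX) hx y).symm.trans
    (e.trans (D.ran.tmSub_id h (RanTy.sub_eq_ofTy hY hX) hx y'))

/-! ### Restriction of families to the points of an object -/

section Restriction

variable {U : P} {A : T.Ty (G.obj U)} {X : D.RanTy U A} {B : T.TyFam A}

theorem RanTy.eval_trans {Θ Δ : C} {m : Y.obj Θ ⟶ U} {A' : T.Ty (G.obj (Y.obj Θ))}
    {X' : D.Ty Θ A'} {hA : T.tySub (G.map m) A = A'} (hX : X.eval m hA = X') {ρ : Δ ⟶ Θ}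
    {m' : Y.obj Δ ⟶ U} (hm : Y.map ρ ≫ m = m') {A₁ : T.Ty (G.obj (Y.obj Δ))} {X₁ : D.Ty Δ A₁}
    {h : T.tySub (G.map (Y.map ρ)) A' = A₁} (hX' : D.tySub ρ h X' = X₁)
    (h₂ : T.tySub (G.map m') A = A₁) : X.eval m' h₂ = X₁ := by
  subst hX hX'; exact (X.tySub_eval ρ m hm hA h h₂).symm

/-- The restriction of a family over the extension to a family over `C` along a point. -/
def TyFam.restr (E : D.ran.TyFam X B) {Θ : C} (m : Y.obj Θ ⟶ U)
    {A' : T.Ty (G.obj (Y.obj Θ))} {X' : D.Ty Θ A'} (hA : T.tySub (G.map m) A = A')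
    (hX : X.eval m hA = X') : D.TyFam X' (B.sub (G.map m) hA) where
  app ρ _ _ h hX' _ z _ hB :=
    E.pt hY (Y.map ρ ≫ m) (base_trans (Y.map ρ) m hA h)
      (RanTy.eval_trans hX rfl hX' _) z
      ((B.app_congr (G.map_comp _ _) _ _ rfl).trans hB)
  nat σ ρ _ _ _ _ _ _ h hX h' hX' hx z _ _ hB hB' hB'' :=
    E.tySub_pt hY σ _ (by rw [Y.map_comp, Category.assoc]) _ _ h' hX' hx rfl _ _ _ hB' _

theorem TyFam.restr_app (E : D.ran.TyFam X B) {Θ : C} {m : Y.obj Θ ⟶ U}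
    {A' : T.Ty (G.obj (Y.obj Θ))} {X' : D.Ty Θ A'} {hA : T.tySub (G.map m) A = A'}
    {hX : X.eval m hA = X'} {Δ : C} {ρ : Δ ⟶ Θ} {m' : Y.obj Δ ⟶ U} (hm : Y.map ρ ≫ m = m')
    {A₁ : T.Ty (G.obj (Y.obj Δ))} {X₁ : D.Ty Δ A₁} (h : T.tySub (G.map (Y.map ρ)) A' = A₁)
    (hX' : D.tySub ρ h X' = X₁) {x : T.Tm A₁} (z : D.Tm X₁ x) {B₁ : T.Ty (G.obj (Y.obj Δ))}
    (hB : (B.sub (G.map m) hA).app (G.map (Y.map ρ)) h x = B₁)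
    (h₂ : T.tySub (G.map m') A = A₁) (hX₂ : X.eval m' h₂ = X₁)
    (hB₂ : B.app (G.map m') h₂ x = B₁) :
    (E.restr hY m hA hX).app ρ h hX' z hB = E.pt hY m' h₂ hX₂ z hB₂ := by
  subst hm; rfl

/-- Both sides are the value of `E` at the common composite point. This is the compatibility of the
restricted families as the point varies, needed for naturality of the operations. -/
theorem TyFam.restr_app_congr (E : D.ran.TyFam X B) {Θ Θ' : C} {m : Y.obj Θ ⟶ U}
    {A' : T.Ty (G.obj (Y.obj Θ))} {X' : D.Ty Θ A'} {hA : T.tySub (G.map m) A = A'}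
    {hX : X.eval m hA = X'} {m' : Y.obj Θ' ⟶ U}
    {A'' : T.Ty (G.obj (Y.obj Θ'))} {X'' : D.Ty Θ' A''} {hA' : T.tySub (G.map m') A = A''}
    {hX' : X.eval m' hA' = X''} {Δ : C} {ρ : Δ ⟶ Θ} {ρ' : Δ ⟶ Θ'}
    (hm : Y.map ρ ≫ m = Y.map ρ' ≫ m')
    {A₁ : T.Ty (G.obj (Y.obj Δ))} {X₁ : D.Ty Δ A₁} (h : T.tySub (G.map (Y.map ρ)) A' = A₁)
    (hX₁ : D.tySub ρ h X' = X₁) {x : T.Tm A₁} (z : D.Tm X₁ x) {B₁ : T.Ty (G.obj (Y.obj Δ))}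
    (hB : (B.sub (G.map m) hA).app (G.map (Y.map ρ)) h x = B₁)
    (h₂ : T.tySub (G.map (Y.map ρ')) A'' = A₁) (hX₂ : D.tySub ρ' h₂ X'' = X₁)
    (hB₂ : (B.sub (G.map m') hA').app (G.map (Y.map ρ')) h₂ x = B₁) :
    (E.restr hY m hA hX).app ρ h hX₁ z hB = (E.restr hY m' hA' hX').app ρ' h₂ hX₂ z hB₂ := by
  have h₃ := base_trans (Y.map ρ) m hA h
  have hX₃ := RanTy.eval_trans hX rfl hX₁ h₃
  have hB₃ := (B.app_congr (G.map_comp (Y.map ρ) m) h₃ _ rfl).trans hB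
  rw [E.restr_app hY rfl h hX₁ z hB h₃ hX₃ hB₃, E.restr_app hY hm.symm h₂ hX₂ z hB₂ h₃ hX₃ hB₃]

/-- The restriction of a dependent function over the extension along a point. -/
def TmFam.restr {E : D.ran.TyFam X B} {t : T.TmFam B} (s : D.ran.TmFam E t) {Θ : C}
    (m : Y.obj Θ ⟶ U) {A' : T.Ty (G.obj (Y.obj Θ))} {X' : D.Ty Θ A'}
    (hA : T.tySub (G.map m) A = A') (hX : X.eval m hA = X') {t' : T.TmFam (B.sub (G.map m) hA)}
    (ht : t.sub (G.map m) hA = t') : D.TmFam (E.restr hY m hA hX) t' where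
  app ρ _ _ h hX' _ z _ hB _ ht' :=
    s.pt hY (Y.map ρ ≫ m) (base_trans (Y.map ρ) m hA h)
      (RanTy.eval_trans hX rfl hX' _) z
      ((B.app_congr (G.map_comp _ _) _ _ rfl).trans hB) rfl
      (by subst ht; exact (t.app_congr (G.map_comp _ _) _ _ rfl _ _).trans ht')
  nat σ ρ _ _ _ _ _ _ h hX h' hX' hx z _ _ hB hB' hB'' _ _ ht ht' ht'' :=
    s.tmSub_pt hY σ _ (by rw [Y.map_comp, Category.assoc]) _ _ h' hX' hx rfl _ _ _ hB' _ _ _ _ _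
      ht' _

theorem TmFam.appTo_restr {E : D.ran.TyFam X B} {t : T.TmFam B} (s : D.ran.TmFam E t) {Θ : C}
    (m : Y.obj Θ ⟶ U) {A' : T.Ty (G.obj (Y.obj Θ))} {X' : D.Ty Θ A'}
    (hA : T.tySub (G.map m) A = A') (hX : X.eval m hA = X') {t' : T.TmFam (B.sub (G.map m) hA)}
    (ht : t.sub (G.map m) hA = t') {Δ : C} (ρ : Δ ⟶ Θ) {m' : Y.obj Δ ⟶ U}
    (hm : Y.map ρ ≫ m = m') {A₁ : T.Ty (G.obj (Y.obj Δ))}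
    {X₁ : D.Ty Δ A₁} (h : T.tySub (G.map (Y.map ρ)) A' = A₁) (hX' : D.tySub ρ h X' = X₁)
    {x : T.Tm A₁} (z : D.Tm X₁ x) {B₁ : T.Ty (G.obj (Y.obj Δ))}
    (hB : (B.sub (G.map m) hA).app (G.map (Y.map ρ)) h x = B₁) {Z : D.Ty Δ B₁}
    (hZ : (E.restr hY m hA hX).app ρ h hX' z hB = Z) {t₁ : T.Tm B₁}
    (ht₁ : t'.app (G.map (Y.map ρ)) h x hB = t₁)
    (h₂ : T.tySub (G.map m') A = A₁) (hX₂ : X.eval m' h₂ = X₁)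
    (hB₂ : B.app (G.map m') h₂ x = B₁) (hZ₂ : E.pt hY m' h₂ hX₂ z hB₂ = Z)
    (ht₂ : t.app (G.map m') h₂ x hB₂ = t₁) :
    (s.restr hY m hA hX ht).appTo ρ h hX' z hB hZ ht₁ = s.pt hY m' h₂ hX₂ z hB₂ hZ₂ ht₂ := by
  subst hm hZ; rfl

theorem TyFam.pt_sub (E : D.ran.TyFam X B) {V : P} (n : V ⟶ U) {A₁ : T.Ty (G.obj V)}
    {X₁ : D.RanTy V A₁} (hA : T.tySub (G.map n) A = A₁) (hX : X.sub n hA = X₁)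
    {Δ : C} (m : Y.obj Δ ⟶ V) {m' : Y.obj Δ ⟶ U} (hm : m ≫ n = m')
    {A' : T.Ty (G.obj (Y.obj Δ))} {X' : D.Ty Δ A'} (h : T.tySub (G.map m) A₁ = A')
    (hX' : X₁.eval m h = X') {x : T.Tm A'} (z : D.Tm X' x) {B' : T.Ty (G.obj (Y.obj Δ))}
    (hB : (B.sub (G.map n) hA).app (G.map m) h x = B') (h₂ : T.tySub (G.map m') A = A')
    (hX₂ : X.eval m' h₂ = X') (hB₂ : B.app (G.map m') h₂ x = B') :
    (E.sub n hA hX).pt hY m h hX' z hB = E.pt hY m' h₂ hX₂ z hB₂ := by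
  subst hm; rfl

theorem TmFam.pt_sub {E : D.ran.TyFam X B} {t : T.TmFam B} (s : D.ran.TmFam E t) {V : P}
    (n : V ⟶ U) {A₁ : T.Ty (G.obj V)} {X₁ : D.RanTy V A₁} (hA : T.tySub (G.map n) A = A₁)
    (hX : X.sub n hA = X₁) {t' : T.TmFam (B.sub (G.map n) hA)} (ht : t.sub (G.map n) hA = t')
    {Δ : C} (m : Y.obj Δ ⟶ V) {m' : Y.obj Δ ⟶ U} (hm : m ≫ n = m')
    {A' : T.Ty (G.obj (Y.obj Δ))} {X' : D.Ty Δ A'} (h : T.tySub (G.map m) A₁ = A')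
    (hX' : X₁.eval m h = X') {x : T.Tm A'} (z : D.Tm X' x) {B' : T.Ty (G.obj (Y.obj Δ))}
    (hB : (B.sub (G.map n) hA).app (G.map m) h x = B') {Z : D.Ty Δ B'}
    (hZ : (E.sub n hA hX).pt hY m h hX' z hB = Z) {t₁ : T.Tm B'}
    (ht₁ : t'.app (G.map m) h x hB = t₁) (h₂ : T.tySub (G.map m') A = A')
    (hX₂ : X.eval m' h₂ = X') (hB₂ : B.app (G.map m') h₂ x = B')
    (hZ₂ : E.pt hY m' h₂ hX₂ z hB₂ = Z) (ht₂ : t.app (G.map m') h₂ x hB₂ = t₁) :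
    (s.sub n hA hX ht).pt hY m h hX' z hB hZ ht₁ = s.pt hY m' h₂ hX₂ z hB₂ hZ₂ ht₂ := by
  subst hm hZ; rfl

end Restriction

/-! ### Families at representable objects -/

section Families

variable {Γ : C} {A : T.Ty (G.obj (Y.obj Γ))} {X : D.Ty Γ A} {X' : D.RanTy (Y.obj Γ) A}
  {B : T.TyFam A}

/-- The defining equation is one between displayed types at `Y Δ`, and such an equation can be
tested at the identity. -/
theorem tyFamRel_iff (hX : RanTy.ofTy hY X = X') {E : D.TyFam X B} {E' : D.ran.TyFam X' B} :
    (ranAction D hY).TyFamRel hX E E' ↔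
      ∀ {Δ : C} (ρ : Δ ⟶ Γ) {A' : T.Ty (G.obj (Y.obj Δ))} {Z : D.Ty Δ A'}
        (h : T.tySub (G.map (Y.map ρ)) A = A') (hZ : D.tySub ρ h X = Z)
        (hZ' : X'.eval (Y.map ρ) h = Z) {x : T.Tm A'} (z : D.Tm Z x)
        {B' : T.Ty (G.obj (Y.obj Δ))} (hB : B.app (G.map (Y.map ρ)) h x = B'),
        E.app ρ h hZ z hB = E'.pt hY (Y.map ρ) h hZ' z hB := by
  constructor
  · intro hE Δ ρ A' Z h hZ hZ' x z B' hB
    have e := hE ρ h hZ (RanTy.sub_eq_ofTy hY hZ') z hB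
    exact (RanTy.eval_id_ofTy hY (E.app ρ h hZ z hB) (base_id _ _)).symm.trans
      (congrArg (fun W : D.RanTy (Y.obj Δ) B' => W.eval (𝟙 _) (base_id _ _)) e)
  · intro hE Δ ρ A' Z h hZ hZ' x z B' hB
    exact (RanTy.eq_ofTy hY
      (hE ρ h hZ (RanTy.eval_eq_of_sub_eq_ofTy hY hZ') z hB).symm).symm

/-- As for types, the equation is tested at the identity of `Y Δ`; the cast in the definition is
absorbed into the index equations of `eval`. -/
theorem tmFamRel_iff (hX : RanTy.ofTy hY X = X') {E : D.TyFam X B} {E' : D.ran.TyFam X' B}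
    (hE : (ranAction D hY).TyFamRel hX E E') {t : T.TmFam B} {s : D.TmFam E t}
    {s' : D.ran.TmFam E' t} :
    (ranAction D hY).TmFamRel hX hE s s' ↔
      ∀ {Δ : C} (ρ : Δ ⟶ Γ) {A' : T.Ty (G.obj (Y.obj Δ))} {Z : D.Ty Δ A'}
        (h : T.tySub (G.map (Y.map ρ)) A = A') (hZ : D.tySub ρ h X = Z)
        (hZ' : X'.eval (Y.map ρ) h = Z) {x : T.Tm A'} (z : D.Tm Z x)
        {B' : T.Ty (G.obj (Y.obj Δ))} (hB : B.app (G.map (Y.map ρ)) h x = B') {W : D.Ty Δ B'}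
        (hW : E.app ρ h hZ z hB = W) (hW' : E'.pt hY (Y.map ρ) h hZ' z hB = W) {t' : T.Tm B'}
        (ht : t.app (G.map (Y.map ρ)) h x hB = t'),
        s.appTo ρ h hZ z hB hW ht = s'.pt hY (Y.map ρ) h hZ' z hB hW' ht := by
  constructor
  · intro hs Δ ρ A' Z h hZ hZ' x z B' hB W hW hW' t' ht
    subst hW
    have e := hs ρ h hZ (RanTy.sub_eq_ofTy hY hZ') z hB ht
    have e' := congrArg (fun W => RanTm.eval W (𝟙 _) (base_id _ _) hW' (base_tmSub_id _ _)) e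
    refine Eq.trans ?_ e'
    refine Eq.symm ((RanTm.eval_castTm (hE ρ h hZ (RanTy.sub_eq_ofTy hY hZ') z hB) rfl
      (RanTm.ofTm hY (s.app ρ h hZ z hB ht)) (𝟙 _) (base_id _ _) hW' (base_tmSub_id _ _)
      (RanTy.eval_id_ofTy hY _ _) (base_tmSub_id _ _)).trans ?_)
    exact RanTm.eval_id_ofTm hY _ _ _ _
  · intro hs Δ ρ A' Z h hZ hZ' x z B' hB t' ht
    have hZ₁ := RanTy.eval_eq_of_sub_eq_ofTy hY (h := h) hZ'
    have hW' := ((tyFamRel_iff hY hX).1 hE ρ h hZ hZ₁ z hB).symm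
    refine RanTm.ext_id hY (h := base_id _ _) (hx := base_tmSub_id _ _) hW' ?_
    refine ((RanTm.eval_castTm (hE ρ h hZ (RanTy.sub_eq_ofTy hY hZ₁) z hB) rfl
      (RanTm.ofTm hY (s.app ρ h hZ z hB ht)) (𝟙 _) (base_id _ _) hW' (base_tmSub_id _ _)
      (RanTy.eval_id_ofTy hY _ _) (base_tmSub_id _ _)).trans ?_)
    exact (RanTm.eval_id_ofTm hY _ _ _ _).trans (hs ρ h hZ hZ₁ z hB rfl hW' ht)

theorem tySub_preimage_eq {Δ : C} {m : Y.obj Δ ⟶ Y.obj Γ} {A' : T.Ty (G.obj (Y.obj Δ))}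
    {Z : D.Ty Δ A'} {h : T.tySub (G.map m) A = A'} (hZ : (RanTy.ofTy hY X).eval m h = Z)
    (h' : T.tySub (G.map (Y.map (hY.preimage m))) A = A') :
    D.tySub (hY.preimage m) h' X = Z :=
  (RanTy.eval_ofTy hY X (hY.map_preimage m) h h').symm.trans hZ

theorem base_preimage {Δ : C} {m : Y.obj Δ ⟶ Y.obj Γ} {A' : T.Ty (G.obj (Y.obj Δ))}
    (h : T.tySub (G.map m) A = A') : T.tySub (G.map (Y.map (hY.preimage m))) A = A' :=
  (T.tySub_congr (congrArg G.map (hY.map_preimage m)) A).trans h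

/-- The values at points of the extension of a family over `C`. -/
def TyFam.toPt (E : D.TyFam X B) : PtTyFam (RanTy.ofTy hY X) B where
  app m _ _ h hX _ z _ hB := E.app (hY.preimage m) (base_preimage hY h)
    (tySub_preimage_eq hY hX _) z
    ((B.app_congr (congrArg G.map (hY.map_preimage m)) _ h rfl).trans hB)
  nat σ m m' hm _ _ _ _ _ _ h hX h' hX' hx _ _ hz h'' hX'' _ _ hB hB' hB'' :=
    E.nat' σ (hY.preimage m) (hY.map_injective (by simp [hm])) _ _ h' hX' hx hz _ _ _ hB' _

theorem TyFam.app_eq_toPt (E : D.TyFam X B) {Δ : C} (ρ : Δ ⟶ Γ)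
    {A' : T.Ty (G.obj (Y.obj Δ))} {Z : D.Ty Δ A'}
    (h : T.tySub (G.map (Y.map ρ)) A = A') (hZ : D.tySub ρ h X = Z)
    (hZ' : (RanTy.ofTy hY X).eval (Y.map ρ) h = Z) {x : T.Tm A'} (z : D.Tm Z x)
    {B' : T.Ty (G.obj (Y.obj Δ))} (hB : B.app (G.map (Y.map ρ)) h x = B') :
    E.app ρ h hZ z hB = (E.toPt hY).app (Y.map ρ) h hZ' z hB :=
  E.app_congr (hY.preimage_map ρ).symm rfl _ _ _ _ rfl rfl _ _

/-- The family over `C` underlying a family over the extension at an object `Y Γ`. -/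
def TyFam.ofRan (E : D.ran.TyFam (RanTy.ofTy hY X) B) : D.TyFam X B where
  app ρ _ _ h hX _ z _ hB :=
    E.pt hY (Y.map ρ) h ((RanTy.eval_ofTy hY X rfl h h).trans hX) z hB
  nat σ ρ _ _ _ _ _ _ _ _ h' hX' hx _ _ _ _ hB' _ :=
    E.tySub_pt hY σ _ (Y.map_comp σ ρ).symm _ _ h' hX' hx rfl _ _ _ hB' _

/-- The dependent function over `C` underlying a dependent function over the extension. -/
def TmFam.ofRan {E : D.TyFam X B} {E' : D.ran.TyFam (RanTy.ofTy hY X) B} {t : T.TmFam B}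
    (hE : (ranAction D hY).TyFamRel rfl E E') (s : D.ran.TmFam E' t) : D.TmFam E t where
  app ρ _ _ h hX _ z _ hB _ ht :=
    s.pt hY (Y.map ρ) h ((RanTy.eval_ofTy hY X rfl h h).trans hX) z hB
      ((tyFamRel_iff hY rfl).1 hE ρ h hX _ z hB).symm ht
  nat σ ρ _ _ _ _ _ _ _ _ h' hX' hx _ _ _ _ hB' _ _ _ _ ht' _ :=
    s.tmSub_pt hY σ _ (Y.map_comp σ ρ).symm _ _ h' hX' hx rfl _ _ _ hB' _ _ _ _ _ ht' _

/-- The values at points of the extension of a dependent function over `C`. -/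
def TmFam.toPt {E : D.TyFam X B} {E' : D.ran.TyFam (RanTy.ofTy hY X) B} {t : T.TmFam B}
    (hE : (ranAction D hY).TyFamRel rfl E E') (s : D.TmFam E t) : PtTmFam hY E' t where
  app m _ _ h hX _ z _ hB _ hZ _ ht := s.appTo (hY.preimage m) (base_preimage hY h)
    (tySub_preimage_eq hY hX _) z
    ((B.app_congr (congrArg G.map (hY.map_preimage m)) _ h rfl).trans hB)
    (((tyFamRel_iff hY rfl).1 hE _ _ _
      ((RanTy.eval_congr _ (hY.map_preimage m) _ h).trans hX) _ _).trans
      ((E'.pt_congr hY (hY.map_preimage m) rfl _ _ h hX rfl rfl _ hB).trans hZ))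
    ((t.app_congr (congrArg G.map (hY.map_preimage m)) _ h rfl _ hB).trans ht)
  nat σ m m' hm _ _ _ _ _ _ h hX h' hX' hx _ _ hz h'' hX'' _ _ hB hB' hB'' _ _ hZ hZ' hZ'' _ _
      ht ht' ht'' :=
    s.tmSub_appTo σ (hY.preimage m) (hY.map_injective (by simp [hm])) _ _ h' hX' hx hz _ _ _ hB'
      _ _ hZ' _ _ ht' _

/-- Since `Y` is full, the points of `Y Γ` are the images of the morphisms into `Γ`. Values at
points are thus exactly the data of a family over `C`, and the relation asserts that the two sets of
values agree. -/
theorem ranAction_isBijectiveOnFamilies : (ranAction D hY).IsBijectiveOnFamilies where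
  tyFam {Γ A} X B := by
    constructor
    · intro E
      refine ⟨(E.toPt hY).toTyFam, (tyFamRel_iff hY rfl).2 ?_, ?_⟩
      · intro Δ ρ A' Z h hZ hZ' x z B' hB
        exact (E.app_eq_toPt hY ρ h hZ hZ' z hB).trans
          ((E.toPt hY).pt_toTyFam hY (Y.map ρ) h hZ' z hB).symm
      · intro E' hE'
        refine TyFam.ext_pt hY fun m _ _ h hX _ z _ hB => ?_
        refine Eq.trans ?_ ((E.toPt hY).pt_toTyFam hY m h hX z hB).symm
        -- The relation constrains `E'` only at points in the image of `Y`; fullness makes these all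
        -- the points.
        obtain ⟨ρ, rfl⟩ : ∃ ρ, Y.map ρ = m := ⟨_, hY.map_preimage m⟩
        exact ((tyFamRel_iff hY rfl).1 hE' ρ h
          ((RanTy.eval_ofTy hY X rfl h h).symm.trans hX) hX z hB).symm.trans
          (E.app_eq_toPt hY ρ h _ hX z hB)
    · intro E'
      refine ⟨TyFam.ofRan hY E', (tyFamRel_iff hY rfl).2 fun ρ _ _ h hZ hZ' _ z _ hB => rfl, ?_⟩
      intro E hE
      exact TyFam.ext_app fun ρ _ _ h hX _ z _ hB =>
        (tyFamRel_iff hY rfl).1 hE ρ h hX ((RanTy.eval_ofTy hY X rfl h h).trans hX) z hB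
  tmFam {Γ A} X B E E' hE t := by
    constructor
    · intro s
      have key : ∀ {Δ : C} (ρ : Δ ⟶ Γ) {A' : T.Ty (G.obj (Y.obj Δ))} {Z : D.Ty Δ A'}
          (h : T.tySub (G.map (Y.map ρ)) A = A') (hZ : D.tySub ρ h X = Z)
          (hZ' : (RanTy.ofTy hY X).eval (Y.map ρ) h = Z) {x : T.Tm A'} (z : D.Tm Z x)
          {B' : T.Ty (G.obj (Y.obj Δ))} (hB : B.app (G.map (Y.map ρ)) h x = B') {W : D.Ty Δ B'}
          (hW : E.app ρ h hZ z hB = W) (hW' : E'.pt hY (Y.map ρ) h hZ' z hB = W) {t' : T.Tm B'}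
          (ht : t.app (G.map (Y.map ρ)) h x hB = t'),
          s.appTo ρ h hZ z hB hW ht = (TmFam.toPt hY hE s).app (Y.map ρ) h hZ' z hB hW' ht := by
        intro Δ ρ A' Z h hZ hZ' x z B' hB W hW hW' t' ht
        exact s.appTo_congr_hom (hY.preimage_map ρ).symm _ _ _ _ z _ _ _
          ((E.app_congr (hY.preimage_map ρ) rfl _ _ h hZ rfl rfl _ hB).trans hW) _
          ((t.app_congr (congrArg G.map (hY.map_preimage _)) _ h rfl _ hB).trans ht)
      refine ⟨(TmFam.toPt hY hE s).toTmFam, (tmFamRel_iff hY rfl hE).2 ?_, ?_⟩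
      · intro Δ ρ A' Z h hZ hZ' x z B' hB W hW hW' t' ht
        exact (key ρ h hZ hZ' z hB hW hW' ht).trans
          ((TmFam.toPt hY hE s).pt_toTmFam (Y.map ρ) h hZ' z hB hW' ht).symm
      · intro s' hs'
        refine TmFam.ext_pt hY fun m _ _ h hX _ z _ hB _ hZ _ ht => ?_
        refine Eq.trans ?_ ((TmFam.toPt hY hE s).pt_toTmFam m h hX z hB hZ ht).symm
        obtain ⟨ρ, rfl⟩ : ∃ ρ, Y.map ρ = m := ⟨_, hY.map_preimage m⟩
        have hX' := (RanTy.eval_ofTy hY X rfl h h).symm.trans hX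
        have hW := ((tyFamRel_iff hY rfl).1 hE ρ h hX' hX z hB).trans hZ
        exact ((tmFamRel_iff hY rfl hE).1 hs' ρ h hX' hX z hB hW hZ ht).symm.trans
          (key ρ h hX' hX z hB hW hZ ht)
    · intro s'
      refine ⟨TmFam.ofRan hY hE s', (tmFamRel_iff hY rfl hE).2
        fun ρ _ _ h hZ hZ' _ z _ hB _ hW hW' _ ht => ?_, ?_⟩
      · subst hW; rfl
      · intro s hs
        exact TmFam.ext_app fun ρ _ _ h hX _ z _ hB _ ht =>
          have hX' := (RanTy.eval_ofTy hY X rfl h h).trans hX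
          (tmFamRel_iff hY rfl hE).1 hs ρ h hX hX' z hB rfl
            ((tyFamRel_iff hY rfl).1 hE ρ h hX hX' z hB).symm ht

end Families

end DispTyTm

/-! ### The operations of the extension -/

namespace DispModel

open DispTyTm

section

variable {C : Type u₁} [Category.{v₁} C] {S : Type u₂} [Category.{v₂} S]
  {M : Model.{u₂, v₂, a, b} S} {F : C ⥤ S} (D : DispModel.{u₁, v₁, u₂, v₂, a, b, c, d} M F)

/-- Restricted families at different points lie over types that are only propositionally equal, so
they cannot be equated directly. The naturality of `Π` is therefore put in a form that compares
families value by value. -/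
theorem tySub_pi {Δ Γ : C} (σ : Δ ⟶ Γ) {A : M.Ty (F.obj Γ)} {A' : M.Ty (F.obj Δ)}
    {B : M.TyFam A} {B' : M.TyFam A'} {X : D.Ty Γ A} {X' : D.Ty Δ A'} {E : D.TyFam X B}
    {E' : D.TyFam X' B'} (hA : M.tySub (F.map σ) A = A') (hB : B.sub (F.map σ) hA = B')
    (hX : D.tySub σ hA X = X')
    (hE : ∀ {Θ : C} (ρ : Θ ⟶ Δ) {A₁ : M.Ty (F.obj Θ)} {X₁ : D.Ty Θ A₁}
      (h₁ : M.tySub (F.map ρ) A' = A₁) (hX₁ : D.tySub ρ h₁ X' = X₁) {x : M.Tm A₁}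
      (z : D.Tm X₁ x) {B₁ : M.Ty (F.obj Θ)} (hB₁ : B'.app (F.map ρ) h₁ x = B₁)
      (h₂ : M.tySub (F.map (ρ ≫ σ)) A = A₁) (hX₂ : D.tySub (ρ ≫ σ) h₂ X = X₁)
      (hB₂ : B.app (F.map (ρ ≫ σ)) h₂ x = B₁),
      E.app (ρ ≫ σ) h₂ hX₂ z hB₂ = E'.app ρ h₁ hX₁ z hB₁)
    (h : M.tySub (F.map σ) (M.pi A B) = M.pi A' B') :
    D.tySub σ h (D.pi X E) = D.pi X' E' := by
  subst hA hB hX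
  obtain rfl : E.sub σ rfl rfl = E' :=
    TyFam.ext_app fun ρ _ _ h₁ hX₁ _ z _ hB₁ => hE ρ h₁ hX₁ z hB₁ _ _ _
  exact D.pi_sub σ X E

/-- Application is injective and natural, so terms of a `Π`-type can be compared by applying them.
Both directions serve: one gives naturality of application, the other that of abstraction. -/
theorem tmSub_eq_iff_app {Δ Γ : C} (σ : Δ ⟶ Γ) {A : M.Ty (F.obj Γ)} {A' : M.Ty (F.obj Δ)}
    {B : M.TyFam A} {B' : M.TyFam A'} {X : D.Ty Γ A} {X' : D.Ty Δ A'} {E : D.TyFam X B}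
    {E' : D.TyFam X' B'} (hA : M.tySub (F.map σ) A = A') (hB : B.sub (F.map σ) hA = B')
    (hX : D.tySub σ hA X = X')
    (hE : ∀ {Θ : C} (ρ : Θ ⟶ Δ) {A₁ : M.Ty (F.obj Θ)} {X₁ : D.Ty Θ A₁}
      (h₁ : M.tySub (F.map ρ) A' = A₁) (hX₁ : D.tySub ρ h₁ X' = X₁) {x : M.Tm A₁}
      (z : D.Tm X₁ x) {B₁ : M.Ty (F.obj Θ)} (hB₁ : B'.app (F.map ρ) h₁ x = B₁)
      (h₂ : M.tySub (F.map (ρ ≫ σ)) A = A₁) (hX₂ : D.tySub (ρ ≫ σ) h₂ X = X₁)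
      (hB₂ : B.app (F.map (ρ ≫ σ)) h₂ x = B₁),
      E.app (ρ ≫ σ) h₂ hX₂ z hB₂ = E'.app ρ h₁ hX₁ z hB₁)
    (h : M.tySub (F.map σ) (M.pi A B) = M.pi A' B')
    (hP : D.tySub σ h (D.pi X E) = D.pi X' E') {g : M.Tm (M.pi A B)} {g' : M.Tm (M.pi A' B')}
    (hg : M.tmSub (F.map σ) h g = g') {k : D.Tm (D.pi X E) g} {k' : D.Tm (D.pi X' E') g'} :
    D.tmSub σ h hP hg k = k' ↔
      ∀ {Θ : C} (ρ : Θ ⟶ Δ) {ρ' : Θ ⟶ Γ} (_ : ρ ≫ σ = ρ') {A₁ : M.Ty (F.obj Θ)} {X₁ : D.Ty Θ A₁}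
      (h₁ : M.tySub (F.map ρ) A' = A₁) (hX₁ : D.tySub ρ h₁ X' = X₁) {x : M.Tm A₁}
      (z : D.Tm X₁ x) {B₁ : M.Ty (F.obj Θ)} (hB₁ : B'.app (F.map ρ) h₁ x = B₁)
      (h₂ : M.tySub (F.map ρ') A = A₁) (hX₂ : D.tySub ρ' h₂ X = X₁)
      (hB₂ : B.app (F.map ρ') h₂ x = B₁) {Z : D.Ty Θ B₁}
      (hZ₁ : E'.app ρ h₁ hX₁ z hB₁ = Z) (hZ₂ : E.app ρ' h₂ hX₂ z hB₂ = Z) {t : M.Tm B₁}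
      (ht₁ : (M.app g').app (F.map ρ) h₁ x hB₁ = t)
      (ht₂ : (M.app g).app (F.map ρ') h₂ x hB₂ = t),
      (D.app k).appTo ρ' h₂ hX₂ z hB₂ hZ₂ ht₂ = (D.app k').appTo ρ h₁ hX₁ z hB₁ hZ₁ ht₁ := by
  subst hA hB hX
  obtain rfl : E.sub σ rfl rfl = E' :=
    TyFam.ext_app fun ρ _ _ h₁ hX₁ _ z _ hB₁ => hE ρ h₁ hX₁ z hB₁ _ _ _
  subst hg
  rw [← D.app.apply_eq_iff_eq, D.app_sub]
  constructor
  · rintro hk Θ ρ _ rfl A₁ X₁ h₁ hX₁ x z B₁ hB₁ h₂ hX₂ hB₂ Z hZ₁ hZ₂ t ht₁ ht₂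
    rw [← hk]
    rfl
  · intro hk
    refine TmFam.ext_app fun ρ _ _ h₁ hX₁ _ z _ hB₁ _ ht₁ => ?_
    exact hk ρ rfl h₁ hX₁ z hB₁ _ _ _ rfl rfl ht₁ _

theorem tmSub_elim {Δ Γ : C} (σ : Δ ⟶ Γ) {P : M.TyFam (M.bool (F.obj Γ))}
    {P' : M.TyFam (M.bool (F.obj Δ))} (hP : P.sub (F.map σ) (M.bool_sub _) = P')
    {Q : D.TyFam (D.bool Γ) P} {Q' : D.TyFam (D.bool Δ) P'}
    (hQ : ∀ {Θ : C} (ρ : Θ ⟶ Δ) {A₁ : M.Ty (F.obj Θ)} {X₁ : D.Ty Θ A₁}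
      (h₁ : M.tySub (F.map ρ) (M.bool _) = A₁) (hX₁ : D.tySub ρ h₁ (D.bool Δ) = X₁) {x : M.Tm A₁}
      (z : D.Tm X₁ x) {B₁ : M.Ty (F.obj Θ)} (hB₁ : P'.app (F.map ρ) h₁ x = B₁)
      (h₂ : M.tySub (F.map (ρ ≫ σ)) (M.bool _) = A₁) (hX₂ : D.tySub (ρ ≫ σ) h₂ (D.bool Γ) = X₁)
      (hB₂ : P.app (F.map (ρ ≫ σ)) h₂ x = B₁),
      Q.app (ρ ≫ σ) h₂ hX₂ z hB₂ = Q'.app ρ h₁ hX₁ z hB₁)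
    {t : M.Tm (P.inst (M.tt (F.obj Γ)))} {s : M.Tm (P.inst (M.ff (F.obj Γ)))}
    {t₁ : M.Tm (P'.inst (M.tt (F.obj Δ)))} {s₁ : M.Tm (P'.inst (M.ff (F.obj Δ)))}
    {t' : D.Tm (Q.inst (D.tt Γ)) t} {s' : D.Tm (Q.inst (D.ff Γ)) s}
    {t₁' : D.Tm (Q'.inst (D.tt Δ)) t₁} {s₁' : D.Tm (Q'.inst (D.ff Δ)) s₁}
    {x : M.Tm (M.bool (F.obj Γ))} {y : D.Tm (D.bool Γ) x}
    {x₁ : M.Tm (M.bool (F.obj Δ))} {y₁ : D.Tm (D.bool Δ) x₁}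
    {h₁ : M.tySub (F.map σ) (P.inst (M.tt _)) = P'.inst (M.tt _)}
    {hX₁ : D.tySub σ h₁ (Q.inst (D.tt Γ)) = Q'.inst (D.tt Δ)}
    {hx₁ : M.tmSub (F.map σ) h₁ t = t₁} (ht : D.tmSub σ h₁ hX₁ hx₁ t' = t₁')
    {h₂ : M.tySub (F.map σ) (P.inst (M.ff _)) = P'.inst (M.ff _)}
    {hX₂ : D.tySub σ h₂ (Q.inst (D.ff Γ)) = Q'.inst (D.ff Δ)}
    {hx₂ : M.tmSub (F.map σ) h₂ s = s₁} (hs : D.tmSub σ h₂ hX₂ hx₂ s' = s₁')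
    {hx₃ : M.tmSub (F.map σ) (M.bool_sub _) x = x₁}
    (hy : D.tmSub σ (M.bool_sub _) (D.bool_sub σ) hx₃ y = y₁)
    (h : M.tySub (F.map σ) (P.inst x) = P'.inst x₁)
    (hX : D.tySub σ h (Q.inst y) = Q'.inst y₁)
    (hx : M.tmSub (F.map σ) h (M.elim P t s x) = M.elim P' t₁ s₁ x₁) :
    D.tmSub σ h hX hx (D.elim Q t' s' y) = D.elim Q' t₁' s₁' y₁ := by
  subst hP
  obtain rfl : Q.sub σ (M.bool_sub _) (D.bool_sub σ) = Q' :=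
    TyFam.ext_app fun ρ _ _ h₁ hX₁ _ z _ hB₁ => hQ ρ h₁ hX₁ z hB₁ _ _ _
  subst hx₃ hy hx₁ ht hx₂ hs
  exact D.elim_sub σ Q t' s' y

end

end DispModel

namespace DispModel

open DispTyTm

variable {C : Type u₁} [Category.{v₁} C] {P : Type u} [Category.{v} P]
  {S : Type u₂} [Category.{v₂} S] {M : Model.{u₂, v₂, a, b} S} {Y : C ⥤ P} {G : P ⥤ S}
  (D : DispModel.{u₁, v₁, u₂, v₂, a, b, c, d} M (Y ⋙ G)) (hY : Y.FullyFaithful)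

/-! ### Dependent products of the extension -/

section Pi

variable {D}
variable {U : P} {A : M.Ty (G.obj U)} {B : M.TyFam A} {X : D.RanTy U A}

theorem base_pi {V W : S} (σ : V ⟶ W) {A : M.Ty W} {B : M.TyFam A} {A' : M.Ty V}
    {B' : M.TyFam A'} (hA : M.tySub σ A = A') (hB : B.sub σ hA = B') :
    M.tySub σ (M.pi A B) = M.pi A' B' := by
  subst hA hB; exact M.pi_sub σ A B

theorem base_sub_sub {Ξ Θ : C} (σ : Ξ ⟶ Θ) (m : Y.obj Θ ⟶ U) {m' : Y.obj Ξ ⟶ U}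
    (hm : Y.map σ ≫ m = m') {A' : M.Ty (G.obj (Y.obj Θ))} {A'' : M.Ty (G.obj (Y.obj Ξ))}
    (h : M.tySub (G.map m) A = A') (h' : M.tySub (G.map (Y.map σ)) A' = A'')
    (h'' : M.tySub (G.map m') A = A'') :
    (B.sub (G.map m) h).sub (G.map (Y.map σ)) h' = B.sub (G.map m') h'' :=
  TyTm.TyFam.ext_app fun ρ _ _ _ => B.app_congr (by rw [← hm]; simp) _ _ rfl

/-- The `Π`-type of the extension. -/
def ranPi (X : D.RanTy U A) (E : D.ran.TyFam X B) : D.RanTy U (M.pi A B) :=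
  RanTy.ofChosen (fun m => M.pi_sub (G.map m) A B)
    (fun m => D.pi (X.eval m rfl) (E.restr hY m rfl rfl)) fun σ m h => by
      have h₁ := base_trans_eq (T := M.toTyTm) (G := G) (m := Y.map σ) (ρ := m) (A := A) rfl rfl rfl
      refine D.tySub_pi σ h₁.symm (base_sub_sub σ m rfl _ _ _) (X.tySub_eval σ m rfl _ _ _) ?_ h
      intro Θ ρ A₁ X₁ _ _ x z B₁ _ _ _ _
      -- Restricting at `m` and then along `σ` agrees with restricting at `Y.map σ ≫ m`, because the
      -- composite points agree.
      exact E.restr_app_congr hY (by simp) _ _ z _ _ _ _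

/-- The family `E'` may be any one with the values of `E` below `m`. This freedom is used for
restrictions, where `E'` comes from a restricted family, and for preservation, where it is a family
over `C`. -/
theorem eval_ranPi (E : D.ran.TyFam X B) {Θ : C} (m : Y.obj Θ ⟶ U)
    {A' : M.Ty (G.obj (Y.obj Θ))} {B' : M.TyFam A'} {X' : D.Ty Θ A'} {E' : D.TyFam X' B'}
    (hA : M.tySub (G.map m) A = A') (hB : B.sub (G.map m) hA = B') (hX : X.eval m hA = X')
    (hE : ∀ {Δ : C} (ρ : Δ ⟶ Θ) {A₁ : M.Ty (G.obj (Y.obj Δ))} {X₁ : D.Ty Δ A₁}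
      (h₁ : M.tySub (G.map (Y.map ρ)) A' = A₁) (hX₁ : D.tySub ρ h₁ X' = X₁) {x : M.Tm A₁}
      (z : D.Tm X₁ x) {B₁ : M.Ty (G.obj (Y.obj Δ))} (hB₁ : B'.app (G.map (Y.map ρ)) h₁ x = B₁)
      (h₂ : M.tySub (G.map (Y.map ρ ≫ m)) A = A₁) (hX₂ : X.eval (Y.map ρ ≫ m) h₂ = X₁)
      (hB₂ : B.app (G.map (Y.map ρ ≫ m)) h₂ x = B₁),
      E.pt hY (Y.map ρ ≫ m) h₂ hX₂ z hB₂ = E'.app ρ h₁ hX₁ z hB₁)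
    (h : M.tySub (G.map m) (M.pi A B) = M.pi A' B') :
    (ranPi hY X E).eval m h = D.pi X' E' := by
  subst hA hB hX
  obtain rfl : E.restr hY m rfl rfl = E' :=
    TyFam.ext_app fun ρ _ _ h₁ hX₁ _ z _ hB₁ =>
      hE ρ h₁ hX₁ z hB₁ _ (RanTy.eval_trans rfl rfl hX₁ _) _
  exact RanTy.eval_ofChosen (fun m => M.pi_sub (G.map m) A B) _ _ m h

theorem eval_ranPi_restr (E : D.ran.TyFam X B) {Θ : C} (m : Y.obj Θ ⟶ U)
    {A' : M.Ty (G.obj (Y.obj Θ))} {X' : D.Ty Θ A'} (hA : M.tySub (G.map m) A = A')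
    (hX : X.eval m hA = X') :
    (ranPi hY X E).eval m (base_pi _ hA rfl) = D.pi X' (E.restr hY m hA hX) :=
  eval_ranPi hY E m (E' := E.restr hY m hA hX) hA rfl hX
    (fun _ _ _ _ _ _ _ _ _ _ _ _ => rfl) _

/-- At a point `m` of `V` both sides are a product over the value of `X` at `m ≫ n`, and the
families have the same values by `TyFam.pt_sub`. -/
theorem ranPi_sub {V : P} (n : V ⟶ U) (E : D.ran.TyFam X B) {A' : M.Ty (G.obj V)}
    {X' : D.RanTy V A'} (hA : M.tySub (G.map n) A = A') (hX : X.sub n hA = X') :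
    (ranPi hY X E).sub n (base_pi _ hA rfl) = ranPi hY X' (TyFam.sub (D := D.ran) E n hA hX) := by
  refine RanTy.ext_chosen (fun m => base_pi (G.map m) rfl rfl) fun m => ?_
  rw [eval_ranPi_restr hY _ m rfl rfl,
    RanTy.eval_sub _ n _ m rfl _ (base_trans m n (base_pi _ hA rfl) (base_pi _ rfl rfl))]
  refine eval_ranPi hY E (m ≫ n) (B' := (B.sub (G.map n) hA).sub (G.map m) rfl)
    (base_trans m n hA rfl)
    (TyTm.TyFam.ext_app fun ρ _ _ _ => B.app_congr (by simp) _ _ rfl)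
    (RanTy.eval_of_sub_eq hX m rfl rfl _).symm ?_ _
  intro Δ ρ A₁ X₁ h₁ hX₁ x z B₁ hB₁ h₂ hX₂ hB₂
  exact (TyFam.pt_sub hY E n hA hX (Y.map ρ ≫ m) (Category.assoc _ _ _) _
    (RanTy.eval_trans rfl rfl hX₁ _) z _ h₂ hX₂ hB₂).symm

end Pi

/-! ### Application and abstraction of the extension -/

section App

variable {D}
variable {U : P} {A : M.Ty (G.obj U)} {B : M.TyFam A} {X : D.RanTy U A} {E : D.ran.TyFam X B}
  {g : M.Tm (M.pi A B)}

theorem base_appTm {Θ : C} (m : Y.obj Θ ⟶ U) {A' : M.Ty (G.obj (Y.obj Θ))}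
    (hA : M.tySub (G.map m) A = A') (h : M.tySub (G.map m) (M.pi A B) = M.pi A' (B.sub _ hA))
    (g : M.Tm (M.pi A B)) : (M.app g).sub (G.map m) hA = M.app (M.tmSub (G.map m) h g) := by
  subst hA; exact (M.app_sub _ g).symm

/-- Naturality of application in the base model, read at a single argument. -/
theorem base_app_tmSub {Θ : C} {m : Y.obj Θ ⟶ U} {A' : M.Ty (G.obj (Y.obj Θ))}
    {hA : M.tySub (G.map m) A = A'} {h : M.tySub (G.map m) (M.pi A B) = M.pi A' (B.sub _ hA)}
    {Δ : C} {ρ : Δ ⟶ Θ} {m' : Y.obj Δ ⟶ U} (hm : Y.map ρ ≫ m = m')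
    {A₁ : M.Ty (G.obj (Y.obj Δ))} {h₁ : M.tySub (G.map (Y.map ρ)) A' = A₁} {x : M.Tm A₁}
    {B₁ : M.Ty (G.obj (Y.obj Δ))}
    (hB₁ : (B.sub (G.map m) hA).app (G.map (Y.map ρ)) h₁ x = B₁)
    {h₂ : M.tySub (G.map m') A = A₁} (hB₂ : B.app (G.map m') h₂ x = B₁) :
    (M.app (M.tmSub (G.map m) h g)).app (G.map (Y.map ρ)) h₁ x hB₁ =
      (M.app g).app (G.map m') h₂ x hB₂ := by
  rw [← base_appTm m hA h g]
  exact (M.app g).app_congr (by rw [← hm, G.map_comp]) _ _ rfl _ _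

/-- The value at a point of a term of a `Π`-type of the extension. -/
def ranAppVal (k : D.RanTm (ranPi hY X E) g) {Θ : C} (m : Y.obj Θ ⟶ U)
    {A' : M.Ty (G.obj (Y.obj Θ))} {X' : D.Ty Θ A'} (hA : M.tySub (G.map m) A = A')
    (hX : X.eval m hA = X') :
    D.TmFam (E.restr hY m hA hX) (M.app (M.tmSub (G.map m) (base_pi _ hA rfl) g)) :=
  D.app (k.eval m (base_pi _ hA rfl) (eval_ranPi_restr hY E m hA hX) rfl)

/-- Naturality of `k` relates its values at `m` and at `m'` by restriction along `σ`;
`tmSub_eq_iff_app` turns this into an equation between applications. -/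
theorem ranAppVal_comp (k : D.RanTm (ranPi hY X E) g) {Ξ Θ : C} (σ : Ξ ⟶ Θ)
    (m : Y.obj Θ ⟶ U) {m' : Y.obj Ξ ⟶ U} (hm : Y.map σ ≫ m = m')
    {A' : M.Ty (G.obj (Y.obj Θ))} {A'' : M.Ty (G.obj (Y.obj Ξ))} {X' : D.Ty Θ A'}
    {X'' : D.Ty Ξ A''} (hA : M.tySub (G.map m) A = A') (hX : X.eval m hA = X')
    (hA' : M.tySub (G.map m') A = A'') (hX' : X.eval m' hA' = X'')
    (h : M.tySub (G.map (Y.map σ)) A' = A'') (hXX : D.tySub σ h X' = X'')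
    {Δ : C} (ρ : Δ ⟶ Ξ) {ρ' : Δ ⟶ Θ} (hρ : ρ ≫ σ = ρ') {A₁ : M.Ty (G.obj (Y.obj Δ))}
    {X₁ : D.Ty Δ A₁}
    (h₁ : M.tySub (G.map (Y.map ρ)) A'' = A₁) (hX₁ : D.tySub ρ h₁ X'' = X₁) {x : M.Tm A₁}
    (z : D.Tm X₁ x) {B₁ : M.Ty (G.obj (Y.obj Δ))}
    (hB₁ : (B.sub (G.map m') hA').app (G.map (Y.map ρ)) h₁ x = B₁)
    (h₂ : M.tySub (G.map (Y.map ρ')) A' = A₁) (hX₂ : D.tySub ρ' h₂ X' = X₁)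
    (hB₂ : (B.sub (G.map m) hA).app (G.map (Y.map ρ')) h₂ x = B₁) {Z : D.Ty Δ B₁}
    (hZ₁ : (E.restr hY m' hA' hX').app ρ h₁ hX₁ z hB₁ = Z)
    (hZ₂ : (E.restr hY m hA hX).app ρ' h₂ hX₂ z hB₂ = Z) {t : M.Tm B₁}
    (ht₁ : (M.app (M.tmSub (G.map m') (base_pi _ hA' rfl) g)).app (G.map (Y.map ρ)) h₁ x hB₁ = t)
    (ht₂ : (M.app (M.tmSub (G.map m) (base_pi _ hA rfl) g)).app (G.map (Y.map ρ')) h₂ x hB₂ = t) :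
    (ranAppVal hY k m hA hX).appTo ρ' h₂ hX₂ z hB₂ hZ₂ ht₂ =
      (ranAppVal hY k m' hA' hX').appTo ρ h₁ hX₁ z hB₁ hZ₁ ht₁ := by
  have hB := base_sub_sub (B := B) σ m hm hA h hA'
  have hE : ∀ {Θ₁ : C} (τ : Θ₁ ⟶ Ξ) {A₁ : M.Ty (G.obj (Y.obj Θ₁))} {X₁ : D.Ty Θ₁ A₁}
      (h₁ : M.tySub (G.map (Y.map τ)) A'' = A₁) (hX₁ : D.tySub τ h₁ X'' = X₁) {x : M.Tm A₁}
      (z : D.Tm X₁ x) {B₁ : M.Ty (G.obj (Y.obj Θ₁))}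
      (hB₁ : (B.sub (G.map m') hA').app (G.map (Y.map τ)) h₁ x = B₁)
      (h₂ : M.tySub (G.map (Y.map (τ ≫ σ))) A' = A₁) (hX₂ : D.tySub (τ ≫ σ) h₂ X' = X₁)
      (hB₂ : (B.sub (G.map m) hA).app (G.map (Y.map (τ ≫ σ))) h₂ x = B₁),
      (E.restr hY m hA hX).app (τ ≫ σ) h₂ hX₂ z hB₂ =
        (E.restr hY m' hA' hX').app τ h₁ hX₁ z hB₁ := by
    intro Θ₁ τ A₁ X₁ _ _ x z B₁ _ _ _ _
    exact E.restr_app_congr hY (by rw [← hm]; simp) _ _ z _ _ _ _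
  have hp := base_pi (G.map (Y.map σ)) h hB
  have hP := D.tySub_pi σ h hB hXX hE hp
  have hg := (TyTm.tmSub_trans (T := M.toTyTm) (by rw [← hm, G.map_comp])
    (base_pi (G.map m') hA' rfl) (rfl : M.tmSub (G.map m) (base_pi _ hA rfl) g = _)
    (rfl : M.tmSub (G.map (Y.map σ)) hp _ = _)).symm
  exact (D.tmSub_eq_iff_app σ h hB hXX hE hp hP hg).1
    (k.tmSub_eval σ m hm _ _ _ hp hP hg _ _ _) ρ hρ h₁ hX₁ z hB₁ h₂ hX₂ hB₂ hZ₁ hZ₂ ht₁ ht₂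

theorem restr_app_id {Θ : C} {m : Y.obj Θ ⟶ U} {A' : M.Ty (G.obj (Y.obj Θ))} {X' : D.Ty Θ A'}
    {hA : M.tySub (G.map m) A = A'} {hX : X.eval m hA = X'} {x : M.Tm A'} {z : D.Tm X' x}
    {B' : M.Ty (G.obj (Y.obj Θ))} {hB : B.app (G.map m) hA x = B'} {Z : D.Ty Θ B'}
    (hZ : E.pt hY m hA hX z hB = Z)
    (hB₁ : (B.sub (G.map m) hA).app (G.map (Y.map (𝟙 Θ))) (base_id (F := Y ⋙ G) Θ A') x = B') :
    (E.restr hY m hA hX).app (𝟙 Θ) (base_id (F := Y ⋙ G) Θ A') (D.tySub_id _ X') z hB₁ = Z :=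
  (E.restr_app hY (by simp) _ _ z _ hA hX hB).trans hZ

/-- The values at points of the dependent function given by a term of a `Π`-type. -/
def ranAppPt (k : D.RanTm (ranPi hY X E) g) : PtTmFam hY E (M.app g) where
  app {Θ} m A' X' h hX x z B' hB Z hZ t ht :=
    have hB₁ : (B.sub (G.map m) h).app (G.map (Y.map (𝟙 Θ))) (base_id (F := Y ⋙ G) Θ A') x = B' :=
      (B.app_congr (by simp) _ _ rfl).trans hB
    -- The argument `z` lives at `Θ` itself, so the function at `m` is applied at the identity.
    (ranAppVal hY k m h hX).appTo (𝟙 Θ) (base_id (F := Y ⋙ G) Θ A') (D.tySub_id _ X') z hB₁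
      (restr_app_id hY hZ hB₁) ((base_app_tmSub (by simp) hB₁ hB).trans ht)
  nat {Ξ Θ} σ m m' hm A' A'' X' X'' x x' h hX h' hX' hx z z' hz h'' hX'' B' B'' hB hB' hB'' Z Z'
      hZ hZ' hZ'' t t' ht ht' ht'' := by
    have hB₁ : (B.sub (G.map m) h).app (G.map (Y.map σ)) h' x' = B'' :=
      (B.app_congr (by rw [← hm, G.map_comp]) _ _ rfl).trans hB''
    have hZ₁ : (E.restr hY m h hX).app σ h' hX' z' hB₁ = Z' :=
      (E.restr_app hY hm _ _ z' _ h'' hX'' hB'').trans hZ''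
    have ht₁ := (base_app_tmSub (g := g) (h := base_pi _ h rfl) hm hB₁ hB'').trans ht''
    refine (TmFam.tmSub_appTo _ σ (𝟙 Θ) (Category.comp_id σ) _ _ h' hX' hx hz h' hX' _ hB' hB₁ _
      hZ' hZ₁ _ ht' ht₁).trans ?_
    exact ranAppVal_comp hY k σ m hm h hX h'' hX'' h' hX' (𝟙 Ξ) (Category.id_comp σ) _ _ z' _ _ _ _
      _ _ _ _

/-- The application of the extension. -/
def ranApp (k : D.RanTm (ranPi hY X E) g) : D.ran.TmFam E (M.app g) :=
  (ranAppPt hY k).toTmFam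

/-- The application at the point `Y.map ρ ≫ m` can be computed from the value of `k` at `m` instead,
by `ranAppVal_comp`. As in `eval_ranPi`, any family `E'` with the right values is allowed. -/
theorem pt_ranApp (k : D.RanTm (ranPi hY X E) g) {Θ : C} (m : Y.obj Θ ⟶ U)
    {A' : M.Ty (G.obj (Y.obj Θ))} {B' : M.TyFam A'} {X' : D.Ty Θ A'} {E' : D.TyFam X' B'}
    (hA : M.tySub (G.map m) A = A') (hB : B.sub (G.map m) hA = B') (hX : X.eval m hA = X')
    (hE : ∀ {Δ : C} (ρ : Δ ⟶ Θ) {A₁ : M.Ty (G.obj (Y.obj Δ))} {X₁ : D.Ty Δ A₁}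
      (h₁ : M.tySub (G.map (Y.map ρ)) A' = A₁) (hX₁ : D.tySub ρ h₁ X' = X₁) {x : M.Tm A₁}
      (z : D.Tm X₁ x) {B₁ : M.Ty (G.obj (Y.obj Δ))} (hB₁ : B'.app (G.map (Y.map ρ)) h₁ x = B₁)
      (h₂ : M.tySub (G.map (Y.map ρ ≫ m)) A = A₁) (hX₂ : X.eval (Y.map ρ ≫ m) h₂ = X₁)
      (hB₂ : B.app (G.map (Y.map ρ ≫ m)) h₂ x = B₁),
      E.pt hY (Y.map ρ ≫ m) h₂ hX₂ z hB₂ = E'.app ρ h₁ hX₁ z hB₁)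
    (h : M.tySub (G.map m) (M.pi A B) = M.pi A' B')
    (hP : (ranPi hY X E).eval m h = D.pi X' E') {g' : M.Tm (M.pi A' B')}
    (hg : M.tmSub (G.map m) h g = g')
    {Δ : C} (ρ : Δ ⟶ Θ) {m' : Y.obj Δ ⟶ U} (hm : Y.map ρ ≫ m = m')
    {A₁ : M.Ty (G.obj (Y.obj Δ))} {X₁ : D.Ty Δ A₁}
    (h₁ : M.tySub (G.map (Y.map ρ)) A' = A₁) (hX₁ : D.tySub ρ h₁ X' = X₁) {x : M.Tm A₁}
    (z : D.Tm X₁ x) {B₁ : M.Ty (G.obj (Y.obj Δ))} (hB₁ : B'.app (G.map (Y.map ρ)) h₁ x = B₁)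
    (h₂ : M.tySub (G.map m') A = A₁) (hX₂ : X.eval m' h₂ = X₁)
    (hB₂ : B.app (G.map m') h₂ x = B₁) {Z : D.Ty Δ B₁}
    (hZ₁ : E'.app ρ h₁ hX₁ z hB₁ = Z) (hZ₂ : E.pt hY m' h₂ hX₂ z hB₂ = Z) {t : M.Tm B₁}
    (ht₁ : (M.app g').app (G.map (Y.map ρ)) h₁ x hB₁ = t)
    (ht₂ : (M.app g).app (G.map m') h₂ x hB₂ = t) :
    (D.app (k.eval m h hP hg)).appTo ρ h₁ hX₁ z hB₁ hZ₁ ht₁ =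
      (ranApp hY k).pt hY m' h₂ hX₂ z hB₂ hZ₂ ht₂ := by
  subst hB hg
  obtain rfl : E.restr hY m hA hX = E' :=
    TyFam.ext_app fun ρ _ _ h₁ hX₁ _ z _ hB₁ =>
      hE ρ h₁ hX₁ z hB₁ _ (RanTy.eval_trans hX rfl hX₁ _) _
  refine Eq.trans ?_ ((ranAppPt hY k).pt_toTmFam m' h₂ hX₂ z hB₂ hZ₂ ht₂).symm
  exact ranAppVal_comp hY k ρ m hm hA hX h₂ hX₂ h₁ hX₁ (𝟙 Δ) (Category.id_comp ρ) _ _ z _ _ _ _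
    (restr_app_id hY hZ₂ ((B.app_congr (by simp) _ _ rfl).trans hB₂)) _
    ((base_app_tmSub (by simp) _ hB₂).trans ht₂) _

/-- The abstraction of the extension. -/
def ranLam (s : D.ran.TmFam E (M.app g)) : D.RanTm (ranPi hY X E) g :=
  RanTm.ofChosen (fun m => base_pi (G.map m) rfl rfl) (fun m => eval_ranPi_restr hY E m rfl rfl)
    (fun _ => rfl)
    (fun m => D.app.symm (s.restr hY m rfl rfl (base_appTm m rfl _ g))) fun {Ξ Θ} σ m h hX hx => by
      have h₁ := (base_trans_eq (T := M.toTyTm) (G := G) (m := Y.map σ) (ρ := m) (A := A)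
        rfl rfl rfl).symm
      refine (D.tmSub_eq_iff_app σ h₁ (base_sub_sub σ m rfl _ _ _) (X.tySub_eval σ m rfl _ _ _) ?_
        h hX hx).2 ?_
      · intro Θ ρ A₁ X₁ _ _ x z B₁ _ _ _ _
        exact E.restr_app_congr hY (by simp) _ _ z _ _ _ _
      · rintro Δ ρ _ rfl A₁ X₁ h₁ hX₁ x z B₁ hB₁ h₂ hX₂ hB₂ Z hZ₁ hZ₂ t ht₁ ht₂
        rw [Equiv.apply_symm_apply, Equiv.apply_symm_apply]
        have h₃ := base_trans (F := G) (Y.map ρ) (Y.map σ ≫ m) rfl h₁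
        have hX₃ := RanTy.eval_trans rfl rfl hX₁ h₃
        have hB₃ := (B.app_congr (G.map_comp (Y.map ρ) (Y.map σ ≫ m)) h₃ _ rfl).trans hB₁
        have hZ₃ := (E.restr_app hY rfl h₁ hX₁ z hB₁ h₃ hX₃ hB₃).symm.trans hZ₁
        have ht₃ := (base_app_tmSub (g := g) (h := base_pi _ rfl rfl) rfl hB₁ hB₃).symm.trans ht₁
        exact (s.appTo_restr hY m rfl rfl _ (ρ ≫ σ) (by simp) h₂ hX₂ z hB₂ hZ₂ ht₂ h₃ hX₃ hB₃ hZ₃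
          ht₃).trans (s.appTo_restr hY (Y.map σ ≫ m) rfl rfl _ ρ rfl h₁ hX₁ z hB₁ hZ₁ ht₁ h₃ hX₃ hB₃
          hZ₃ ht₃).symm

theorem eval_ranLam (s : D.ran.TmFam E (M.app g)) {Θ : C} (m : Y.obj Θ ⟶ U)
    {A' : M.Ty (G.obj (Y.obj Θ))} {X' : D.Ty Θ A'} (hA : M.tySub (G.map m) A = A')
    (hX : X.eval m hA = X') :
    (ranLam hY s).eval m (base_pi _ hA rfl) (eval_ranPi_restr hY E m hA hX) rfl =
      D.app.symm (s.restr hY m hA hX (base_appTm m hA _ g)) := by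
  subst hA hX
  exact RanTm.eval_ofChosen (X := ranPi hY X E) (fun m => base_pi (G.map m) rfl rfl)
    (fun m => eval_ranPi_restr hY E m rfl rfl) (fun _ => rfl)
    (fun m => D.app.symm (s.restr hY m rfl rfl (base_appTm m rfl _ g))) _ m _ _ _

/-- After application in the given model, both sides at `m` have as values the application of `k` at
the points below `m`. -/
theorem ranLam_ranApp (k : D.RanTm (ranPi hY X E) g) : ranLam hY (ranApp hY k) = k := by
  refine RanTm.ext_chosen (fun m => base_pi (G.map m) rfl rfl)
    (fun m => eval_ranPi_restr hY E m rfl rfl) (fun _ => rfl) fun m => ?_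
  rw [eval_ranLam hY _ m rfl rfl, Equiv.symm_apply_eq]
  refine TmFam.ext_app fun ρ _ _ h₁ hX₁ x z _ hB₁ _ ht₁ => ?_
  have h₃ := base_trans (F := G) (Y.map ρ) m rfl h₁
  have hX₃ := RanTy.eval_trans rfl rfl hX₁ h₃
  have hB₃ := (B.app_congr (G.map_comp (Y.map ρ) m) h₃ _ rfl).trans hB₁
  have ht₃ := (base_app_tmSub (g := g) (h := base_pi _ rfl rfl) rfl hB₁ hB₃).symm.trans ht₁
  refine ((ranApp hY k).appTo_restr hY m rfl rfl _ ρ rfl h₁ hX₁ z hB₁ rfl ht₁ h₃ hX₃ hB₃ rfl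
    ht₃).trans ?_
  exact (pt_ranApp hY k m (E' := E.restr hY m rfl rfl) rfl rfl rfl
    (fun _ _ _ _ _ _ _ _ _ _ _ _ => rfl) (base_pi _ rfl rfl)
    (eval_ranPi_restr hY E m rfl rfl) rfl ρ rfl h₁ hX₁ z hB₁ h₃ hX₃ hB₃ rfl rfl ht₁ ht₃).symm

/-- At a point the abstraction is the inverse of application in the given model, which cancels and
leaves the value of `s`. -/
theorem ranApp_ranLam (s : D.ran.TmFam E (M.app g)) : ranApp hY (ranLam hY s) = s := by
  refine TmFam.ext_pt hY fun {Θ} m A' X' h hX x z B' hB Z hZ t ht => ?_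
  have hB₁ : (B.sub (G.map m) h).app (G.map (Y.map (𝟙 Θ))) (base_id (F := Y ⋙ G) Θ A') x = B' :=
    (B.app_congr (by simp) _ _ rfl).trans hB
  have hZ₁ := restr_app_id hY hZ hB₁
  have ht₁ := (base_app_tmSub (g := g) (h := base_pi _ h rfl) (by simp) hB₁ hB).trans ht
  refine (pt_ranApp hY (ranLam hY s) m (E' := E.restr hY m h hX) h rfl hX
    (fun _ _ _ _ _ _ _ _ _ _ _ _ => rfl) (base_pi _ h rfl)
    (eval_ranPi_restr hY E m h hX) rfl (𝟙 Θ) (by simp) _ (D.tySub_id _ X') z hB₁ h hX hB hZ₁ hZ ht₁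
    ht).symm.trans ?_
  rw [eval_ranLam hY s m h hX, Equiv.apply_symm_apply]
  exact s.appTo_restr hY m h hX _ (𝟙 Θ) (by simp) _ _ z hB₁ hZ₁ ht₁ h hX hB hZ ht

/-- Both sides at a point `m` are the application of `k` at `m ≫ n`: `pt_ranApp` is used once for
the restricted term at `m` and once for `k` at `m ≫ n`. -/
theorem ranApp_sub {V : P} (n : V ⟶ U) (k : D.RanTm (ranPi hY X E) g) :
    ranApp hY (k.sub n (M.pi_sub (G.map n) A B) (ranPi_sub hY n E rfl rfl) rfl) =
      TmFam.sub (D := D.ran) (ranApp hY k) n rfl rfl (M.app_sub (G.map n) g).symm := by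
  refine TmFam.ext_pt hY fun {Θ} m A' X' h hX x z B' hB Z hZ t ht => ?_
  have h₂ := base_trans m n rfl h
  have hX₂ := (X.eval_sub n rfl m rfl h h₂).symm.trans hX
  have hB₂ := (B.app_congr (G.map_comp m n) h₂ _ rfl).trans hB
  have hZ₂ := (TyFam.pt_sub hY E n rfl rfl m rfl h hX z hB h₂ hX₂ hB₂).symm.trans hZ
  have ht₂ : (M.app g).app (G.map (m ≫ n)) h₂ x hB₂ = t := by
    refine Eq.trans ?_ ht
    rw [M.app_sub]
    exact (M.app g).app_congr (G.map_comp m n) _ _ rfl _ _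
  refine Eq.trans ?_ (TmFam.pt_sub hY (ranApp hY k) n rfl rfl (M.app_sub (G.map n) g).symm m rfl
    h hX z hB hZ ht h₂ hX₂ hB₂ hZ₂ ht₂).symm
  have hB₁ : ((B.sub (G.map n) rfl).sub (G.map m) h).app (G.map (Y.map (𝟙 Θ)))
      (base_id (F := Y ⋙ G) Θ A') x = B' :=
    ((B.sub (G.map n) rfl).app_congr (by simp)
      (M.toTyTm.tySub_trans _ _ h (base_id (F := Y ⋙ G) Θ A')) h rfl).trans hB
  have hZ₁ := restr_app_id hY hZ hB₁
  -- The family at `m` obtained from the restriction of `E` along `n` has the values of `E` below `m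
  -- ≫ n`, so it can serve as `E'` in both uses of `pt_ranApp`.
  have hE : ∀ {Δ : C} (ρ : Δ ⟶ Θ) {A₁ : M.Ty (G.obj (Y.obj Δ))} {X₁ : D.Ty Δ A₁}
      (h₁ : M.tySub (G.map (Y.map ρ)) A' = A₁) (hX₁ : D.tySub ρ h₁ X' = X₁) {x : M.Tm A₁}
      (z : D.Tm X₁ x) {B₁ : M.Ty (G.obj (Y.obj Δ))}
      (hB₁ : ((B.sub (G.map n) rfl).sub (G.map m) h).app (G.map (Y.map ρ)) h₁ x = B₁)
      (h₂ : M.tySub (G.map (Y.map ρ ≫ m ≫ n)) A = A₁)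
      (hX₂ : X.eval (Y.map ρ ≫ m ≫ n) h₂ = X₁)
      (hB₂ : B.app (G.map (Y.map ρ ≫ m ≫ n)) h₂ x = B₁),
      E.pt hY (Y.map ρ ≫ m ≫ n) h₂ hX₂ z hB₂ =
        (TyFam.restr hY (TyFam.sub (D := D.ran) E n rfl rfl) m h hX).app ρ h₁ hX₁ z hB₁ :=
    fun ρ _ _ h₁ hX₁ x z _ hB₁ h₂ hX₂ hB₂ =>
      (TyFam.pt_sub hY E n rfl rfl (Y.map ρ ≫ m) (Category.assoc _ _ _) _
        (RanTy.eval_trans hX rfl hX₁ _) z _ h₂ hX₂ hB₂).symm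
  have hBB : B.sub (G.map (m ≫ n)) h₂ = (B.sub (G.map n) rfl).sub (G.map m) h :=
    TyTm.TyFam.ext_app fun ρ _ _ _ => B.app_congr (by simp) _ _ rfl
  have hp := base_pi (G.map (m ≫ n)) h₂ hBB
  have hP := eval_ranPi hY E (m ≫ n) h₂ hBB hX₂ hE hp
  have hg := base_tmSub_trans hp (rfl : M.tmSub (G.map n) (M.pi_sub (G.map n) A B) g = _)
    (rfl : M.tmSub (G.map m) (base_pi _ h rfl) _ = _)
  have ht₁ : (M.app (M.tmSub (G.map m) (base_pi _ h rfl)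
      (M.tmSub (G.map n) (M.pi_sub (G.map n) A B) g))).app (G.map (Y.map (𝟙 Θ)))
      (base_id (F := Y ⋙ G) Θ A') x hB₁ = t := (base_app_tmSub (by simp) hB₁ hB).trans ht
  refine (pt_ranApp hY (k.sub n (M.pi_sub (G.map n) A B) (ranPi_sub hY n E rfl rfl) rfl) m
    (E' := TyFam.restr hY (TyFam.sub (D := D.ran) E n rfl rfl) m h hX)
    h rfl hX (fun _ _ _ _ _ _ _ _ _ _ _ _ => rfl) (base_pi _ h rfl)
    (eval_ranPi_restr hY _ m h hX) rfl (𝟙 Θ) (by simp) _ (D.tySub_id _ X') z hB₁ h hX hB hZ₁ hZ ht₁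
    ht).symm.trans ?_
  refine (congrArg (fun W => (D.app W).appTo (𝟙 Θ) _ _ z hB₁ hZ₁ ht₁)
    (k.eval_sub n (M.pi_sub (G.map n) A B) (ranPi_sub hY n E rfl rfl) rfl m rfl
    (base_pi _ h rfl) (eval_ranPi_restr hY _ m h hX) rfl hp hP hg)).trans ?_
  exact pt_ranApp hY k (m ≫ n) h₂ hBB hX₂ hE hp hP hg (𝟙 Θ) (by simp) _ _ z hB₁ h₂ hX₂ hB₂ hZ₁ hZ₂
    ht₁ ht₂

end App

/-! ### Booleans of the extension -/

section Bool

variable {D}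

/-- The type of booleans of the extension. -/
def ranBool (D : DispModel.{u₁, v₁, u₂, v₂, a, b, c, d} M (Y ⋙ G)) (U : P) :
    D.RanTy U (M.bool (G.obj U)) :=
  RanTy.ofChosen (fun m => M.bool_sub (G.map m)) (fun {Θ} _ => D.bool Θ)
    fun σ _ _ => D.bool_sub σ

theorem eval_ranBool {U : P} {Θ : C} (m : Y.obj Θ ⟶ U)
    (h : M.tySub (G.map m) (M.bool (G.obj U)) = M.bool (G.obj (Y.obj Θ))) :
    (ranBool D U).eval m h = D.bool Θ :=
  RanTy.eval_ofChosen (D := D.toDispTyTm) (fun m => M.bool_sub (G.map m)) _ _ m h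

theorem ranBool_sub {U V : P} (n : V ⟶ U) :
    (ranBool D U).sub n (M.bool_sub (G.map n)) = ranBool D V := by
  refine RanTy.ext_chosen (fun m => M.bool_sub (G.map m)) fun m => ?_
  rw [eval_ranBool, RanTy.eval_sub _ n _ m rfl _ (M.bool_sub _), eval_ranBool]

/-- The displayed term `true` of the extension. -/
def ranTt (D : DispModel.{u₁, v₁, u₂, v₂, a, b, c, d} M (Y ⋙ G)) (U : P) :
    D.RanTm (ranBool D U) (M.tt (G.obj U)) :=
  RanTm.ofChosen (fun m => M.bool_sub (G.map m)) (fun m => eval_ranBool m _)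
    (fun m => M.tt_sub (G.map m)) (fun {Θ} _ => D.tt Θ) fun σ _ _ _ _ => D.tt_sub σ

theorem eval_ranTt {U : P} {Θ : C} (m : Y.obj Θ ⟶ U)
    (h : M.tySub (G.map m) (M.bool (G.obj U)) = M.bool (G.obj (Y.obj Θ)))
    (hX : (ranBool D U).eval m h = D.bool Θ)
    (hx : M.tmSub (G.map m) h (M.tt (G.obj U)) = M.tt (G.obj (Y.obj Θ))) :
    (ranTt D U).eval m h hX hx = D.tt Θ :=
  RanTm.eval_ofChosen (X := ranBool D U) (fun m => M.bool_sub (G.map m))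
    (fun m => eval_ranBool m _) (fun m => M.tt_sub (G.map m)) _ _ m h hX hx

theorem ranTt_sub {U V : P} (n : V ⟶ U) :
    (ranTt D U).sub n (M.bool_sub (G.map n)) (ranBool_sub n) (M.tt_sub _) = ranTt D V := by
  refine RanTm.ext_chosen (fun m => M.bool_sub (G.map m)) (fun m => eval_ranBool m _)
    (fun m => M.tt_sub (G.map m)) fun m => ?_
  rw [eval_ranTt, RanTm.eval_sub _ n _ _ _ m rfl _ _ _ (M.bool_sub _) (eval_ranBool _ _)
    (M.tt_sub _), eval_ranTt]

/-- The displayed term `false` of the extension. -/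
def ranFf (D : DispModel.{u₁, v₁, u₂, v₂, a, b, c, d} M (Y ⋙ G)) (U : P) :
    D.RanTm (ranBool D U) (M.ff (G.obj U)) :=
  RanTm.ofChosen (fun m => M.bool_sub (G.map m)) (fun m => eval_ranBool m _)
    (fun m => M.ff_sub (G.map m)) (fun {Θ} _ => D.ff Θ) fun σ _ _ _ _ => D.ff_sub σ

theorem eval_ranFf {U : P} {Θ : C} (m : Y.obj Θ ⟶ U)
    (h : M.tySub (G.map m) (M.bool (G.obj U)) = M.bool (G.obj (Y.obj Θ)))
    (hX : (ranBool D U).eval m h = D.bool Θ)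
    (hx : M.tmSub (G.map m) h (M.ff (G.obj U)) = M.ff (G.obj (Y.obj Θ))) :
    (ranFf D U).eval m h hX hx = D.ff Θ :=
  RanTm.eval_ofChosen (X := ranBool D U) (fun m => M.bool_sub (G.map m))
    (fun m => eval_ranBool m _) (fun m => M.ff_sub (G.map m)) _ _ m h hX hx

theorem ranFf_sub {U V : P} (n : V ⟶ U) :
    (ranFf D U).sub n (M.bool_sub (G.map n)) (ranBool_sub n) (M.ff_sub _) = ranFf D V := by
  refine RanTm.ext_chosen (fun m => M.bool_sub (G.map m)) (fun m => eval_ranBool m _)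
    (fun m => M.ff_sub (G.map m)) fun m => ?_
  rw [eval_ranFf, RanTm.eval_sub _ n _ _ _ m rfl _ _ _ (M.bool_sub _) (eval_ranBool _ _)
    (M.ff_sub _), eval_ranFf]

end Bool

end DispModel

namespace DispModel

open DispTyTm

variable {C : Type u₁} [Category.{v₁} C] {P : Type u} [Category.{v} P]
  {S : Type u₂} [Category.{v₂} S] {M : Model.{u₂, v₂, a, b} S} {Y : C ⥤ P} {G : P ⥤ S}
  {D : DispModel.{u₁, v₁, u₂, v₂, a, b, c, d} M (Y ⋙ G)} (hY : Y.FullyFaithful)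

/-! ### The eliminator of the extension -/

section Elim

theorem base_cancel {U V W : P} {A : M.Ty (G.obj U)} {A' : M.Ty (G.obj V)} {A'' : M.Ty (G.obj W)}
    {ρ : V ⟶ U} {m : W ⟶ V} {m' : W ⟶ U} (hm : m ≫ ρ = m') (h : M.tySub (G.map ρ) A = A')
    (h' : M.tySub (G.map m') A = A'') : M.tySub (G.map m) A' = A'' := by
  subst hm h h'; rw [G.map_comp, M.tySub_comp]

theorem base_tm_cancel {U V W : P} {A : M.Ty (G.obj U)} {A' : M.Ty (G.obj V)}
    {A'' : M.Ty (G.obj W)} {ρ : V ⟶ U} {m : W ⟶ V} {m' : W ⟶ U} (hm : m ≫ ρ = m')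
    {h : M.tySub (G.map ρ) A = A'} {h' : M.tySub (G.map m') A = A''} {x : M.Tm A} {x' : M.Tm A'}
    {x'' : M.Tm A''} (hx : M.tmSub (G.map ρ) h x = x') (hx' : M.tmSub (G.map m') h' x = x'')
    (h'' : M.tySub (G.map m) A' = A'') : M.tmSub (G.map m) h'' x' = x'' := by
  subst hx hx'
  exact (TyTm.tmSub_trans (by rw [← hm, G.map_comp]) h' rfl rfl).symm

/-- Gives the displayed type equation for restriction along `σ` from the two values of `X`, without
mentioning `X` in the conclusion. -/
theorem ranTy_cancel {U : P} {A : M.Ty (G.obj U)} {X : D.RanTy U A} {Ξ Θ : C} {σ : Ξ ⟶ Θ}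
    {m : Y.obj Θ ⟶ U} {m' : Y.obj Ξ ⟶ U} (hm : Y.map σ ≫ m = m') {A' : M.Ty (G.obj (Y.obj Θ))}
    {A'' : M.Ty (G.obj (Y.obj Ξ))} {X' : D.Ty Θ A'} {X'' : D.Ty Ξ A''}
    {h : M.tySub (G.map m) A = A'} {h' : M.tySub (G.map m') A = A''} (hX : X.eval m h = X')
    (hX' : X.eval m' h' = X'') (h'' : M.tySub (G.map (Y.map σ)) A' = A'') :
    D.tySub σ h'' X' = X'' := by
  subst hX hX'; exact X.tySub_eval σ m hm h h'' h'

/-- By `eval_app` at the identity of `U`, instantiating and then reading at `m` is the same as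
instantiating the family restricted at `m`. The pointwise eliminator has its result in the right
displayed type for this reason. -/
theorem eval_inst {U : P} {A : M.Ty (G.obj U)} {B : M.TyFam A} {X : D.RanTy U A}
    (E : D.ran.TyFam X B) {x : M.Tm A} {y : D.RanTm X x} {Θ : C} (m : Y.obj Θ ⟶ U)
    {A' : M.Ty (G.obj (Y.obj Θ))} {X' : D.Ty Θ A'} {x' : M.Tm A'} {y' : D.Tm X' x'}
    (hA : M.tySub (G.map m) A = A') (hX : X.eval m hA = X') (hx : M.tmSub (G.map m) hA x = x')
    (hy : y.eval m hA hX hx = y')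
    (h : M.tySub (G.map m) (B.inst x) = (B.sub (G.map m) hA).inst x') :
    RanTy.eval (E.inst y) m h = (E.restr hY m hA hX).inst y' := by
  have hB : B.app (G.map m) hA x' = (B.sub (G.map m) hA).inst x' :=
    B.app_congr (by simp) _ _ rfl
  have e := E.eval_app hY (𝟙 U) (base_id _ _) (D.ran.tySub_id (base_id _ _) X) y
    (TyTm.TyFam.app_congr B (by simp) (base_id _ _) (M.tySub_id A) rfl) m (Category.comp_id m) hA hX hx
    hy h hA hX hB
  exact e.trans (restr_app_id hY rfl ((B.app_congr (by simp)
    (M.toTyTm.tySub_trans _ _ hA (base_id (F := Y ⋙ G) Θ A')) hA rfl).trans hB)).symm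

variable {U : P} {Q : M.TyFam (M.bool (G.obj U))} (E : D.ran.TyFam (ranBool D U) Q)
  {t : M.Tm (Q.inst (M.tt _))} {s : M.Tm (Q.inst (M.ff _))}
  (t' : D.RanTm (E.inst (ranTt D U)) t) (s' : D.RanTm (E.inst (ranFf D U)) s)
  {x : M.Tm (M.bool (G.obj U))} (y : D.RanTm (ranBool D U) x)

/-- The eliminator of the booleans of the extension. -/
def ranElim : D.RanTm (E.inst y) (M.elim Q t s x) :=
  RanTm.ofChosen (fun m => Q.tySub_inst (G.map m) (M.bool_sub _) rfl)
    (fun m => eval_inst hY E m (M.bool_sub _) (eval_ranBool m _) rfl rfl _)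
    (fun m => M.elim_sub (G.map m) Q t s x)
    (fun m => D.elim (E.restr hY m (M.bool_sub _) (eval_ranBool m _))
      (t'.eval m (Q.tySub_inst (G.map m) (M.bool_sub _) (M.tt_sub _))
        (eval_inst hY E m (M.bool_sub _) (eval_ranBool m _) (M.tt_sub _) (eval_ranTt m _ _ _) _)
        rfl)
      (s'.eval m (Q.tySub_inst (G.map m) (M.bool_sub _) (M.ff_sub _))
        (eval_inst hY E m (M.bool_sub _) (eval_ranBool m _) (M.ff_sub _) (eval_ranFf m _ _ _) _)
        rfl)
      (y.eval m (M.bool_sub _) (eval_ranBool m _) rfl))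
    fun {Ξ Θ} σ m h hX hx => by
      have ht := eval_inst hY E m (M.bool_sub _) (eval_ranBool m _) (M.tt_sub _)
        (eval_ranTt m _ _ _) (Q.tySub_inst (G.map m) (M.bool_sub _) (M.tt_sub _))
      have ht' := eval_inst hY E (Y.map σ ≫ m) (M.bool_sub _) (eval_ranBool _ _) (M.tt_sub _)
        (eval_ranTt _ _ _ _) (Q.tySub_inst (G.map (Y.map σ ≫ m)) (M.bool_sub _) (M.tt_sub _))
      have hs := eval_inst hY E m (M.bool_sub _) (eval_ranBool m _) (M.ff_sub _)
        (eval_ranFf m _ _ _) (Q.tySub_inst (G.map m) (M.bool_sub _) (M.ff_sub _))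
      have hs' := eval_inst hY E (Y.map σ ≫ m) (M.bool_sub _) (eval_ranBool _ _) (M.ff_sub _)
        (eval_ranFf _ _ _ _) (Q.tySub_inst (G.map (Y.map σ ≫ m)) (M.bool_sub _) (M.ff_sub _))
      refine D.tmSub_elim σ (base_sub_sub σ m rfl _ _ _) ?_
        (t'.tmSub_eval σ m rfl _ ht rfl
          (base_cancel rfl (Q.tySub_inst (G.map m) (M.bool_sub _) (M.tt_sub _))
            (Q.tySub_inst (G.map (Y.map σ ≫ m)) (M.bool_sub _) (M.tt_sub _)))
          (ranTy_cancel rfl ht ht' _) (base_tm_cancel rfl rfl rfl _) _ ht' rfl)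
        (s'.tmSub_eval σ m rfl _ hs rfl
          (base_cancel rfl (Q.tySub_inst (G.map m) (M.bool_sub _) (M.ff_sub _))
            (Q.tySub_inst (G.map (Y.map σ ≫ m)) (M.bool_sub _) (M.ff_sub _)))
          (ranTy_cancel rfl hs hs' _) (base_tm_cancel rfl rfl rfl _) _ hs' rfl)
        (y.tmSub_eval σ m rfl _ _ _ _ _ (base_tm_cancel rfl rfl rfl _) _ _ _) h hX hx
      intro Θ ρ A₁ X₁ _ _ x z B₁ _ _ _ _
      exact E.restr_app_congr hY (by simp) _ _ z _ _ _ _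

/-- Motive, branches and scrutinee at `m` are left free up to equations, as in `eval_ranPi`, so that
the lemma applies to restricted data and to data over `C` alike. -/
theorem eval_ranElim {Θ : C} (m : Y.obj Θ ⟶ U) {Q' : M.TyFam (M.bool (G.obj (Y.obj Θ)))}
    (hQ : Q.sub (G.map m) (M.bool_sub _) = Q') {E' : D.TyFam (D.bool Θ) Q'}
    (hE : ∀ {Δ : C} (ρ : Δ ⟶ Θ) {A₁ : M.Ty (G.obj (Y.obj Δ))} {X₁ : D.Ty Δ A₁}
      (h₁ : M.tySub (G.map (Y.map ρ)) (M.bool _) = A₁) (hX₁ : D.tySub ρ h₁ (D.bool Θ) = X₁)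
      {x : M.Tm A₁} (z : D.Tm X₁ x) {B₁ : M.Ty (G.obj (Y.obj Δ))}
      (hB₁ : Q'.app (G.map (Y.map ρ)) h₁ x = B₁)
      (h₂ : M.tySub (G.map (Y.map ρ ≫ m)) (M.bool _) = A₁)
      (hX₂ : (ranBool D U).eval (Y.map ρ ≫ m) h₂ = X₁)
      (hB₂ : Q.app (G.map (Y.map ρ ≫ m)) h₂ x = B₁),
      E.pt hY (Y.map ρ ≫ m) h₂ hX₂ z hB₂ = E'.app ρ h₁ hX₁ z hB₁)
    {t₁ : M.Tm (Q'.inst (M.tt _))} {s₁ : M.Tm (Q'.inst (M.ff _))}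
    {t₁' : D.Tm (E'.inst (D.tt Θ)) t₁} {s₁' : D.Tm (E'.inst (D.ff Θ)) s₁}
    {x₁ : M.Tm (M.bool (G.obj (Y.obj Θ)))} {y₁ : D.Tm (D.bool Θ) x₁}
    {h₁ : M.tySub (G.map m) (Q.inst (M.tt _)) = Q'.inst (M.tt _)}
    {hX₁ : RanTy.eval (E.inst (ranTt D U)) m h₁ = E'.inst (D.tt Θ)}
    {hx₁ : M.tmSub (G.map m) h₁ t = t₁} (ht : t'.eval m h₁ hX₁ hx₁ = t₁')
    {h₂ : M.tySub (G.map m) (Q.inst (M.ff _)) = Q'.inst (M.ff _)}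
    {hX₂ : RanTy.eval (E.inst (ranFf D U)) m h₂ = E'.inst (D.ff Θ)}
    {hx₂ : M.tmSub (G.map m) h₂ s = s₁} (hs : s'.eval m h₂ hX₂ hx₂ = s₁')
    {hx₃ : M.tmSub (G.map m) (M.bool_sub _) x = x₁}
    (hy : y.eval m (M.bool_sub _) (eval_ranBool m _) hx₃ = y₁)
    (h : M.tySub (G.map m) (Q.inst x) = Q'.inst x₁)
    (hX : RanTy.eval (E.inst y) m h = E'.inst y₁)
    (hx : M.tmSub (G.map m) h (M.elim Q t s x) = M.elim Q' t₁ s₁ x₁) :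
    (ranElim hY E t' s' y).eval m h hX hx = D.elim E' t₁' s₁' y₁ := by
  subst hQ
  obtain rfl : E.restr hY m (M.bool_sub _) (eval_ranBool m _) = E' :=
    TyFam.ext_app fun ρ _ _ h₁ hX₁ _ z _ hB₁ =>
      hE ρ h₁ hX₁ z hB₁ _ (RanTy.eval_trans (eval_ranBool m (M.bool_sub _)) rfl hX₁ _) _
  subst hx₃ hy hx₁ ht hx₂ hs
  exact RanTm.eval_ofChosen (fun m => Q.tySub_inst (G.map m) (M.bool_sub _) rfl)
    (fun m => eval_inst hY E m (M.bool_sub _) (eval_ranBool m _) rfl rfl _)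
    (fun m => M.elim_sub (G.map m) Q t s x) _ _ m h hX hx

/-- At a point `m` of `V` both sides are the given eliminator on the data at `m ≫ n`; `eval_ranElim`
is used at `m ≫ n` on one side and at `m` on the other. -/
theorem ranElim_sub {V : P} (n : V ⟶ U)
    {h : M.tySub (G.map n) (Q.inst x) =
      (Q.sub (G.map n) (M.bool_sub _)).inst (M.tmSub (G.map n) (M.bool_sub _) x)}
    {h₁ : M.tySub (G.map n) (Q.inst (M.tt _)) = (Q.sub (G.map n) (M.bool_sub _)).inst (M.tt _)}
    {h₂ : M.tySub (G.map n) (Q.inst (M.ff _)) = (Q.sub (G.map n) (M.bool_sub _)).inst (M.ff _)}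
    {E' : D.ran.TyFam (ranBool D V) (Q.sub (G.map n) (M.bool_sub _))}
    (hE : TyFam.sub (D := D.ran) E n (M.bool_sub _) (ranBool_sub n) = E')
    (hX : RanTy.sub (E.inst y) n h =
      E'.inst (y.sub n (M.bool_sub _) (ranBool_sub n) rfl))
    (hX₁ : RanTy.sub (E.inst (ranTt D U)) n h₁ = E'.inst (ranTt D V))
    (hX₂ : RanTy.sub (E.inst (ranFf D U)) n h₂ = E'.inst (ranFf D V)) :
    (ranElim hY E t' s' y).sub n h hX (M.elim_sub (G.map n) Q t s x) =
      ranElim hY E' (t'.sub n h₁ hX₁ rfl) (s'.sub n h₂ hX₂ rfl)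
        (y.sub n (M.bool_sub _) (ranBool_sub n) rfl) := by
  refine RanTm.ext_chosen
    (fun m => TyTm.TyFam.tySub_inst (Q.sub (G.map n) _) (G.map m) (M.bool_sub _) rfl)
    (fun m => eval_inst hY E' m (M.bool_sub _) (eval_ranBool m _) rfl rfl _)
    (fun m => M.elim_sub (G.map m) _ _ _ _) fun {Θ} m => ?_
  subst hE
  have kt := TyTm.TyFam.tySub_inst (Q.sub (G.map n) (M.bool_sub _)) (G.map m) (M.bool_sub _)
    (M.tt_sub _)
  have kX := eval_inst hY (TyFam.sub (D := D.ran) E n (M.bool_sub _) (ranBool_sub n)) m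
    (M.bool_sub _) (eval_ranBool m _) (M.tt_sub _) (eval_ranTt m _ _ _) kt
  have ks := TyTm.TyFam.tySub_inst (Q.sub (G.map n) (M.bool_sub _)) (G.map m) (M.bool_sub _)
    (M.ff_sub _)
  have kZ := eval_inst hY (TyFam.sub (D := D.ran) E n (M.bool_sub _) (ranBool_sub n)) m
    (M.bool_sub _) (eval_ranBool m _) (M.ff_sub _) (eval_ranFf m _ _ _) ks
  have k := TyTm.TyFam.tySub_inst (Q.sub (G.map n) (M.bool_sub _)) (G.map m) (M.bool_sub _)
    (rfl : _ = M.tmSub (G.map m) _ (M.tmSub (G.map n) (M.bool_sub _) x))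
  have kW := eval_inst hY (TyFam.sub (D := D.ran) E n (M.bool_sub _) (ranBool_sub n)) m
    (M.bool_sub _) (eval_ranBool m _) rfl (y := y.sub n (M.bool_sub _) (ranBool_sub n) rfl) rfl k
  refine (RanTm.eval_sub _ n h hX (M.elim_sub (G.map n) Q t s x) m rfl k kW
    (M.elim_sub (G.map m) _ _ _ _) (base_trans m n h k)
    ((RanTy.eval_of_sub_eq hX m rfl k _).symm.trans kW)
    (base_tmSub_trans _ (M.elim_sub (G.map n) Q t s x) (M.elim_sub (G.map m) _ _ _ _))).trans ?_
  have hQ : Q.sub (G.map (m ≫ n)) (M.bool_sub _) =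
      (Q.sub (G.map n) (M.bool_sub _)).sub (G.map m) (M.bool_sub _) :=
    TyTm.TyFam.ext_app fun ρ _ _ _ => Q.app_congr (by simp) _ _ rfl
  refine (eval_ranElim hY E t' s' y (m ≫ n) hQ ?_
    (RanTm.eval_sub t' n h₁ hX₁ rfl m rfl kt kX rfl (base_trans m n h₁ kt)
      ((RanTy.eval_of_sub_eq hX₁ m rfl kt _).symm.trans kX) (base_tmSub_trans _ rfl rfl)).symm
    (RanTm.eval_sub s' n h₂ hX₂ rfl m rfl ks kZ rfl (base_trans m n h₂ ks)
      ((RanTy.eval_of_sub_eq hX₂ m rfl ks _).symm.trans kZ) (base_tmSub_trans _ rfl rfl)).symm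
    (RanTm.eval_sub y n (M.bool_sub _) (ranBool_sub n) rfl m rfl (M.bool_sub _)
      (eval_ranBool m _) rfl (M.bool_sub _) (eval_ranBool _ _) (base_tmSub_trans _ rfl rfl)).symm
    _ _ _).trans ?_
  · exact fun ρ _ _ h₁ hX₁ x z _ hB₁ h₂ hX₂ hB₂ =>
      (TyFam.pt_sub hY E n (M.bool_sub _) (ranBool_sub n) (Y.map ρ ≫ m) (Category.assoc _ _ _) _
        (RanTy.eval_trans (eval_ranBool m (M.bool_sub _)) rfl hX₁ _) z _ h₂ hX₂ hB₂).symm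
  · exact (eval_ranElim hY _ _ _ _ m rfl (fun _ _ _ _ _ _ _ _ _ _ _ _ => rfl) rfl rfl rfl
      _ _ _).symm

theorem ranElim_tt :
    D.ran.castTm rfl (M.elim_tt Q t s) (ranElim hY E t' s' (ranTt D U)) = t' := by
  have k {Θ : C} (m : Y.obj Θ ⟶ U) := Q.tySub_inst (G.map m) (M.bool_sub _) (M.tt_sub _)
  have kX {Θ : C} (m : Y.obj Θ ⟶ U) := eval_inst hY E m (M.bool_sub _) (eval_ranBool m _)
    (M.tt_sub _) (eval_ranTt m _ _ _) (k m)
  have l {Θ : C} (m : Y.obj Θ ⟶ U) := Q.tySub_inst (G.map m) (M.bool_sub _) (M.ff_sub _)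
  have lX {Θ : C} (m : Y.obj Θ ⟶ U) := eval_inst hY E m (M.bool_sub _) (eval_ranBool m _)
    (M.ff_sub _) (eval_ranFf m _ _ _) (l m)
  refine RanTm.ext_chosen k kX (fun _ => rfl) fun m => ?_
  -- Both base terms compute to the restriction of `t`, by the computation rule before and after
  -- restriction. The equation lets the cast pass from the extension to the given model, where its
  -- computation rule applies.
  have hx : M.tmSub (G.map m) (k m) (M.elim Q t s (M.tt _)) =
      M.elim (Q.sub (G.map m) (M.bool_sub _)) (M.tmSub _ (k m) t)
        (M.tmSub _ (l m) s) (M.tt _) := by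
    rw [M.elim_tt, M.elim_tt]
  refine (RanTm.eval_castTm rfl (M.elim_tt Q t s) _ m _ _ _ (kX m)
    (hx.trans (M.elim_tt _ _ _))).trans ?_
  refine (RanTm.castTm_eval _ m (k m) (kX m) hx rfl (M.elim_tt _ _ _)).symm.trans ?_
  exact (congrArg _ (eval_ranElim hY E t' s' _ m rfl (fun _ _ _ _ _ _ _ _ _ _ _ _ => rfl)
    (hX₁ := kX m) (hx₁ := rfl) rfl (hX₂ := lX m) (hx₂ := rfl) rfl
    (eval_ranTt m _ _ (M.tt_sub _)) (k m) (kX m) hx)).trans (D.elim_tt _ _ _)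

theorem ranElim_ff :
    D.ran.castTm rfl (M.elim_ff Q t s) (ranElim hY E t' s' (ranFf D U)) = s' := by
  have k {Θ : C} (m : Y.obj Θ ⟶ U) := Q.tySub_inst (G.map m) (M.bool_sub _) (M.ff_sub _)
  have kX {Θ : C} (m : Y.obj Θ ⟶ U) := eval_inst hY E m (M.bool_sub _) (eval_ranBool m _)
    (M.ff_sub _) (eval_ranFf m _ _ _) (k m)
  have l {Θ : C} (m : Y.obj Θ ⟶ U) := Q.tySub_inst (G.map m) (M.bool_sub _) (M.tt_sub _)
  have lX {Θ : C} (m : Y.obj Θ ⟶ U) := eval_inst hY E m (M.bool_sub _) (eval_ranBool m _)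
    (M.tt_sub _) (eval_ranTt m _ _ _) (l m)
  refine RanTm.ext_chosen k kX (fun _ => rfl) fun m => ?_
  have hx : M.tmSub (G.map m) (k m) (M.elim Q t s (M.ff _)) =
      M.elim (Q.sub (G.map m) (M.bool_sub _))
        (M.tmSub _ (l m) t)
        (M.tmSub _ (k m) s) (M.ff _) := by
    rw [M.elim_ff, M.elim_ff]
  refine (RanTm.eval_castTm rfl (M.elim_ff Q t s) _ m _ _ _ (kX m)
    (hx.trans (M.elim_ff _ _ _))).trans ?_
  refine (RanTm.castTm_eval _ m (k m) (kX m) hx rfl (M.elim_ff _ _ _)).symm.trans ?_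
  exact (congrArg _ (eval_ranElim hY E t' s' _ m rfl (fun _ _ _ _ _ _ _ _ _ _ _ _ => rfl)
    (hX₁ := lX m) (hx₁ := rfl) rfl (hX₂ := kX m) (hx₂ := rfl) rfl
    (eval_ranFf m _ _ (M.ff_sub _)) (k m) (kX m) hx)).trans (D.elim_ff _ _ _)

end Elim

/-- The extension of a displayed model along a fully faithful functor. -/
def ranModel (D : DispModel.{u₁, v₁, u₂, v₂, a, b, c, d} M (Y ⋙ G)) (hY : Y.FullyFaithful) :
    DispModel.{u, v, u₂, v₂, a, b, max u₁ v c, max u₁ v d} M G where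
  toDispTyTm := D.toDispTyTm.ran
  pi X E := ranPi hY X E
  pi_sub n _ _ _ E := ranPi_sub hY n E rfl rfl
  app :=
    { toFun := ranApp hY
      invFun := ranLam hY
      left_inv := ranLam_ranApp hY
      right_inv := ranApp_ranLam hY }
  app_sub n _ _ _ _ _ k := ranApp_sub hY n k
  bool := ranBool D
  bool_sub := ranBool_sub
  tt := ranTt D
  tt_sub := ranTt_sub
  ff := ranFf D
  ff_sub := ranFf_sub
  elim E _ _ t' s' _ y := ranElim hY E t' s' y
  elim_sub n _ E _ _ t' s' _ y :=
    ranElim_sub hY E t' s' y n (h := TyTm.TyFam.tySub_inst _ _ (M.bool_sub _) rfl) rfl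
      (TyFam.tySub_inst (D := D.ran) E n (M.bool_sub _) (ranBool_sub n) rfl rfl)
      (TyFam.tySub_inst (D := D.ran) E n (M.bool_sub _) (ranBool_sub n) (M.tt_sub _) (ranTt_sub n))
      (TyFam.tySub_inst (D := D.ran) E n (M.bool_sub _) (ranBool_sub n) (M.ff_sub _) (ranFf_sub n))
  elim_tt E _ _ t' s' := ranElim_tt hY E t' s'
  elim_ff E _ _ t' s' := ranElim_ff hY E t' s'

end DispModel

namespace DispModel

open DispTyTm

variable {C : Type u₁} [Category.{v₁} C] {P : Type u} [Category.{v} P]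
  {S : Type u₂} [Category.{v₂} S] {M : Model.{u₂, v₂, a, b} S} {Y : C ⥤ P} {G : P ⥤ S}
  {D : DispModel.{u₁, v₁, u₂, v₂, a, b, c, d} M (Y ⋙ G)} (hY : Y.FullyFaithful)

/-! ### Preservation of the operations by the action of `Y` -/

section Preservation

variable {Γ : C} {A : M.Ty (G.obj (Y.obj Γ))} {B : M.TyFam A}

theorem sub_map_id (B : M.TyFam A) (h : M.tySub (G.map (𝟙 _)) A = A) :
    B.sub (G.map (𝟙 _)) h = B :=
  TyTm.TyFam.ext_app fun _ _ _ _ => B.app_congr (by simp) _ _ rfl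

/-- Puts the relation between `E` and `E'` in the form that `eval_ranPi`, `pt_ranApp` and
`eval_ranElim` require at the point `𝟙`. -/
theorem pt_comp_id {X : D.Ty Γ A} {X' : D.RanTy (Y.obj Γ) A} (hX : RanTy.ofTy hY X = X')
    {E : D.TyFam X B} {E' : D.ran.TyFam X' B} (hE : (ranAction D.toDispTyTm hY).TyFamRel hX E E')
    {Δ : C} (ρ : Δ ⟶ Γ) {A₁ : M.Ty (G.obj (Y.obj Δ))} {X₁ : D.Ty Δ A₁}
    (h₁ : M.tySub (G.map (Y.map ρ)) A = A₁) (hX₁ : D.tySub ρ h₁ X = X₁) {x : M.Tm A₁}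
    (z : D.Tm X₁ x) {B₁ : M.Ty (G.obj (Y.obj Δ))} (hB₁ : B.app (G.map (Y.map ρ)) h₁ x = B₁)
    (h₂ : M.tySub (G.map (Y.map ρ ≫ 𝟙 _)) A = A₁) (hX₂ : X'.eval (Y.map ρ ≫ 𝟙 _) h₂ = X₁)
    (hB₂ : B.app (G.map (Y.map ρ ≫ 𝟙 _)) h₂ x = B₁) :
    E'.pt hY (Y.map ρ ≫ 𝟙 _) h₂ hX₂ z hB₂ = E.app ρ h₁ hX₁ z hB₁ := by
  have hX₃ := (X'.eval_congr (Category.comp_id (Y.map ρ)) h₂ h₁).symm.trans hX₂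
  exact (E'.pt_congr hY (Category.comp_id _) rfl _ _ h₁ hX₃ rfl rfl _ hB₁).trans
    ((tyFamRel_iff hY hX).1 hE ρ h₁ hX₁ hX₃ z hB₁).symm

theorem eval_id_ranPi {X : D.Ty Γ A} {E : D.TyFam X B} {E' : D.ran.TyFam (RanTy.ofTy hY X) B}
    (hE : (ranAction D.toDispTyTm hY).TyFamRel rfl E E')
    (h : M.tySub (G.map (𝟙 _)) (M.pi A B) = M.pi A B) :
    (ranPi hY _ E').eval (𝟙 (Y.obj Γ)) h = D.pi X E :=
  eval_ranPi hY E' (𝟙 _) (base_id _ _) (sub_map_id B _) (RanTy.eval_id_ofTy hY X _)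
    (fun ρ _ _ h₁ hX₁ _ z _ hB₁ h₂ hX₂ hB₂ =>
      pt_comp_id hY rfl hE ρ h₁ hX₁ z hB₁ h₂ hX₂ hB₂) h

theorem eval_id_eq {X : D.Ty Γ A} {X' : D.RanTy (Y.obj Γ) A} (h : RanTy.ofTy hY X = X') :
    X'.eval (𝟙 _) (base_id _ _) = X := by
  subst h; exact RanTy.eval_id_ofTy hY X _

theorem eval_id_castTm {X : D.Ty Γ A} {X' : D.RanTy (Y.obj Γ) A} (h : RanTy.ofTy hY X = X')
    {x : M.Tm A} (z : D.Tm X x) :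
    RanTm.eval (D.ran.castTm h rfl (RanTm.ofTm hY z)) (𝟙 _) (base_id _ _) (eval_id_eq hY h)
      (base_tmSub_id _ _) = z := by
  subst h; exact RanTm.eval_id_ofTm hY z _ _ _

theorem ofTy_bool (Γ : C) : RanTy.ofTy hY (D.bool Γ) = ranBool D (Y.obj Γ) :=
  (RanTy.eq_ofTy hY (eval_ranBool (𝟙 _) (base_id _ _))).symm

theorem ofTm_tt (Γ : C) :
    D.ran.castTm (ofTy_bool hY Γ) rfl (RanTm.ofTm hY (D.tt Γ)) = ranTt D (Y.obj Γ) :=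
  RanTm.ext_id hY (eval_id_eq hY (ofTy_bool hY Γ))
    ((eval_id_castTm hY _ _).trans (eval_ranTt _ _ _ _).symm)

theorem ofTm_ff (Γ : C) :
    D.ran.castTm (ofTy_bool hY Γ) rfl (RanTm.ofTm hY (D.ff Γ)) = ranFf D (Y.obj Γ) :=
  RanTm.ext_id hY (eval_id_eq hY (ofTy_bool hY Γ))
    ((eval_id_castTm hY _ _).trans (eval_ranFf _ _ _ _).symm)

/-- Displayed types and terms at `Y Γ` are determined by their values at the identity, and there
each operation of the extension is the given operation by construction. -/
theorem ranAction_preservesOperations :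
    DispAction.PreservesOperations (D := D) (D' := ranModel D hY)
      (ranAction D.toDispTyTm hY) where
  pi X E E' hE := (RanTy.eq_ofTy hY (eval_id_ranPi hY hE (base_id _ _))).symm
  app X E E' hE g k := by
    refine (tmFamRel_iff hY rfl hE).2 ?_
    intro Δ ρ A' Z h hZ hZ' x z B' hB W hW hW' t' ht
    have hP := eval_id_ranPi hY hE (base_id _ _)
    refine Eq.trans ?_ (pt_ranApp hY _ (𝟙 _) (base_id _ _) (sub_map_id _ _)
      (RanTy.eval_id_ofTy hY X _) (fun ρ _ _ h₁ hX₁ _ z _ hB₁ h₂ hX₂ hB₂ =>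
        pt_comp_id hY rfl hE ρ h₁ hX₁ z hB₁ h₂ hX₂ hB₂) (base_id _ _) hP (base_tmSub_id _ _) ρ
      (Category.comp_id _) h hZ z hB h hZ' hB hW hW' ht ht)
    refine congrArg (fun K => (D.app K).appTo ρ h hZ z hB hW ht) ?_
    exact ((RanTm.eval_castTm _ rfl _ (𝟙 _) (base_id _ _) hP (base_tmSub_id _ _)
      (RanTy.eval_id_ofTy hY _ _) (base_tmSub_id _ _)).trans (RanTm.eval_id_ofTm hY k _ _ _)).symm
  bool := ofTy_bool hY
  tt := ofTm_tt hY
  ff := ofTm_ff hY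
  elim {Γ Q} E E' hE t s t' s' x z := by
    refine RanTm.ext_id hY (h := base_id _ _) (hx := base_tmSub_id _ _)
      (eval_id_eq hY (hE.inst rfl)) ?_
    refine (eval_id_castTm hY (hE.inst rfl) _).trans (Eq.symm ?_)
    exact eval_ranElim hY E' _ _ _ (𝟙 _) (sub_map_id Q _)
      (fun ρ _ _ h₁ hX₁ _ z _ hB₁ h₂ hX₂ hB₂ =>
        pt_comp_id hY (ofTy_bool hY Γ) hE ρ h₁ hX₁ z hB₁ h₂ hX₂ hB₂)
      (eval_id_castTm hY (hE.inst (ofTm_tt hY Γ)) t')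
      (eval_id_castTm hY (hE.inst (ofTm_ff hY Γ)) s') (eval_id_castTm hY (ofTy_bool hY Γ) z) _ _ _

end Preservation

end DispModel

/-! ### Points of the displayed presheaf category -/

namespace DispPsh

variable {C : Type u₁} [Category.{v} C] {S : Type u₂} [Category.{v₂} S] {F : C ⥤ S}

/-- The morphism from a representable object given by an element, by the Yoneda lemma. -/
def point (U : DispPsh F) {Θ : C} (γ : F.obj Θ ⟶ U.base) (x : U.fib γ) :
    (dispYoneda F).obj Θ ⟶ U where
  base := γ
  app _ _ h g := U.res g.1 (by rw [g.2]; exact h) x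
  nat σ _ _ _ _ h k k' h' g := U.res_comp σ g.1 _ _ _ x

/-- The element of `U` that corresponds to a morphism from a representable object. -/
def elem {U : DispPsh F} {Θ : C} (m : (dispYoneda F).obj Θ ⟶ U) : U.fib (Hom.base m) :=
  Hom.app m (𝟙 (F.obj Θ)) (Category.id_comp _) ⟨𝟙 Θ, F.map_id Θ⟩

theorem elem_point {U : DispPsh F} {Θ : C} (γ : F.obj Θ ⟶ U.base) (x : U.fib γ) :
    elem (U.point γ x) = x :=
  U.res_id _ x

/-- The Yoneda argument: `g` is the restriction of the identity along itself, and `m` commutes with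
restriction. -/
theorem app_eq_res {U : DispPsh F} {Θ : C} (m : (dispYoneda F).obj Θ ⟶ U) {Ξ : C}
    {γ : F.obj Ξ ⟶ F.obj Θ} {δ : F.obj Ξ ⟶ U.base} (h : γ ≫ Hom.base m = δ)
    (g : { g : Ξ ⟶ Θ // F.map g = γ }) (h' : F.map g.1 ≫ Hom.base m = δ) :
    Hom.app m γ h g = U.res g.1 h' (elem m) := by
  obtain ⟨g, rfl⟩ := g
  refine Eq.trans ?_ (Hom.nat m g (Category.comp_id (F.map g)) (Category.id_comp _) h h' _)
  congr 1
  exact Subtype.ext (Category.comp_id g).symm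

theorem elem_map_comp {U : DispPsh F} {Ξ Θ : C} (σ : Ξ ⟶ Θ) (m : (dispYoneda F).obj Θ ⟶ U) :
    elem ((dispYoneda F).map σ ≫ m) = U.res σ rfl (elem m) := by
  refine (app_eq_res m _ _
    (congrArg (fun τ => F.map τ ≫ Hom.base m) (Category.id_comp σ))).trans ?_
  have : ∀ (τ : Ξ ⟶ Θ) (_ : τ = σ) (h : F.map τ ≫ Hom.base m = F.map σ ≫ Hom.base m),
      U.res τ h (elem m) = U.res σ rfl (elem m) := by
    rintro _ rfl _; rfl
  exact this _ (Category.id_comp σ) _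

theorem point_elem {U : DispPsh F} {Θ : C} (m : (dispYoneda F).obj Θ ⟶ U) :
    U.point (Hom.base m) (elem m) = m :=
  Hom.ext' rfl fun _ _ h _ g => (app_eq_res m h g _).symm

theorem map_comp_point {U : DispPsh F} {Ξ Θ : C} (σ : Ξ ⟶ Θ) {γ : F.obj Θ ⟶ U.base}
    {γ' : F.obj Ξ ⟶ U.base} (h : F.map σ ≫ γ = γ') (x : U.fib γ) :
    (dispYoneda F).map σ ≫ U.point γ x = U.point γ' (U.res σ h x) := by
  subst h
  exact Hom.ext' rfl fun _ _ _ _ g => U.res_comp _ _ _ _ _ _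

theorem point_comp {U V : DispPsh F} (n : U ⟶ V) {Θ : C} {γ : F.obj Θ ⟶ U.base}
    {δ : F.obj Θ ⟶ V.base} (h : γ ≫ Hom.base n = δ) (x : U.fib γ) :
    U.point γ x ≫ n = V.point δ (Hom.app n γ h x) := by
  subst h
  exact Hom.ext' rfl fun _ _ _ _ g => Hom.nat n _ _ _ _ _ _

/-- The displayed Yoneda embedding is fully faithful. -/
def fullyFaithfulDispYoneda (F : C ⥤ S) : (dispYoneda F).FullyFaithful where
  -- By the Yoneda lemma `m` corresponds to an element of `Y` of the target over its base morphism: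
  -- a morphism of `C` with a proof that `F` sends it there.
  preimage m := (elem m).1
  map_preimage m := Hom.ext' (elem m).2 fun _ _ _ h g =>
    (app_eq_res m h g ((congrArg (· ≫ Hom.base m) g.2).trans h)).symm
  preimage_map g := Category.id_comp g

end DispPsh

/-! ### Context extensions of the extension to the displayed presheaf category -/

section

variable {A : Type u} [Category.{v} A] {B : Type u₁} [Category.{v₁} B]

/-- Sections of a presheaf are determined by their value at a terminal object; hence restriction
along a functor that preserves a terminal object is bijective on sections. -/
theorem bijective_sections_of_isTerminal (L : A ⥤ B) {t : A} (ht : Limits.IsTerminal t)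
    (hLt : Limits.IsTerminal (L.obj t)) (P : Bᵒᵖ ⥤ Type w) :
    Function.Bijective (fun s : P.sections =>
      (⟨fun U => s.1 (L.op.obj U), fun m => s.2 (L.op.map m)⟩ : (L.op ⋙ P).sections)) := by
  constructor
  · intro s s' h
    refine Subtype.ext (funext fun U => ?_)
    have := congrFun (congrArg Subtype.val h) (Opposite.op t)
    rw [← s.2 (hLt.from U.unop).op, ← s'.2 (hLt.from U.unop).op]
    exact congrArg _ this
  · intro r
    refine ⟨⟨fun U => P.map (hLt.from U.unop).op (r.1 (Opposite.op t)), ?_⟩, ?_⟩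
    · intro U V f
      have : (hLt.from V.unop) = f.unop ≫ hLt.from U.unop := hLt.hom_ext _ _
      beta_reduce
      rw [this, op_comp, P.map_comp]
      rfl
    · refine Subtype.ext (funext fun U => ?_)
      have : hLt.from (L.obj U.unop) = L.map (ht.from U.unop) := hLt.hom_ext _ _
      refine Eq.trans ?_ (r.2 (ht.from U.unop).op)
      change P.map (hLt.from (L.obj U.unop)).op _ = P.map (L.map (ht.from U.unop)).op _
      rw [this]

end

namespace DispTyTm

open DispPsh

variable {C : Type u₁} [Category.{v} C] {S : Type u₂} [Category.{v₂} S] {F : C ⥤ S}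
  {T : TyTm.{u₂, v₂, a, b} S}
  {D : DispTyTm.{u₁, v, u₂, v₂, a, b, c, v} T (dispYoneda F ⋙ dispProj F)}
  {U : DispPsh F}

/-! ### The object `U ▹ X` and its generic displayed term -/

section Extension

variable {A : T.Ty U.base} (X : D.RanTy U A) (e : T.TermOver A)

/-- The elements of the context extension `U ▹ X` over `γ`. -/
structure ExtFib {Θ : C} (γ : F.obj Θ ⟶ e.dom) where
  fst : U.fib (γ ≫ e.hom)
  snd : D.Tm (X.eval (U.point (γ ≫ e.hom) fst) (T.tySub_comp γ e.hom A)) (T.tmSub γ rfl e.tm)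

namespace ExtFib

variable {X e}

theorem ext_castTm {Θ : C} {γ : F.obj Θ ⟶ e.dom} {w w' : ExtFib X e γ} (h : w.fst = w'.fst)
    (h' : ∀ hX, D.castTm hX rfl w.snd = w'.snd) : w = w' := by
  obtain ⟨u, z⟩ := w
  obtain ⟨u', z'⟩ := w'
  obtain rfl : u = u' := h
  obtain rfl : z = z' := h' rfl
  rfl

theorem base_fst {Ξ Θ : C} {σ : Ξ ⟶ Θ} {γ : F.obj Θ ⟶ e.dom} {γ' : F.obj Ξ ⟶ e.dom}
    (h : F.map σ ≫ γ = γ') : F.map σ ≫ γ ≫ e.hom = γ' ≫ e.hom := by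
  rw [← h, Category.assoc]

/-- The point of a restricted element is the precomposition of the point with `Y σ`, so this is
naturality of `X`. -/
theorem tySub_snd (X : D.RanTy U A) {Ξ Θ : C} {σ : Ξ ⟶ Θ} {γ : F.obj Θ ⟶ e.dom}
    {γ' : F.obj Ξ ⟶ e.dom} (h : F.map σ ≫ γ = γ') (u : U.fib (γ ≫ e.hom)) :
    D.tySub σ (by rw [← h, T.tySub_comp]; rfl)
      (X.eval (U.point (γ ≫ e.hom) u) (T.tySub_comp γ e.hom A)) =
        X.eval (U.point (γ' ≫ e.hom) (U.res σ (base_fst h) u)) (T.tySub_comp γ' e.hom A) :=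
  X.tySub_eval σ _ (map_comp_point σ (base_fst h) u) _ _ _

/-- Restriction of elements of the context extension. -/
def res {Ξ Θ : C} (σ : Ξ ⟶ Θ) {γ : F.obj Θ ⟶ e.dom} {γ' : F.obj Ξ ⟶ e.dom}
    (h : F.map σ ≫ γ = γ') (w : ExtFib X e γ) : ExtFib X e γ' where
  fst := U.res σ (base_fst h) w.fst
  snd := D.tmSub σ _ (tySub_snd X h w.fst) (T.tmSub_trans h rfl rfl rfl).symm w.snd

end ExtFib

/-- The object `U ▹ X` of the displayed presheaf category. -/
def extPsh : DispPsh F where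
  base := e.dom
  fib := ExtFib X e
  res := ExtFib.res
  res_id _ _ := ExtFib.ext_castTm (U.res_id _ _) fun hX =>
    (D.castTm_tmSub _ _ _ _ hX rfl _).trans (D.tmSub_id _ _ _ _)
  res_comp τ σ _ _ _ h _ _ w :=
    ExtFib.ext_castTm (U.res_comp τ σ (ExtFib.base_fst h) _ _ w.fst) fun hX =>
      (D.castTm_tmSub _ _ _ _ hX rfl _).trans (D.tmSub_comp _ _ _ _ _ _ _ _ _ _ _ _)

/-- The projection of the context extension. -/
def extHom : extPsh X e ⟶ U where
  base := e.hom
  app γ _ h w := h ▸ w.fst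
  nat σ _ _ _ _ h k k' h' w := by
    subst k k'; rfl

/-- Identifies the point at which the second component of an element lives with `m` followed by the
projection; so that component has the displayed type required of a value at `m` of the generic term.
-/
theorem elem_comp_extHom {Θ : C} (m : (dispYoneda F).obj Θ ⟶ extPsh X e) :
    U.point (Hom.base m ≫ e.hom) (ExtFib.fst (elem m)) = m ≫ extHom X e := by
  conv_rhs => rw [← point_elem m]
  exact (point_comp (extHom X e) rfl (elem m)).symm

/-- Naturality of the generic term: restriction of elements of `U ▹ X` restricts their second
components. -/
theorem tmSub_elem {Ξ Θ : C} (σ : Ξ ⟶ Θ) (m : (dispYoneda F).obj Θ ⟶ extPsh X e)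
    (h hX hx) : D.tmSub σ h hX hx (ExtFib.snd (elem m)) =
      ExtFib.snd (elem ((dispYoneda F).map σ ≫ m)) := by
  have key : ∀ (w : ExtFib X e (F.map σ ≫ Hom.base m)) (_ : w = ExtFib.res σ rfl (elem m)) (hX hx),
      D.tmSub σ h hX hx (ExtFib.snd (elem m)) = w.snd := by
    rintro _ rfl _ _; rfl
  exact key _ (elem_map_comp σ m) _ _

/-- The generic displayed term over the context extension. -/
def extTm : D.RanTm (X.sub (extHom X e) rfl) e.tm :=
  RanTm.ofChosen (fun _ => rfl)
    (fun m => (X.eval_sub (extHom X e) rfl m (elem_comp_extHom X e m).symm rfl _))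
    (fun _ => rfl) (fun m => ExtFib.snd (elem m)) fun σ m h hX hx => tmSub_elem X e σ m h hX hx

theorem eval_extTm {Θ : C} {m : (dispYoneda F).obj Θ ⟶ extPsh X e} {γ : F.obj Θ ⟶ e.dom}
    (w : ExtFib X e γ) (hm : (extPsh X e).point γ w = m) (h hX hx) :
    (extTm X e).eval m (A' := T.tySub γ (T.tySub e.hom A)) h hX hx = w.snd := by
  subst hm
  have key : ∀ (w' : ExtFib X e γ) (_ : w' = w) (hX'),
      (extTm X e).eval ((extPsh X e).point γ w) h hX' hx = w'.snd →
      (extTm X e).eval ((extPsh X e).point γ w) h hX hx = w.snd := by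
    rintro _ rfl _ h; exact h
  exact key _ (elem_point (U := extPsh X e) γ w)
    (X.eval_sub (extHom X e) rfl _ (elem_comp_extHom X e _).symm rfl _)
    (RanTm.eval_ofChosen (fun _ => rfl)
      (fun m => (X.eval_sub (extHom X e) rfl m (elem_comp_extHom X e m).symm rfl _))
      (fun _ => rfl) (fun m => ExtFib.snd (elem m)) _ _ _ _ _)

/-! ### Universal property of `U ▹ X` -/

section Lift

variable {X e} {V : DispPsh F} {n : V ⟶ U} {x : T.Tm (T.tySub (Hom.base n) A)}
  (y : D.RanTm (X.sub n rfl) x) {b : V.base ⟶ e.dom} (hb : b ≫ e.hom = Hom.base n)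
  (ht : ∀ h : T.tySub b (T.tySub e.hom A) = T.tySub (Hom.base n) A, T.tmSub b h e.tm = x)

theorem extLift_fst (hb : b ≫ e.hom = Hom.base n) {Θ : C} {γ : F.obj Θ ⟶ V.base}
    {δ : F.obj Θ ⟶ e.dom} (h : γ ≫ b = δ) : γ ≫ Hom.base n = δ ≫ e.hom := by
  rw [← h, ← hb, Category.assoc]

theorem extLift_ty (hb : b ≫ e.hom = Hom.base n) {Θ : C} {γ : F.obj Θ ⟶ V.base}
    {δ : F.obj Θ ⟶ e.dom} (h : γ ≫ b = δ) :
    T.tySub γ (T.tySub (Hom.base n) A) = T.tySub δ (T.tySub e.hom A) := by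
  rw [← T.tySub_comp, ← T.tySub_comp, extLift_fst hb h]

/-- The morphism into the context extension given by a displayed term. -/
def extLift : V ⟶ extPsh X e where
  base := b
  app γ δ h v :=
    { fst := Hom.app n γ (extLift_fst hb h) v
      snd := y.eval (V.point γ v) (extLift_ty hb h) (X.eval_sub n rfl _ (point_comp n _ v) _ _)
        (TyTm.tmSub_trans h rfl (ht (by rw [← hb, T.tySub_comp])) rfl).symm }
  nat σ γ γ' δ δ' h k k' h' v := ExtFib.ext_castTm (Hom.nat n σ h _ _ _ v) fun hX =>
    (RanTm.castTm_eval _ _ _ _ _ hX rfl).trans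
      (y.tmSub_eval σ _ (map_comp_point σ h v) _ _ _ _ _ _ _ _ _).symm

theorem extLift_extHom : extLift y hb ht ≫ extHom X e = n :=
  Hom.ext' hb fun γ δ h h' v => by
    have key : ∀ (δ' : F.obj _ ⟶ U.base) (k : γ ≫ Hom.base n = δ') (hδ : δ' = δ),
        hδ ▸ Hom.app n γ k v = Hom.app n γ h' v := by
      rintro _ _ rfl; rfl
    exact key _ _ _

/-- At a point `m`, the composite with the lift is the point of the lifted element, whose second
component was chosen to be the value of `y` there. -/
theorem extTm_extLift (h hX hx) : (extTm X e).sub (extLift y hb ht) h hX hx = y := by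
  refine RanTm.ext_chosen (A₀ := fun m => T.tySub (Hom.base m ≫ b) (T.tySub e.hom A))
    (fun m => extLift_ty hb rfl)
    (fun {Θ} m => X.eval_sub n rfl m (m' := U.point _ (Hom.app n _ (extLift_fst hb rfl) (elem m)))
      (by conv_lhs => rw [← point_elem m]
          exact point_comp n _ _) _ (T.tySub_comp (Hom.base m ≫ b) e.hom A))
    (x₀ := fun m => T.tmSub (Hom.base m ≫ b) rfl e.tm)
    (fun m => (TyTm.tmSub_trans rfl rfl (ht (by rw [← hb, T.tySub_comp])) rfl).symm) fun {Θ} m => ?_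
  have e₁ : m ≫ extLift y hb ht =
      (extPsh X e).point _ (Hom.app (extLift y hb ht) (Hom.base m) rfl (elem m)) := by
    conv_lhs => rw [← point_elem m]
    exact point_comp _ _ _
  refine (RanTm.eval_sub _ _ h hX hx m e₁ _ _ _ rfl
    (X.eval_sub (extHom X e) rfl _ (point_comp (extHom X e) rfl _) _ _) rfl).trans ?_
  refine (eval_extTm X e (Hom.app (extLift y hb ht) (Hom.base m) rfl (elem m)) rfl rfl
    (X.eval_sub (extHom X e) rfl _ (point_comp (extHom X e) rfl _) _ _) rfl).trans ?_
  exact y.eval_congr (point_elem m) _ _ _ _ _ _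

/-- The first component of an image under `m` is fixed by the projection, and the second is the
value of the generic term at that point, hence fixed by `y`. -/
theorem extLift_unique (m : V ⟶ extPsh X e) (hm : m ≫ extHom X e = n) (hmb : Hom.base m = b)
    {h hX hx} (hy : (extTm X e).sub m h hX hx = y) : m = extLift y hb ht := by
  subst hmb hm hy
  refine Hom.ext' rfl fun γ δ k k' v => ?_
  have hfst : ExtFib.fst (Hom.app m γ k v) =
      Hom.app (m ≫ extHom X e) γ (extLift_fst hb k) v := by
    subst k; rfl
  refine ExtFib.ext_castTm hfst fun hX' => ?_
  have hw := X.eval_sub (extHom X e) rfl _ (point_comp (extHom X e) rfl (Hom.app m γ k v)) rfl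
    (T.tySub_comp δ e.hom A)
  refine (congrArg (D.castTm hX' rfl)
    (eval_extTm X e (Hom.app m γ k v) rfl rfl hw rfl)).symm.trans ?_
  refine (RanTm.castTm_eval _ _ _ _ _ hX' rfl).trans (Eq.symm ?_)
  exact RanTm.eval_sub _ m h hX hx _ (point_comp m k v) _ _ _ rfl (hw.trans hX') rfl

end Lift

end Extension

variable {A : T.Ty ((dispProj F).obj U)} (X : D.ran.Ty U A) {e : T.TermOver A}

/-- The context extension, with its projection and its generic pair. -/
def extTermOver : D.ran.TermOver X where
  dom := extPsh X e
  hom := extHom X e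
  tm := e.tm
  dtm := extTm X e

/-- The context extension `U ▹ X` has the universal property. -/
def isTerminalExtTermOver (he : Limits.IsTerminal e) :
    Limits.IsTerminal (extTermOver X (e := e)) :=
  -- The base morphism comes from the universal property of the context extension in `S`, which also
  -- forces it in the uniqueness part.
  let lift (V : D.ran.TermOver X) : (⟨V.dom.base, Hom.base V.hom, V.tm⟩ : T.TermOver A) ⟶ e :=
    he.from _
  Limits.IsTerminal.ofUniqueHom
    (fun V =>
      { hom := extLift V.dtm (lift V).comm (lift V).tm
        comm := extLift_extHom V.dtm _ _
        tm := (lift V).tm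
        dtm := fun h hX => extTm_extLift V.dtm (lift V).comm (lift V).tm h hX ((lift V).tm h) })
    fun V m => TermOver.Hom.ext
      (extLift_unique V.dtm (lift V).comm (lift V).tm m.hom m.comm
        (congrArg TyTm.TermOver.Hom.hom (he.hom_ext ((TermOver.fst X).map m) (lift V)))
        (hX := m.disp) (hx := m.tm m.base) (m.dtm m.base m.disp))

/-- Context extensions on `S` lift to the displayed presheaf category. -/
theorem exists_isTerminal_fst (he : Limits.IsTerminal e) : ∃ V : D.ran.TermOver X,
    Nonempty (Limits.IsTerminal V) ∧ Nonempty (Limits.IsTerminal ((TermOver.fst X).obj V)) :=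
  ⟨extTermOver X (e := e), ⟨isTerminalExtTermOver X he⟩, ⟨he⟩⟩

theorem ran_isLocallyRepresentable
    (hT : ∀ {Γ : S} (A : T.Ty Γ), ∃ e : T.TermOver A, Nonempty (Limits.IsTerminal e)) :
    D.ran.IsLocallyRepresentable := fun _ A X =>
  let ⟨_, ⟨he⟩⟩ := hT A
  let ⟨V, hV, _⟩ := exists_isTerminal_fst X he
  ⟨V, hV⟩

/-- Any two context extensions are isomorphic, so it is enough that the constructed one is
preserved. -/
theorem ran_preservesContextExtensions
    (hT : ∀ {Γ : S} (A : T.Ty Γ), ∃ e : T.TermOver A, Nonempty (Limits.IsTerminal e)) :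
    D.ran.PreservesContextExtensions := fun _ A X _ hW =>
  let ⟨_, ⟨he⟩⟩ := hT A
  let ⟨_, ⟨hV⟩, ⟨hV'⟩⟩ := exists_isTerminal_fst X he
  ⟨hV'.ofIso ((TermOver.fst X).mapIso (hV.uniqueUpToIso hW))⟩

theorem ran_preservesVirtualContextExtensions
    (hT : ∀ {Γ : S} (A : T.Ty Γ), ∃ e : T.TermOver A, Nonempty (Limits.IsTerminal e)) :
    PreservesVirtualContextExtensions.{max (v + 1) u₁ u₂ v₂, max u₁ v v₂, u₂, v₂, a, b,
      max u₁ v v₂ c, max u₁ v v₂, w} D.ran := fun _ A X P =>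
  let ⟨_, ⟨he⟩⟩ := hT A
  let ⟨_, ⟨hV⟩, ⟨hV'⟩⟩ := exists_isTerminal_fst X he
  bijective_sections_of_isTerminal (TermOver.fst X) hV hV' P

end DispTyTm

/-! ### The gluing category -/

namespace DispPsh

variable {C : Type u₁} [Category.{v} C] {S : Type u₂} [Category.{v} S] {F : C ⥤ S}

/-- The total space of an object at `Θ`. -/
abbrev Total (U : DispPsh F) (Θ : C) : Type v := Σ γ : F.obj Θ ⟶ U.base, U.fib γ

/-- In the total space the index is part of the element, so the index equation of `res` can be
normalised to `rfl`; `Total.mk_app` does the same for morphisms. -/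
theorem Total.mk_res {U : DispPsh F} {Ξ Θ : C} (σ : Ξ ⟶ Θ) {γ : F.obj Θ ⟶ U.base}
    {γ' : F.obj Ξ ⟶ U.base} (h : F.map σ ≫ γ = γ') (x : U.fib γ) :
    (⟨γ', U.res σ h x⟩ : U.Total Ξ) = ⟨F.map σ ≫ γ, U.res σ rfl x⟩ := by
  subst h; rfl

theorem Total.mk_app {U V : DispPsh F} (m : U ⟶ V) {Θ : C} {γ : F.obj Θ ⟶ U.base}
    {δ : F.obj Θ ⟶ V.base} (h : γ ≫ Hom.base m = δ) (x : U.fib γ) :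
    (⟨δ, Hom.app m γ h x⟩ : V.Total Θ) = ⟨γ ≫ Hom.base m, Hom.app m γ rfl x⟩ := by
  subst h; rfl

theorem Total.mk_cast {U : DispPsh F} {Θ : C} (p : U.Total Θ) {γ : F.obj Θ ⟶ U.base}
    (h : p.1 = γ) : (⟨γ, h ▸ p.2⟩ : U.Total Θ) = p := by
  subst h; rfl

theorem Total.mk_injective {U : DispPsh F} {Θ : C} {γ : F.obj Θ ⟶ U.base} {x y : U.fib γ}
    (h : (⟨γ, x⟩ : U.Total Θ) = ⟨γ, y⟩) : x = y :=
  eq_of_heq (Sigma.mk.inj h).2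

/-- The presheaf of elements of an object of the displayed presheaf category. -/
def total (U : DispPsh F) : Cᵒᵖ ⥤ Type v where
  obj Θ := U.Total Θ.unop
  map σ := ↾fun p => ⟨F.map σ.unop ≫ p.1, U.res σ.unop rfl p.2⟩
  map_id Θ := ConcreteCategory.hom_ext _ _ fun p =>
    (Total.mk_res (𝟙 Θ.unop) (by simp) p.2).symm.trans
      (congrArg (Sigma.mk p.1) (U.res_id _ p.2))
  map_comp σ τ := ConcreteCategory.hom_ext _ _ fun p =>
    (Total.mk_res (τ.unop ≫ σ.unop) (by simp) p.2).symm.trans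
      (congrArg (Sigma.mk (F.map τ.unop ≫ F.map σ.unop ≫ p.1)) (U.res_comp _ _ _ _ _ _))

variable (F)

/-- The comparison functor to the gluing category. -/
def toComma : DispPsh F ⥤ Comma (𝟭 (Cᵒᵖ ⥤ Type v)) (relNerve F) where
  obj U :=
    { left := U.total
      right := U.base
      hom := { app := fun _ => ↾fun p => p.1 } }
  map {U V} m :=
    { left :=
        { app := fun _ => ↾fun p => ⟨p.1 ≫ Hom.base m, Hom.app m p.1 rfl p.2⟩
          naturality := fun Θ Ξ σ => ConcreteCategory.hom_ext _ _ fun p =>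
            (Total.mk_app m (by rw [Category.assoc]) _).symm.trans
              (congrArg (Sigma.mk (F.map σ.unop ≫ p.1 ≫ Hom.base m))
                (Hom.nat m σ.unop rfl rfl _ rfl p.2)) }
      right := Hom.base m }
  map_id U := by
    refine CommaMorphism.ext ?_ rfl
    ext Θ : 2
    refine ConcreteCategory.hom_ext _ _ fun p => ?_
    exact (Total.mk_app (𝟙 U) (Category.comp_id _) p.2).symm.trans
      (congrArg (Sigma.mk p.1) (U.res_id _ p.2))
  map_comp m n := by
    refine CommaMorphism.ext ?_ rfl
    ext Θ : 2
    refine ConcreteCategory.hom_ext _ _ fun p => ?_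
    exact (Total.mk_app (m ≫ n) (Category.assoc _ _ _).symm p.2).symm

variable {F}

/-- The function on total spaces underlying a morphism of the gluing category. -/
def totalMap {U V : DispPsh F} (f : (toComma F).obj U ⟶ (toComma F).obj V) {Θ : C}
    (p : U.Total Θ) : V.Total Θ :=
  f.left.app (Opposite.op Θ) p

/-- This is the commuting square of the comma morphism; it shows that the map of total spaces sends
fibres to fibres. -/
theorem totalMap_fst {U V : DispPsh F} (f : (toComma F).obj U ⟶ (toComma F).obj V) {Θ : C}
    (p : U.Total Θ) : (totalMap f p).1 = p.1 ≫ f.right := by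
  have h := ConcreteCategory.congr_hom (NatTrans.congr_app f.w (Opposite.op Θ)) p
  exact h

theorem totalMap_res {U V : DispPsh F} (f : (toComma F).obj U ⟶ (toComma F).obj V) {Ξ Θ : C}
    (σ : Ξ ⟶ Θ) (p : U.Total Θ) :
    totalMap f ⟨F.map σ ≫ p.1, U.res σ rfl p.2⟩ =
      ⟨F.map σ ≫ (totalMap f p).1, V.res σ rfl (totalMap f p).2⟩ :=
  ConcreteCategory.congr_hom (f.left.naturality σ.op) p

instance : (toComma F).Faithful where
  map_injective {U V m n} h := by
    have hb : Hom.base m = Hom.base n := congrArg CommaMorphism.right h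
    refine Hom.ext' hb fun {Θ} γ δ k k' x => Total.mk_injective ?_
    rw [Total.mk_app m, Total.mk_app n]
    exact congrArg (fun f => totalMap f ⟨γ, x⟩) h

instance : (toComma F).Full where
  map_surjective {U V} f := by
    let m : U ⟶ V :=
      { base := f.right
        -- The image of `x` lies in the fibre prescribed by the commuting square, and is transported
        -- from there to the fibre over `δ`.
        app := fun {Θ} γ δ h x => ((totalMap_fst f ⟨γ, x⟩).trans h) ▸ (totalMap f ⟨γ, x⟩).2
        nat := fun {Ξ Θ} σ γ γ' δ δ' h k k' h' x => by
          refine Total.mk_injective ((Total.mk_cast _ _).trans ?_)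
          rw [Total.mk_res σ h x, totalMap_res f σ ⟨γ, x⟩]
          have key : ∀ p q : V.Total Θ, p = q →
              (⟨F.map σ ≫ p.1, V.res σ rfl p.2⟩ : V.Total Ξ) =
                ⟨F.map σ ≫ q.1, V.res σ rfl q.2⟩ := by
            rintro _ _ rfl; rfl
          exact (key _ _ (Total.mk_cast _ _).symm).trans (Total.mk_res σ h' _).symm }
    refine ⟨m, CommaMorphism.ext ?_ rfl⟩
    ext Θ : 2
    exact ConcreteCategory.hom_ext _ _ fun p => Total.mk_cast (totalMap f p) (totalMap_fst f p)

/-- The object of the displayed presheaf category given by the fibres of an object of the gluing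
category. -/
def ofComma (Z : Comma (𝟭 (Cᵒᵖ ⥤ Type v)) (relNerve F)) : DispPsh F where
  base := Z.right
  fib {Θ} γ := { q : Z.left.obj (Opposite.op Θ) // Z.hom.app (Opposite.op Θ) q = γ }
  res σ _ _ h q := ⟨Z.left.map σ.op q.1, by
    refine Eq.trans (ConcreteCategory.congr_hom (Z.hom.naturality σ.op) q.1) (Eq.trans ?_ h)
    exact congrArg (F.map σ ≫ ·) q.2⟩
  res_id _ q := Subtype.ext (by simp)
  res_comp τ σ _ _ _ _ _ _ q := Subtype.ext (by simp)

/-- The total space of the fibres of an object of the gluing category. -/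
def totalOfComma (Z : Comma (𝟭 (Cᵒᵖ ⥤ Type v)) (relNerve F)) (Θ : C) :
    (ofComma Z).Total Θ ≃ Z.left.obj (Opposite.op Θ) where
  toFun p := p.2.1
  invFun q := ⟨Z.hom.app (Opposite.op Θ) q, q, rfl⟩
  left_inv := by
    rintro ⟨_, q, rfl⟩; rfl
  right_inv _ := rfl

instance : (toComma F).EssSurj where
  -- A presheaf over the nerve is the total space of its fibres; the base object is left unchanged.
  mem_essImage Z := ⟨ofComma Z, ⟨Comma.isoMk
    (NatIso.ofComponents (fun Θ => (totalOfComma Z Θ.unop).toIso) fun _ => rfl)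
    (Iso.refl _) (by
      ext Θ : 2
      refine ConcreteCategory.hom_ext _ _ fun p => ?_
      exact p.2.2.trans (Category.comp_id _).symm)⟩⟩

instance : (toComma F).IsEquivalence where

end DispPsh

end RelativeInduction

/-! ### The main theorem -/

open CategoryTheory RelativeInduction

universe u u₁ u₂ a b c w

theorem mainTheorem5
    {C : Type u₁} [Category.{u} C] {S : Type u₂} [Category.{u} S]
    (M : Model.{u₂, u, a, b} S) (F : C ⥤ S)
    (D : DispModel.{u₁, u, u₂, u, a, b, c, u} M F) :
    dispYoneda F ⋙ dispProj F = F ∧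
    (dispYoneda F).Full ∧ (dispYoneda F).Faithful ∧
    (∃ (D' : DispModel.{max (u + 1) u₁ u₂, max u u₁, u₂, u, a, b, max u u₁ c, max u u₁}
          M (dispProj F))
        (y : DispAction (dispYoneda F) (dispProj F) D.toDispTyTm D'.toDispTyTm),
      D'.IsLocallyRepresentable ∧
      D'.PreservesContextExtensions ∧
      DispTyTm.PreservesVirtualContextExtensions.{max (u + 1) u₁ u₂, max u u₁, u₂, u, a, b,
        max u u₁ c, max u u₁, w} D'.toDispTyTm ∧
      y.IsBijective ∧ y.IsBijectiveOnFamilies ∧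
      DispAction.PreservesOperations (Y := dispYoneda F) (G := dispProj F) (D := D) (D' := D') y) ∧
    (∃ e : DispPsh F ≌ Comma (𝟭 (Cᵒᵖ ⥤ Type u)) (relNerve F),
      Nonempty (e.functor ⋙ Comma.snd _ _ ≅ dispProj F)) := by
  have hT : ∀ {Γ : S} (A : M.Ty Γ), ∃ e : M.toTyTm.TermOver A, Nonempty (Limits.IsTerminal e) :=
    fun A => ⟨M.ext A, ⟨M.extIsTerminal A⟩⟩
  have hY := DispPsh.fullyFaithfulDispYoneda F
  -- The composite `dispYoneda F ⋙ dispProj F` is `F` by definition, so the given model is already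
  -- one over the composite and can be extended along `Y`.
  let D₀ : DispModel.{u₁, u, u₂, u, a, b, c, u} M (dispYoneda F ⋙ dispProj F) := D
  exact ⟨rfl, hY.full, hY.faithful,
    ⟨D₀.ranModel hY, DispTyTm.ranAction D₀.toDispTyTm hY,
      DispTyTm.ran_isLocallyRepresentable hT, DispTyTm.ran_preservesContextExtensions hT,
      DispTyTm.ran_preservesVirtualContextExtensions hT,
      DispTyTm.ranAction_isBijective hY, DispTyTm.ranAction_isBijectiveOnFamilies hY,
      DispModel.ranAction_preservesOperations hY⟩,
    ⟨(DispPsh.toComma F).asEquivalence, ⟨Iso.refl _⟩⟩⟩
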